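/- **Setting.** Let $d\ge 2$ be even, $L\ge 1$, and let $H=H^*$ be a bounded operator on $\ell^2(\mathbb Z^d,\mathbb C^L)$ with $L\times L$ matrix entries $\langle x|H|y\rangle$, such that (i) $H$ has finite range $R$: $\langle x|H|y\rangle=0$ whenever $|x-y|>R$ (Euclidean distance); (ii) $H$ is periodic with periods $p_1,\dots,p_d\ge 1$: $\langle x+p_je_j|H|y+p_je_j\rangle=\langle x|H|y\rangle$ for all $x,y\in\mathbb Z^d$ and $j=1,\dots,d$; (iii) $0\notin\operatorname{spec}(H)$. Put $g=\|H^{-1}\|^{-1}$ and $M=\max_{j}\|[X_j,H]\|$, where $X_1,\dots,X_d$ are the position operators. Let $\hat\gamma_1,\dots,\hat\gamma_{d-1}$ be a selfadjoint irreducible representation on $\mathbb C^{d'}$ of the Clifford algebra with $d-1$ generators, $\hat\gamma_i\hat\gamma_j+\hat\gamma_j\hat\gamma_i=2\delta_{i,j}$, and let $\hat\gamma_d=\imath\mathbf 1$. For an integer $\rho\ge1$ such that $2\rho$ is a multiple of every $p_j$, let $H^{\rm per}_\rho$ be the operator on $\mathcal H_\rho=\ell^2((\mathbb Z/2\rho\mathbb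 Z)^d,\mathbb C^L)$ with entries $\langle x|H^{\rm per}_\rho|y\rangle=\sum_{a\in\mathbb Z^d}\langle x|H|y+2\rho a\rangle$, $x,y\in\{-\rho+1,\dots,\rho\}^d$. For $\eta>0$, the periodic spectral localizer is the Hermitian matrix on $(\mathcal H_\rho\oplus\mathcal H_\rho)\otimes\mathbb C^{d'}$ $$ L^{\rm per}_{\eta,\rho}=\begin{pmatrix}\sum_{j=1}^d(\mathbf 1-\cos(\tfrac{\pi}{\rho}X_j)) & \sum_{j=1}^d\sin(\tfrac{\pi}{\rho}X_j)\hat\gamma_j^*\\ \sum_{j=1}^d\sin(\tfrac{\pi}{\rho}X_j)\hat\gamma_j & -\sum_{j=1}^d(\mathbf 1-\cos(\tfrac{\pi}{\rho}X_j))\end{pmatrix}+\frac1\eta\begin{pmatrix}-H^{\rm per}_\rho&0\\0&H^{\rm per}_\rho\end{pmatrix}. $$ Call $(\eta,\rho)$, with $\eta>0$ real and $\rho\ge1$ an integer, *admissible* if $2\rho$ is an integer multiple of every $p_j$, $\rho\ge 2R$, $\eta\ge\frac g4$, $$ \rho\ \ge\ \frac{15\cdot10^6\,d^4\,M\,\|H\|^3\,\eta^2}{g^6}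 \qquad\text{and}\qquad \Big(1-\frac g{\|H\|}\Big)^2+4\Big(1-\frac\eta{\|H\|}\Big)\ \le\ \frac{g^2}{4\,d\,\eta\,\|H\|}. $$ **Proposition.** If $(\eta,\rho)$ is admissible, then $$(L^{\rm per}_{\eta,\rho})^2\ \ge\ \frac{g^2}{600\,d\,\eta^2}\,\mathbf 1 .$$ If $(\eta,\rho)$ and $(\eta',\rho')$ are both admissible (for the same $H$, $R$, $p_j$ and $\hat\gamma_j$), then $$\operatorname{Sig}(L^{\rm per}_{\eta,\rho})=\operatorname{Sig}(L^{\rm per}_{\eta',\rho'}),$$ where $\operatorname{Sig}$ is the number of positive minus the number of negative eigenvalues, counted with multiplicity. -/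

import Mathlib

namespace PeriodicLocalizer

open scoped Kronecker

/-- The Hilbert space `ℓ²(ℤ^d, ℂ^L)`. -/
abbrev Hilb (d L : ℕ) : Type :=
  lp (fun _ : Fin d → ℤ => EuclideanSpace ℂ (Fin L)) 2

/-- The `L × L` matrix `⟨x|H|y⟩`. -/
noncomputable def kernel {d L : ℕ} (H : Hilb d L →L[ℂ] Hilb d L) (x y : Fin d → ℤ) :
    Matrix (Fin L) (Fin L) ℂ :=
  Matrix.of fun a b => H (lp.single 2 y (EuclideanSpace.single b (1 : ℂ))) x a

/-- `⟨x|H|y⟩` vanishes whenever the Euclidean distance of `x` and `y` exceeds `R`. -/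
def HasFiniteRange {d L : ℕ} (H : Hilb d L →L[ℂ] Hilb d L) (R : ℝ) : Prop :=
  ∀ x y : Fin d → ℤ, R < √(∑ j, ((x j : ℝ) - (y j : ℝ)) ^ 2) → kernel H x y = 0

/-- `⟨x + p_j e_j|H|y + p_j e_j⟩ = ⟨x|H|y⟩` for all `j`. -/
def IsPeriodic {d L : ℕ} (H : Hilb d L →L[ℂ] Hilb d L) (p : Fin d → ℕ) : Prop :=
  ∀ (j : Fin d) (x y : Fin d → ℤ),
    kernel H (x + Pi.single j (p j : ℤ)) (y + Pi.single j (p j : ℤ)) = kernel H x y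

/-- The (unbounded) position operator `X_j` on its maximal domain. -/
noncomputable def position {d : ℕ} (L : ℕ) (j : Fin d) : Hilb d L →ₗ.[ℂ] Hilb d L where
  domain :=
    { carrier := {ψ | Memℓp (fun x : Fin d → ℤ => ((x j : ℤ) : ℂ) • ψ x) 2}
      zero_mem' := by
        have h : (fun x : Fin d → ℤ => ((x j : ℤ) : ℂ) • (0 : Hilb d L) x) = 0 := by
          funext x; simp
        change Memℓp (fun x : Fin d → ℤ => ((x j : ℤ) : ℂ) • (0 : Hilb d L) x) 2
        rw [h]
        exact zero_memℓp
      add_mem' := by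
        intro ψ φ hψ hφ
        have h : (fun x : Fin d → ℤ => ((x j : ℤ) : ℂ) • (ψ + φ) x)
            = (fun x : Fin d → ℤ => ((x j : ℤ) : ℂ) • ψ x)
              + fun x : Fin d → ℤ => ((x j : ℤ) : ℂ) • φ x := by
          funext x; simp
        change Memℓp (fun x : Fin d → ℤ => ((x j : ℤ) : ℂ) • (ψ + φ) x) 2
        rw [h]
        exact Memℓp.add hψ hφ
      smul_mem' := by
        intro c ψ hψ
        have h : (fun x : Fin d → ℤ => ((x j : ℤ) : ℂ) • (c • ψ) x)
            = c • fun x : Fin d → ℤ => ((x j : ℤ) : ℂ) • ψ x := by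
          funext x; exact smul_comm ((x j : ℤ) : ℂ) c (ψ x)
        change Memℓp (fun x : Fin d → ℤ => ((x j : ℤ) : ℂ) • (c • ψ) x) 2
        rw [h]
        exact Memℓp.const_smul hψ c }
  toFun :=
    { toFun := fun ψ => ⟨fun x => ((x j : ℤ) : ℂ) • ψ.1 x, ψ.2⟩
      map_add' := by
        intro ψ φ
        ext x i
        change ((x j : ℤ) : ℂ) * (ψ.1 x i + φ.1 x i)
          = ((x j : ℤ) : ℂ) * ψ.1 x i + ((x j : ℤ) : ℂ) * φ.1 x i
        exact mul_add _ _ _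
      map_smul' := by
        intro c ψ
        ext x
        simp
        ring }

/-- `‖[X_j, H]‖`, the supremum of `‖X_j H ψ - H X_j ψ‖` over the vectors `ψ` of norm at most one
in the domain of the commutator. -/
noncomputable def commutatorNorm {d L : ℕ} (H : Hilb d L →L[ℂ] Hilb d L) (j : Fin d) : ℝ :=
  sSup {r : ℝ | ∃ (ψ : (position L j).domain) (h : H (ψ : Hilb d L) ∈ (position L j).domain),
    ‖(ψ : Hilb d L)‖ ≤ 1 ∧
      r = ‖position L j ⟨H (ψ : Hilb d L), h⟩ - H (position L j ψ)‖}

/-- `M = max_j ‖[X_j, H]‖`. -/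
noncomputable def maxCommutator {d L : ℕ} (H : Hilb d L →L[ℂ] Hilb d L) : ℝ :=
  ⨆ j : Fin d, commutatorNorm H j

/-- `g = ‖H⁻¹‖⁻¹`. -/
noncomputable def gap {d L : ℕ} (H : Hilb d L →L[ℂ] Hilb d L) : ℝ :=
  ‖Ring.inverse H‖⁻¹

/-- The points of the discrete torus `(ℤ/2ρℤ)^d ≅ {-ρ+1, …, ρ}^d`. -/
abbrev Torus (d ρ : ℕ) : Type := Fin d → Finset.Ioc (-(ρ : ℤ)) (ρ : ℤ)

instance instDecidableEqTorus (d ρ : ℕ) : DecidableEq (Torus d ρ) := inferInstance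

/-- The integer vector representing a point of the discrete torus. -/
def Torus.coord {d ρ : ℕ} (x : Torus d ρ) : Fin d → ℤ := fun j => (x j : ℤ)

/-- The finite-volume restriction of `H` with periodic boundary conditions:
`⟨x|H_ρ^per|y⟩ = ∑_{a ∈ ℤ^d} ⟨x|H|y + 2ρa⟩` (a finite sum for `H` of finite range). -/
noncomputable def perHam {d L : ℕ} (H : Hilb d L →L[ℂ] Hilb d L) (ρ : ℕ) :
    Matrix (Torus d ρ × Fin L) (Torus d ρ × Fin L) ℂ :=
  Matrix.of fun u v =>
    ∑ᶠ a : Fin d → ℤ, kernel H u.1.coord (v.1.coord + (2 * (ρ : ℤ)) • a) u.2 v.2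

/-- A selfadjoint irreducible representation on `ℂ^k` of the Clifford algebra with `m`
generators. -/
structure IsIrredCliffordRep {m k : ℕ} (γ : Fin m → Matrix (Fin k) (Fin k) ℂ) : Prop where
  selfadjoint : ∀ i, (γ i).IsHermitian
  clifford : ∀ i j, γ i * γ j + γ j * γ i = if i = j then 2 else 0
  nontrivial : 0 < k
  irreducible : ∀ W : Submodule ℂ (Fin k → ℂ),
    (∀ i, ∀ w ∈ W, (γ i).mulVec w ∈ W) → W = ⊥ ∨ W = ⊤

/-- The matrices `γ̂_1, …, γ̂_{d-1}` together with `γ̂_d = i 𝟏`. -/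
noncomputable def gammaHat {d k : ℕ} (γ : Fin (d - 1) → Matrix (Fin k) (Fin k) ℂ) (j : Fin d) :
    Matrix (Fin k) (Fin k) ℂ :=
  if h : (j : ℕ) < d - 1 then γ ⟨j, h⟩ else Complex.I • (1 : Matrix (Fin k) (Fin k) ℂ)

/-- `sin((π/ρ) X_j)` on `ℓ²((ℤ/2ρℤ)^d, ℂ^L)`. -/
noncomputable def sinX {d : ℕ} (L ρ : ℕ) (j : Fin d) :
    Matrix (Torus d ρ × Fin L) (Torus d ρ × Fin L) ℂ :=
  Matrix.diagonal fun u => ((Real.sin (Real.pi / ρ * (u.1.coord j : ℝ)) : ℝ) : ℂ)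

/-- `cos((π/ρ) X_j)` on `ℓ²((ℤ/2ρℤ)^d, ℂ^L)`. -/
noncomputable def cosX {d : ℕ} (L ρ : ℕ) (j : Fin d) :
    Matrix (Torus d ρ × Fin L) (Torus d ρ × Fin L) ℂ :=
  Matrix.diagonal fun u => ((Real.cos (Real.pi / ρ * (u.1.coord j : ℝ)) : ℝ) : ℂ)

/-- Index set of a basis of `(ℋ_ρ ⊕ ℋ_ρ) ⊗ ℂ^k`. -/
abbrev LocIndex (d L k ρ : ℕ) : Type :=
  ((Torus d ρ × Fin L) × Fin k) ⊕ ((Torus d ρ × Fin L) × Fin k)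

/-- The even periodic spectral localizer `L^per_{η,ρ}`. -/
noncomputable def perLocalizer {d L k : ℕ} (H : Hilb d L →L[ℂ] Hilb d L)
    (γ : Fin (d - 1) → Matrix (Fin k) (Fin k) ℂ) (η : ℝ) (ρ : ℕ) :
    Matrix (LocIndex d L k ρ) (LocIndex d L k ρ) ℂ :=
  Matrix.fromBlocks
    ((∑ j : Fin d, (1 - cosX L ρ j)) ⊗ₖ (1 : Matrix (Fin k) (Fin k) ℂ))
    (∑ j : Fin d, sinX L ρ j ⊗ₖ (gammaHat γ j).conjTranspose)
    (∑ j : Fin d, sinX L ρ j ⊗ₖ gammaHat γ j)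
    (-((∑ j : Fin d, (1 - cosX L ρ j)) ⊗ₖ (1 : Matrix (Fin k) (Fin k) ℂ)))
  + ((1 / η : ℝ) : ℂ) • Matrix.fromBlocks
    (-(perHam H ρ ⊗ₖ (1 : Matrix (Fin k) (Fin k) ℂ))) 0
    0 (perHam H ρ ⊗ₖ (1 : Matrix (Fin k) (Fin k) ℂ))

/-- The signature of a Hermitian matrix: the number of positive eigenvalues minus the number of
negative eigenvalues, counted with multiplicity. -/
noncomputable def signature {n : Type*} [Fintype n] [DecidableEq n] (A : Matrix n n ℂ)
    (hA : A.IsHermitian) : ℤ :=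
  (Nat.card {i : n // 0 < hA.eigenvalues i} : ℤ) - (Nat.card {i : n // hA.eigenvalues i < 0} : ℤ)

/-- The conditions on the parameters `(η, ρ)`, for a Hamiltonian of range `R` and periods `p`. -/
structure Admissible {d L : ℕ} (H : Hilb d L →L[ℂ] Hilb d L) (R : ℝ) (p : Fin d → ℕ)
    (η : ℝ) (ρ : ℕ) : Prop where
  rho_pos : 0 < ρ
  period_dvd : ∀ j, p j ∣ 2 * ρ
  two_range_le : 2 * R ≤ ρ
  rho_ge : 15 * 10 ^ 6 * (d : ℝ) ^ 4 * maxCommutator H * ‖H‖ ^ 3 * η ^ 2 / gap H ^ 6 ≤ ρ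
  eta_pos : 0 < η
  eta_ge : gap H / 4 ≤ η
  flatness : (1 - gap H / ‖H‖) ^ 2 + 4 * (1 - η / ‖H‖) ≤ gap H ^ 2 / (4 * d * η * ‖H‖)

section Hermitian

variable {d L : ℕ} {H : Hilb d L →L[ℂ] Hilb d L}

theorem kernel_eq_inner (x y : Fin d → ℤ) (a b : Fin L) :
    kernel H x y a b = inner ℂ (lp.single 2 x (EuclideanSpace.single a (1 : ℂ)) : Hilb d L)
      (H (lp.single 2 y (EuclideanSpace.single b (1 : ℂ)))) := by
  rw [lp.inner_single_left]
  simp [kernel, EuclideanSpace.inner_single_left]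

theorem kernel_conj (hH : IsSelfAdjoint H) (x y : Fin d → ℤ) (a b : Fin L) :
    star (kernel H x y a b) = kernel H y x b a := by
  rw [kernel_eq_inner, kernel_eq_inner]
  have h := (ContinuousLinearMap.isSelfAdjoint_iff_isSymmetric.mp hH)
    (lp.single 2 y (EuclideanSpace.single b (1 : ℂ)))
    (lp.single 2 x (EuclideanSpace.single a (1 : ℂ)))
  rw [← inner_conj_symm] at h
  simpa using h

theorem IsPeriodic.shift_single {p : Fin d → ℕ} (hp : IsPeriodic H p) (j : Fin d) (n : ℤ) :
    ∀ x y : Fin d → ℤ, kernel H (x + Pi.single j (n * (p j : ℤ)))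
      (y + Pi.single j (n * (p j : ℤ))) = kernel H x y := by
  induction n using Int.induction_on with
  | zero => intro x y; simp
  | succ n ih =>
    intro x y
    rw [add_mul, one_mul, Pi.single_add, ← add_assoc, ← add_assoc, hp, ih]
  | pred n ih =>
    intro x y
    rw [← hp, add_assoc, add_assoc, ← Pi.single_add]
    have : (-(n : ℤ) - 1) * (p j : ℤ) + p j = -(n : ℤ) * p j := by ring
    rw [this, ih]

theorem IsPeriodic.shift {p : Fin d → ℕ} (hp : IsPeriodic H p) {ρ : ℕ} (hρ : ∀ j, p j ∣ 2 * ρ)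
    (a : Fin d → ℤ) (x y : Fin d → ℤ) :
    kernel H (x + (2 * (ρ : ℤ)) • a) (y + (2 * (ρ : ℤ)) • a) = kernel H x y := by
  have key : ∀ s : Finset (Fin d), kernel H (x + ∑ j ∈ s, Pi.single j ((2 * (ρ : ℤ)) * a j))
      (y + ∑ j ∈ s, Pi.single j ((2 * (ρ : ℤ)) * a j)) = kernel H x y := by
    intro s
    induction s using Finset.induction_on with
    | empty => simp
    | insert j s hj ih =>
      rw [Finset.sum_insert hj, add_comm (Pi.single j _), ← add_assoc, ← add_assoc]
      obtain ⟨c, hc⟩ := hρ j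
      have : (2 * (ρ : ℤ)) * a j = (c * a j) * (p j : ℤ) := by
        have : (2 * (ρ : ℤ)) = p j * c := by exact_mod_cast hc
        rw [this]; ring
      rw [this, hp.shift_single, ih]
  have h := key Finset.univ
  rw [Finset.univ_sum_single] at h
  exact h

theorem perHam_isHermitian {p : Fin d → ℕ} {ρ : ℕ} (hH : IsSelfAdjoint H) (hp : IsPeriodic H p)
    (hρ : ∀ j, p j ∣ 2 * ρ) : (perHam H ρ).IsHermitian := by
  ext u v
  simp only [perHam, Matrix.conjTranspose_apply, Matrix.of_apply]
  have h1 : star (∑ᶠ a : Fin d → ℤ,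
      kernel H v.1.coord (u.1.coord + (2 * (ρ : ℤ)) • a) v.2 u.2)
      = ∑ᶠ a : Fin d → ℤ, star (kernel H v.1.coord (u.1.coord + (2 * (ρ : ℤ)) • a) v.2 u.2) :=
    (starAddEquiv (R := ℂ)).toAddMonoidHom.map_finsum_of_injective
      (starAddEquiv (R := ℂ)).injective _
  rw [h1, ← finsum_comp_equiv (Equiv.neg (Fin d → ℤ))]
  refine finsum_congr fun a => ?_
  rw [kernel_conj hH, ← hp.shift hρ a]
  simp

theorem perLocalizer_isHermitian {p : Fin d → ℕ} {ρ k : ℕ} (hH : IsSelfAdjoint H)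
    (hp : IsPeriodic H p) (hρ : ∀ j, p j ∣ 2 * ρ) (γ : Fin (d - 1) → Matrix (Fin k) (Fin k) ℂ)
    (η : ℝ) : (perLocalizer H γ η ρ).IsHermitian := by
  have hs : ∀ j, (sinX (d := d) L ρ j).conjTranspose = sinX L ρ j := by
    intro j
    simp only [sinX, Matrix.diagonal_conjTranspose]
    congr 1; funext u; simp [-Complex.ofReal_sin]
  have hc : ∀ j, (cosX (d := d) L ρ j).conjTranspose = cosX L ρ j := by
    intro j
    simp only [cosX, Matrix.diagonal_conjTranspose]
    congr 1; funext u; simp [-Complex.ofReal_cos]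
  have hh := (perHam_isHermitian hH hp hρ).eq
  unfold perLocalizer Matrix.IsHermitian
  simp [Matrix.conjTranspose_add, Matrix.fromBlocks_conjTranspose, Matrix.conjTranspose_kronecker,
    Matrix.conjTranspose_sum, Matrix.conjTranspose_smul, hs, hc, hh]

end Hermitian

end PeriodicLocalizer

open PeriodicLocalizer
open scoped ComplexOrder

/-!
The square of the localizer is the sum of the squares of its Hamiltonian and of its mass and
position terms, up to anticommutators. These are controlled by the commutators of `H` with the
phases `e^{iπX_j/ρ}`, which are of order `‖[X_j, H]‖ / ρ`. Hence the localizer stays invertible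
while `η` moves from its given value to a very large one, and the signature, being locally constant
on invertible Hermitian matrices, does not change.

At this large `η` two volumes `ρ ≤ ρ' ≤ 2ρ` are compared. Embed the small torus into the large one,
complete the small Hamiltonian by zero and the small mass by the constant `2`; the added sites
contribute a diagonal block and its negative, of total signature zero. The two Hamiltonians differ
only in an outer region where the mass is bounded below, so a kernel vector of a localizer on the
linear path between the two is small there. Up to small errors the gap of the larger Hamiltonian
then applies to it and forces it to vanish. Doubling the volume repeatedly reaches every `ρ'`.
-/

namespace PeriodicLocalizer

open Matrix Topology
open scoped Matrix.Norms.L2Operator Kronecker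

/-! ### Expectation values -/

section Expectation

variable {E : Type*} [NormedAddCommGroup E] [InnerProductSpace ℂ E]

/-- The expectation value `Re ⟨ψ, T ψ⟩` of an operator `T` in the (unnormalised) state `ψ`, as a
real linear functional of `T`. -/
noncomputable def expectation (ψ : E) : (E →L[ℂ] E) →ₗ[ℝ] ℝ :=
  Complex.reLm ∘ₗ ((innerₛₗ ℂ ψ).restrictScalars ℝ) ∘ₗ
    ((ContinuousLinearMap.apply ℂ E ψ).toLinearMap.restrictScalars ℝ)

theorem expectation_apply (ψ : E) (T : E →L[ℂ] E) :
    expectation ψ T = (inner ℂ ψ (T ψ)).re := rfl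

theorem abs_expectation_le (ψ : E) (T : E →L[ℂ] E) : |expectation ψ T| ≤ ‖T‖ * ‖ψ‖ ^ 2 := by
  calc |expectation ψ T| ≤ ‖ψ‖ * ‖T ψ‖ :=
        (Complex.abs_re_le_norm _).trans (norm_inner_le_norm _ _)
    _ ≤ ‖ψ‖ * (‖T‖ * ‖ψ‖) := by gcongr; exact T.le_opNorm ψ
    _ = ‖T‖ * ‖ψ‖ ^ 2 := by ring

theorem expectation_one (ψ : E) : expectation ψ 1 = ‖ψ‖ ^ 2 := by
  rw [expectation_apply, one_apply_eq_self, inner_self_eq_norm_sq_to_K]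
  norm_cast

variable [CompleteSpace E]

theorem expectation_star_mul (ψ : E) (A T : E →L[ℂ] E) :
    expectation ψ (star A * T) = (inner ℂ (A ψ) (T ψ)).re := by
  rw [expectation_apply, mul_apply_eq_comp, ContinuousLinearMap.star_eq_adjoint,
    ContinuousLinearMap.adjoint_inner_right]

theorem expectation_star_mul_mul (ψ : E) (A T : E →L[ℂ] E) :
    expectation ψ (star A * T * A) = expectation (A ψ) T := by
  rw [mul_assoc, expectation_star_mul]
  rfl

theorem expectation_star_mul_self (ψ : E) (A : E →L[ℂ] E) :
    expectation ψ (star A * A) = ‖A ψ‖ ^ 2 := by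
  rw [← expectation_one, ← expectation_star_mul_mul, mul_one]

theorem expectation_star (ψ : E) (T : E →L[ℂ] E) : expectation ψ (star T) = expectation ψ T := by
  rw [← mul_one (star T), expectation_star_mul, one_apply_eq_self, ← inner_conj_symm,
    Complex.conj_re, expectation_apply]

theorem expectation_star_mul_le (ψ : E) (A T : E →L[ℂ] E) :
    expectation ψ (star A * T) ≤ ‖A ψ‖ * ‖T ψ‖ := by
  rw [expectation_star_mul]
  exact (Complex.re_le_norm _).trans (norm_inner_le_norm _ _)

theorem expectation_anticommutator_star_mul_self {T : E →L[ℂ] E} (hT : IsSelfAdjoint T)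
    (V : E →L[ℂ] E) (ψ : E) :
    expectation ψ (star V * V * T + T * (star V * V))
      = 2 * expectation (V ψ) T + 2 * expectation ψ (star V * ⁅V, T⁆) := by
  have hsplit : star V * V * T + T * (star V * V)
      = (2 : ℝ) • (star V * T * V) + (star V * ⁅V, T⁆ + star (star V * ⁅V, T⁆)) := by
    rw [Ring.lie_def, star_mul, star_sub, star_mul, star_mul, star_star, hT.star_eq, two_smul]
    noncomm_ring
  rw [hsplit, map_add, map_add, map_smul, expectation_star_mul_mul, expectation_star, smul_eq_mul]
  ring

end Expectation

/-! ### The signature along paths of invertible matrices -/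

section DiagonalizedOperators

variable {n E : Type*} [Fintype n] [NormedAddCommGroup E] [InnerProductSpace ℂ E]
  {b : OrthonormalBasis n ℂ E} {μ : n → ℝ} {T : E →L[ℂ] E}

theorem expectation_eq_sum_of_apply_basis (hT : ∀ i, T (b i) = μ i • b i) (v : E) :
    expectation v T = ∑ i, μ i * ‖inner ℂ (b i) v‖ ^ 2 := by
  have hTv : T v = ∑ i, (inner ℂ (b i) v * μ i) • b i := by
    conv_lhs => rw [← b.sum_repr' v]
    simp only [map_sum, map_smul, hT, ← Complex.coe_smul, smul_smul]
  rw [expectation_apply, hTv, inner_sum, Complex.re_sum]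
  refine Finset.sum_congr rfl fun i _ => ?_
  rw [inner_smul_right, ← inner_conj_symm v, mul_right_comm, Complex.mul_conj,
    Complex.normSq_eq_norm_sq, ← Complex.ofReal_mul, Complex.ofReal_re, mul_comm]

theorem finrank_le_card_pos (hT : ∀ i, T (b i) = μ i • b i) (V : Submodule ℂ E)
    (hV : ∀ v ∈ V, v ≠ 0 → 0 < expectation v T) :
    Module.finrank ℂ V ≤ Nat.card {i // 0 < μ i} := by
  let f : V →ₗ[ℂ] ({i // 0 < μ i} → ℂ) :=
    (LinearMap.pi fun i : {i // 0 < μ i} => innerₛₗ ℂ (b i)) ∘ₗ V.subtype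
  have hf : Function.Injective f := by
    refine (injective_iff_map_eq_zero f).mpr fun v hv => ?_
    by_contra hne
    have hpos := hV v v.2 (by simpa using hne)
    rw [expectation_eq_sum_of_apply_basis hT] at hpos
    refine hpos.not_ge (Finset.sum_nonpos fun i _ => ?_)
    by_cases hi : 0 < μ i
    · have : inner ℂ (b i) (v : E) = 0 := congrFun hv ⟨i, hi⟩
      simp [this]
    · exact mul_nonpos_of_nonpos_of_nonneg (not_lt.mp hi) (by positivity)
  have := LinearMap.finrank_le_finrank_of_injective hf
  rwa [Module.finrank_fintype_fun_eq_card, ← Nat.card_eq_fintype_card] at this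

theorem inner_eq_zero_of_mem_span_subtype {q : n → Prop} {v : E}
    (hv : v ∈ Submodule.span ℂ (Set.range fun i : {i // q i} => b i)) {i : n} (hi : ¬ q i) :
    inner ℂ (b i) v = 0 := by
  have hle : Submodule.span ℂ (Set.range fun i : {i // q i} => b i) ≤ (innerₛₗ ℂ (b i)).ker := by
    rw [Submodule.span_le]
    rintro _ ⟨j, rfl⟩
    exact b.orthonormal.2 fun h => hi (h ▸ j.2)
  exact hle hv

theorem card_pos_le_card_pos_of_norm_sub_lt {c : OrthonormalBasis n ℂ E} {ν : n → ℝ}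
    {S : E →L[ℂ] E} (hT : ∀ i, T (b i) = μ i • b i) (hS : ∀ i, S (c i) = ν i • c i) {m : ℝ}
    (hm : ∀ i, 0 < μ i → m ≤ μ i) (hST : ‖S - T‖ < m) :
    Nat.card {i // 0 < μ i} ≤ Nat.card {i // 0 < ν i} := by
  have hb : LinearIndependent ℂ fun i : {i // 0 < μ i} => b i :=
    (b.orthonormal.comp _ Subtype.val_injective).linearIndependent
  rw [Nat.card_eq_fintype_card, ← finrank_span_eq_card hb]
  refine finrank_le_card_pos hS _ fun v hv hne => ?_
  have hlower : m * ‖v‖ ^ 2 ≤ expectation v T := by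
    rw [expectation_eq_sum_of_apply_basis hT, ← b.sum_sq_norm_inner_right v, Finset.mul_sum]
    refine Finset.sum_le_sum fun i _ => ?_
    by_cases hi : 0 < μ i
    · exact mul_le_mul_of_nonneg_right (hm i hi) (by positivity)
    · simp [inner_eq_zero_of_mem_span_subtype hv hi]
  have hdiff : |expectation v S - expectation v T| < m * ‖v‖ ^ 2 := by
    rw [← map_sub]
    exact (abs_expectation_le v _).trans_lt (mul_lt_mul_of_pos_right hST (by positivity))
  linarith [(abs_lt.mp hdiff).1]

theorem card_pos_add_card_neg_le (μ : n → ℝ) :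
    Nat.card {i // 0 < μ i} + Nat.card {i // μ i < 0} ≤ Fintype.card n := by
  classical
  rw [Nat.card_eq_fintype_card, Nat.card_eq_fintype_card, ← Fintype.card_subtype_or_disjoint]
  · exact Fintype.card_subtype_le _
  · exact Pi.disjoint_iff.mpr fun i => Prop.disjoint_iff.mpr (by simpa using fun h => h.le)

theorem card_pos_add_card_neg_eq {μ : n → ℝ} (hμ : ∀ i, μ i ≠ 0) :
    Nat.card {i // 0 < μ i} + Nat.card {i // μ i < 0} = Fintype.card n := by
  have hneg : ∀ i, μ i < 0 ↔ ¬ 0 < μ i := fun i =>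
    ⟨fun h => h.le.not_gt, fun h => (not_lt.mp h).lt_of_ne (hμ i)⟩
  simp only [hneg]
  rw [← Nat.card_sum, Nat.card_congr (Equiv.sumCompl _), Nat.card_eq_fintype_card]

theorem exists_pos_forall_le {n : Type*} [Finite n] (μ : n → ℝ) :
    ∃ m > 0, ∀ i, 0 < μ i → m ≤ μ i := by
  have := Fintype.ofFinite n
  rcases (Finset.univ.filter fun i => 0 < μ i).eq_empty_or_nonempty with h | h
  · exact ⟨1, one_pos, fun i hi => (Finset.filter_eq_empty_iff.mp h (Finset.mem_univ i) hi).elim⟩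
  · obtain ⟨j, hj, hmin⟩ := Finset.exists_min_image _ μ h
    exact ⟨μ j, (Finset.mem_filter.mp hj).2, fun i hi => hmin i (by simp [hi])⟩

end DiagonalizedOperators

section Signature

variable {n m : Type*} [Fintype n] [DecidableEq n] [Fintype m] [DecidableEq m] {A B : Matrix n n ℂ}

theorem toEuclideanCLM_eigenvectorBasis (hA : A.IsHermitian) (i : n) :
    toEuclideanCLM (𝕜 := ℂ) A (hA.eigenvectorBasis i)
      = hA.eigenvalues i • hA.eigenvectorBasis i :=
  (WithLp.equiv 2 (n → ℂ)).injective (hA.mulVec_eigenvectorBasis i)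

theorem exists_forall_signature_eq (hA : A.IsHermitian) (hdet : A.det ≠ 0) :
    ∃ ε > 0, ∀ (B : Matrix n n ℂ) (hB : B.IsHermitian), ‖B - A‖ < ε →
      signature B hB = signature A hA := by
  have hne : ∀ i, hA.eigenvalues i ≠ 0 := by
    rw [hA.det_eq_prod_eigenvalues, Finset.prod_ne_zero_iff] at hdet
    exact fun i hi => hdet i (Finset.mem_univ _) (by simp [hi])
  obtain ⟨ε₁, hε₁, hle₁⟩ := exists_pos_forall_le hA.eigenvalues
  obtain ⟨ε₂, hε₂, hle₂⟩ := exists_pos_forall_le (-hA.eigenvalues)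
  refine ⟨min ε₁ ε₂, lt_min hε₁ hε₂, fun B hB hBA => ?_⟩
  obtain ⟨hlt₁, hlt₂⟩ := lt_min_iff.mp hBA
  have hpos : Nat.card {i // 0 < hA.eigenvalues i} ≤ Nat.card {i // 0 < hB.eigenvalues i} := by
    refine card_pos_le_card_pos_of_norm_sub_lt (toEuclideanCLM_eigenvectorBasis hA)
      (toEuclideanCLM_eigenvectorBasis hB) hle₁ ?_
    rwa [← map_sub, l2_opNorm_toEuclideanCLM]
  have hneg : Nat.card {i // hA.eigenvalues i < 0} ≤ Nat.card {i // hB.eigenvalues i < 0} := by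
    have h := card_pos_le_card_pos_of_norm_sub_lt (T := -toEuclideanCLM (𝕜 := ℂ) A)
      (S := -toEuclideanCLM (𝕜 := ℂ) B) (b := hA.eigenvectorBasis) (c := hB.eigenvectorBasis)
      (μ := -hA.eigenvalues) (ν := -hB.eigenvalues)
      (by simp [toEuclideanCLM_eigenvectorBasis hA]) (by simp [toEuclideanCLM_eigenvectorBasis hB])
      hle₂ (by rwa [neg_sub_neg, ← map_sub, l2_opNorm_toEuclideanCLM, norm_sub_rev])
    simpa using h
  have htotalA := card_pos_add_card_neg_eq hne
  have htotalB := card_pos_add_card_neg_le hB.eigenvalues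
  unfold signature
  omega

theorem signature_eq_of_path (f : unitInterval → Matrix n n ℂ) (hf : Continuous f)
    (hherm : ∀ t, (f t).IsHermitian) (hdet : ∀ t, (f t).det ≠ 0) :
    signature (f 0) (hherm 0) = signature (f 1) (hherm 1) := by
  have hloc : IsLocallyConstant fun t => signature (f t) (hherm t) := by
    rw [IsLocallyConstant.iff_eventually_eq]
    intro t
    obtain ⟨ε, hε, hconst⟩ := exists_forall_signature_eq (hherm t) (hdet t)
    filter_upwards [Metric.tendsto_nhds.mp (hf.tendsto t) ε hε] with s hs
    exact hconst _ (hherm s) (by rwa [← dist_eq_norm])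
  exact hloc.apply_eq_of_preconnectedSpace 0 1

theorem signature_eq_countP_roots (hA : A.IsHermitian) :
    signature A hA = (A.charpoly.roots.countP (fun z => 0 < z.re) : ℤ)
      - (A.charpoly.roots.countP (fun z => z.re < 0) : ℤ) := by
  classical
  rw [hA.roots_charpoly_eq_eigenvalues, Multiset.countP_map, Multiset.countP_map, signature,
    Nat.card_eq_fintype_card, Nat.card_eq_fintype_card, Fintype.card_subtype,
    Fintype.card_subtype]
  simp [Finset.card, Finset.filter_val]

theorem signature_submatrix (hA : A.IsHermitian) (e : m ≃ n) :
    signature (A.submatrix e e) (hA.submatrix e) = signature A hA := by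
  rw [signature_eq_countP_roots, signature_eq_countP_roots]
  exact congrArg (fun q : Polynomial ℂ => (q.roots.countP (fun z => 0 < z.re) : ℤ)
    - (q.roots.countP (fun z => z.re < 0) : ℤ)) (charpoly_reindex e.symm A)

theorem signature_congr (h : A = B) (hA : A.IsHermitian) (hB : B.IsHermitian) :
    signature A hA = signature B hB := by
  subst h
  rfl

theorem signature_fromBlocks {D : Matrix m m ℂ} (hA : A.IsHermitian) (hD : D.IsHermitian)
    (hAD : (fromBlocks A 0 0 D).IsHermitian) :
    signature (fromBlocks A 0 0 D) hAD = signature A hA + signature D hD := by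
  rw [signature_eq_countP_roots, signature_eq_countP_roots, signature_eq_countP_roots,
    charpoly_fromBlocks_zero₁₂,
    Polynomial.roots_mul (mul_ne_zero (charpoly_monic _).ne_zero (charpoly_monic _).ne_zero),
    Multiset.countP_add, Multiset.countP_add]
  push_cast
  ring

theorem roots_charpoly_diagonal (f : n → ℂ) :
    (diagonal f).charpoly.roots = Finset.univ.val.map f := by
  rw [charpoly_diagonal, ← Polynomial.roots_multiset_prod_X_sub_C (Finset.univ.val.map f),
    Multiset.map_map]
  rfl

theorem signature_fromBlocks_diagonal_neg (f : n → ℂ)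
    (h : (fromBlocks (diagonal f) 0 0 (-diagonal f)).IsHermitian) :
    signature (fromBlocks (diagonal f) 0 0 (-diagonal f)) h = 0 := by
  have hD : (diagonal f).IsHermitian := (isHermitian_fromBlocks_iff.mp h).1
  rw [signature_fromBlocks hD hD.neg, signature_eq_countP_roots, signature_eq_countP_roots,
    show -diagonal f = diagonal (fun i => -f i) from diagonal_neg f,
    roots_charpoly_diagonal, roots_charpoly_diagonal]
  simp [Multiset.countP_map]

end Signature

/-! ### Commutators with phases -/

section CStarAlgebra

theorem lie_star_of_isSelfAdjoint {A : Type*} [Ring A] [StarRing A] {a : A}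
    (ha : IsSelfAdjoint a) (u : A) : ⁅star u, a⁆ = -star ⁅u, a⁆ := by
  rw [Ring.lie_def, Ring.lie_def, star_sub, star_mul, star_mul, ha.star_eq, neg_sub]

theorem norm_lie_star_of_isSelfAdjoint {A : Type*} [NormedRing A] [StarRing A] [NormedStarGroup A]
    {a : A} (ha : IsSelfAdjoint a) (u : A) : ‖⁅star u, a⁆‖ = ‖⁅u, a⁆‖ := by
  rw [lie_star_of_isSelfAdjoint ha, norm_neg, norm_star]

end CStarAlgebra

section Phase

variable {X : Type*} [DecidableEq X]

/-- Multiplication by the phase `e^{iθ}`. -/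
noncomputable def phase (θ : X → ℝ) : Matrix X X ℂ :=
  diagonal fun x => Complex.exp (θ x * Complex.I)

theorem star_phase (θ : X → ℝ) : star (phase θ) = phase (-θ) := by
  simp [phase, star_eq_conjTranspose, diagonal_conjTranspose, Pi.star_def, ← Complex.exp_conj]

theorem phase_zero : phase (0 : X → ℝ) = 1 := by
  simp [phase]

variable [Fintype X]

/-- Multiplication by a real function, as a diagonal complex matrix. -/
noncomputable def realDiagonal : (X → ℝ) →ₐ[ℝ] Matrix X X ℂ :=
  (diagonalAlgHom ℝ).comp (Complex.ofRealAm.compLeft X)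

theorem realDiagonal_apply (f : X → ℝ) : realDiagonal f = diagonal fun x => (f x : ℂ) := rfl

theorem star_realDiagonal (f : X → ℝ) : star (realDiagonal f) = realDiagonal f := by
  simp [realDiagonal_apply, star_eq_conjTranspose, diagonal_conjTranspose, Pi.star_def]

theorem phase_mul_phase (θ θ' : X → ℝ) : phase θ * phase θ' = phase (θ + θ') := by
  simp [phase, ← Complex.exp_add, add_mul]

theorem phase_mem_unitary (θ : X → ℝ) : phase θ ∈ unitary (Matrix X X ℂ) := by
  simp [Unitary.mem_iff, star_phase, phase_mul_phase, phase_zero]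

theorem realDiagonal_cos (θ : X → ℝ) :
    realDiagonal (fun x => Real.cos (θ x)) = (1 / 2 : ℝ) • (phase θ + star (phase θ)) := by
  rw [star_phase, phase, phase, diagonal_add, realDiagonal_apply, ← diagonal_smul]
  congr 1
  funext x
  simp only [Complex.ofReal_cos, Complex.cos, Pi.smul_apply, Pi.neg_apply, Complex.ofReal_neg,
    Complex.real_smul]
  push_cast
  ring

theorem realDiagonal_sin (θ : X → ℝ) :
    realDiagonal (fun x => Real.sin (θ x)) = (-Complex.I / 2) • (phase θ - star (phase θ)) := by
  rw [star_phase, phase, phase, diagonal_sub, realDiagonal_apply, ← diagonal_smul]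
  congr 1
  funext x
  simp only [Complex.ofReal_sin, Complex.sin, Pi.smul_apply, Pi.neg_apply, Complex.ofReal_neg,
    smul_eq_mul]
  ring

theorem realDiagonal_one_sub_cos (θ : X → ℝ) :
    realDiagonal (fun x => 1 - Real.cos (θ x))
      = (1 / 2 : ℝ) • (star (1 - phase θ) * (1 - phase θ)) := by
  have hU := Unitary.star_mul_self_of_mem (phase_mem_unitary θ)
  calc realDiagonal (fun x => 1 - Real.cos (θ x))
      = 1 - (1 / 2 : ℝ) • (phase θ + star (phase θ)) := by
        rw [← realDiagonal_cos, ← map_one realDiagonal, ← map_sub]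
        rfl
    _ = (1 / 2 : ℝ) • (1 - phase θ - star (phase θ) + 1) := by module
    _ = (1 / 2 : ℝ) • (star (1 - phase θ) * (1 - phase θ)) := by
        rw [star_sub, star_one, sub_mul, mul_sub, mul_sub, hU, one_mul, one_mul, mul_one]
        congr 1
        abel

variable {h : Matrix X X ℂ} {θ : X → ℝ} {ε : ℝ}

theorem norm_lie_realDiagonal_cos_le (hh : h.IsHermitian) (hε : ‖⁅phase θ, h⁆‖ ≤ ε) :
    ‖⁅realDiagonal (fun x => Real.cos (θ x)), h⁆‖ ≤ ε := by
  have hstar := norm_lie_star_of_isSelfAdjoint hh (phase θ)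
  have hlie : ⁅realDiagonal (fun x => Real.cos (θ x)), h⁆
      = (1 / 2 : ℝ) • (⁅phase θ, h⁆ + ⁅star (phase θ), h⁆) := by
    rw [realDiagonal_cos, Ring.lie_def, Ring.lie_def, Ring.lie_def, smul_mul_assoc, mul_smul_comm,
      ← smul_sub, add_mul, mul_add, add_sub_add_comm]
  rw [hlie, norm_smul, Real.norm_of_nonneg (by norm_num)]
  linarith [norm_add_le ⁅phase θ, h⁆ ⁅star (phase θ), h⁆]

theorem norm_lie_realDiagonal_sin_le (hh : h.IsHermitian) (hε : ‖⁅phase θ, h⁆‖ ≤ ε) :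
    ‖⁅realDiagonal (fun x => Real.sin (θ x)), h⁆‖ ≤ ε := by
  have hstar := norm_lie_star_of_isSelfAdjoint hh (phase θ)
  have hlie : ⁅realDiagonal (fun x => Real.sin (θ x)), h⁆
      = (-Complex.I / 2) • (⁅phase θ, h⁆ - ⁅star (phase θ), h⁆) := by
    rw [realDiagonal_sin, Ring.lie_def, Ring.lie_def, Ring.lie_def, smul_mul_assoc, mul_smul_comm,
      ← smul_sub, sub_mul, mul_sub, sub_sub_sub_comm]
  have hnorm : ‖-Complex.I / 2‖ = 1 / 2 := by simp
  rw [hlie, norm_smul, hnorm]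
  linarith [norm_sub_le ⁅phase θ, h⁆ ⁅star (phase θ), h⁆]

end Phase

/-! ### Localizers in a Clifford frame -/

/-- Matrices over `X` represented on a Hilbert space `E` by `Φ`, together with a grading `J` and
anticommuting generators `Γ` that commute with the represented matrices. It abstracts the action
of the periodic spectral localizer: the estimates in one volume and the comparison of two volumes
only use these relations. -/
structure LocalizerFrame (X E : Type*) [Fintype X] [DecidableEq X] [NormedAddCommGroup E]
    [InnerProductSpace ℂ E] [CompleteSpace E] (d : ℕ) where
  Φ : Matrix X X ℂ →⋆ₐ[ℂ] (E →L[ℂ] E)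
  J : E →L[ℂ] E
  Γ : Fin d → E →L[ℂ] E
  star_J : star J = J
  J_sq : J * J = 1
  star_Γ : ∀ j, star (Γ j) = Γ j
  clifford : ∀ i j, Γ i * Γ j + Γ j * Γ i = if i = j then 2 else 0
  J_mul_Γ : ∀ j, J * Γ j = -(Γ j * J)
  J_comm : ∀ A, Commute J (Φ A)
  Γ_comm : ∀ j A, Commute (Γ j) (Φ A)

namespace LocalizerFrame

variable {X E : Type*} [Fintype X] [DecidableEq X] [NormedAddCommGroup E]
    [InnerProductSpace ℂ E] [CompleteSpace E] {d : ℕ} (𝔽 : LocalizerFrame X E d)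

/-- Multiplication by a real function, represented on the Hilbert space of the frame. -/
noncomputable def mult : (X → ℝ) →ₐ[ℝ] (E →L[ℂ] E) :=
  (𝔽.Φ.toAlgHom.restrictScalars ℝ).comp realDiagonal

theorem mult_apply (f : X → ℝ) : 𝔽.mult f = 𝔽.Φ (realDiagonal f) := rfl

theorem norm_Φ_le (A : Matrix X X ℂ) : ‖𝔽.Φ A‖ ≤ ‖A‖ := NonUnitalStarAlgHom.norm_apply_le 𝔽.Φ A

theorem norm_Φ_apply_le {A : Matrix X X ℂ} {b : ℝ} (hA : ‖A‖ ≤ b) (ψ : E) :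
    ‖𝔽.Φ A ψ‖ ≤ b * ‖ψ‖ :=
  (𝔽.Φ A).le_of_opNorm_le ((𝔽.norm_Φ_le A).trans hA) ψ

theorem expectation_Φ_le {A : Matrix X X ℂ} {b : ℝ} (hA : ‖A‖ ≤ b) (ψ : E) :
    expectation ψ (𝔽.Φ A) ≤ b * ‖ψ‖ ^ 2 :=
  ((le_abs_self _).trans (abs_expectation_le _ _)).trans
    (mul_le_mul_of_nonneg_right ((𝔽.norm_Φ_le A).trans hA) (by positivity))

theorem isSelfAdjoint_Φ {h : Matrix X X ℂ} (hh : h.IsHermitian) : IsSelfAdjoint (𝔽.Φ h) :=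
  IsSelfAdjoint.map (x := h) hh 𝔽.Φ

theorem isSelfAdjoint_mult (f : X → ℝ) : IsSelfAdjoint (𝔽.mult f) :=
  𝔽.isSelfAdjoint_Φ (star_realDiagonal f)

theorem norm_mult_apply_sq (f : X → ℝ) (ψ : E) :
    ‖𝔽.mult f ψ‖ ^ 2 = expectation ψ (𝔽.mult (f ^ 2)) := by
  rw [← expectation_star_mul_self, (𝔽.isSelfAdjoint_mult f).star_eq, map_pow, sq]

theorem expectation_mult_nonneg {f : X → ℝ} (hf : 0 ≤ f) (ψ : E) :
    0 ≤ expectation ψ (𝔽.mult f) := by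
  have hsqrt : (fun x => √(f x)) ^ 2 = f := funext fun x => Real.sq_sqrt (hf x)
  rw [← hsqrt, ← norm_mult_apply_sq]
  positivity

theorem expectation_mult_mono {f g : X → ℝ} (hfg : f ≤ g) (ψ : E) :
    expectation ψ (𝔽.mult f) ≤ expectation ψ (𝔽.mult g) := by
  rw [← sub_nonneg, ← map_sub, ← map_sub]
  exact 𝔽.expectation_mult_nonneg (sub_nonneg.mpr hfg) ψ

theorem J_mem_unitary : 𝔽.J ∈ unitary (E →L[ℂ] E) := by
  simp [Unitary.mem_iff, 𝔽.star_J, 𝔽.J_sq]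

theorem Γ_mem_unitary (j : Fin d) : 𝔽.Γ j ∈ unitary (E →L[ℂ] E) := by
  have hsq : (2 : ℂ) • (𝔽.Γ j * 𝔽.Γ j) = (2 : ℂ) • 1 := by
    rw [two_smul, 𝔽.clifford, if_pos rfl, two_smul, one_add_one_eq_two]
  simp [Unitary.mem_iff, 𝔽.star_Γ, smul_right_injective _ two_ne_zero hsq]

/-- The Dirac part `∑ s_j Γ_j` of the localizer. -/
noncomputable def dirac (s : Fin d → X → ℝ) : E →L[ℂ] E := ∑ j, 𝔽.mult (s j) * 𝔽.Γ j

/-- The localizer `J (c - h) + ∑ s_j Γ_j` with mass function `c` and position functions `s_j`. -/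
noncomputable def loc (c : X → ℝ) (s : Fin d → X → ℝ) (h : Matrix X X ℂ) : E →L[ℂ] E :=
  𝔽.J * (𝔽.mult c - 𝔽.Φ h) + 𝔽.dirac s

theorem star_dirac (s : Fin d → X → ℝ) : star (𝔽.dirac s) = 𝔽.dirac s := by
  simp only [dirac, star_sum, star_mul, star_Γ, (𝔽.isSelfAdjoint_mult _).star_eq]
  exact Finset.sum_congr rfl fun j _ => 𝔽.Γ_comm j _

theorem J_mul_dirac (s : Fin d → X → ℝ) : 𝔽.J * 𝔽.dirac s = -(𝔽.dirac s * 𝔽.J) := by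
  simp only [dirac, Finset.mul_sum, Finset.sum_mul, ← Finset.sum_neg_distrib]
  refine Finset.sum_congr rfl fun j _ => ?_
  rw [mult_apply, ← mul_assoc, (𝔽.J_comm _).eq, mul_assoc, J_mul_Γ, mul_neg, mul_assoc]

theorem mult_commute_dirac (f : X → ℝ) (s : Fin d → X → ℝ) :
    Commute (𝔽.mult f) (𝔽.dirac s) :=
  Commute.sum_right _ _ _ fun j _ =>
    (((Commute.all f (s j)).map 𝔽.mult).mul_right (𝔽.Γ_comm j _).symm)

theorem dirac_sq (s : Fin d → X → ℝ) : 𝔽.dirac s ^ 2 = 𝔽.mult (∑ j, s j ^ 2) := by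
  have hexpand : 𝔽.dirac s ^ 2 = ∑ i, ∑ j, 𝔽.mult (s i * s j) * (𝔽.Γ i * 𝔽.Γ j) := by
    simp only [dirac, sq, Finset.sum_mul_sum, map_mul]
    refine Finset.sum_congr rfl fun i _ => Finset.sum_congr rfl fun j _ => ?_
    rw [mul_assoc, ← mul_assoc (𝔽.Γ i), mult_apply, mult_apply, (𝔽.Γ_comm i _).eq]
    simp only [mul_assoc]
  have hexpand' : 𝔽.dirac s ^ 2 = ∑ i, ∑ j, 𝔽.mult (s i * s j) * (𝔽.Γ j * 𝔽.Γ i) := by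
    rw [hexpand, Finset.sum_comm]
    simp only [mul_comm]
  have hdouble : (2 : ℝ) • 𝔽.dirac s ^ 2 = (2 : ℝ) • 𝔽.mult (∑ j, s j ^ 2) := by
    nth_rewrite 1 [two_smul, hexpand]
    rw [hexpand']
    simp only [← Finset.sum_add_distrib, ← mul_add, clifford, mul_ite, mul_zero,
      Finset.sum_ite_eq, Finset.mem_univ, if_true, map_sum, Finset.smul_sum, two_smul, sq, mul_two]
  exact smul_right_injective _ two_ne_zero hdouble

theorem star_loc (c : X → ℝ) (s : Fin d → X → ℝ) {h : Matrix X X ℂ} (hh : h.IsHermitian) :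
    star (𝔽.loc c s h) = 𝔽.loc c s h := by
  have hJ : Commute 𝔽.J (𝔽.mult c - 𝔽.Φ h) := (𝔽.J_comm _).sub_right (𝔽.J_comm _)
  rw [loc, star_add, star_dirac, star_mul, star_sub, (𝔽.isSelfAdjoint_mult c).star_eq,
    (𝔽.isSelfAdjoint_Φ hh).star_eq, star_J, hJ.eq]

theorem norm_loc_apply_sq (c : X → ℝ) (s : Fin d → X → ℝ) {h : Matrix X X ℂ} (hh : h.IsHermitian)
    (ψ : E) :
    ‖𝔽.loc c s h ψ‖ ^ 2 = ‖(𝔽.mult c - 𝔽.Φ h) ψ‖ ^ 2 + expectation ψ (𝔽.mult (∑ j, s j ^ 2))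
      + expectation ψ (𝔽.J * ⁅𝔽.dirac s, 𝔽.Φ h⁆) := by
  set K := 𝔽.mult c - 𝔽.Φ h with hK
  set B := 𝔽.dirac s with hB
  have hstarK : star K = K := ((𝔽.isSelfAdjoint_mult c).sub (𝔽.isSelfAdjoint_Φ hh)).star_eq
  have hJK : Commute 𝔽.J K := (𝔽.J_comm _).sub_right (𝔽.J_comm _)
  have hKB : ⁅B, 𝔽.Φ h⁆ = K * B - B * K := by
    have hcB : 𝔽.mult c * B = B * 𝔽.mult c := (𝔽.mult_commute_dirac c s).eq
    rw [Ring.lie_def, hK, sub_mul, mul_sub, hcB]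
    abel
  have hJJ : 𝔽.J * K * (𝔽.J * K) = K * K := by
    rw [hJK.symm.mul_mul_mul_comm, J_sq, one_mul]
  have hcross : B * (𝔽.J * K) = -(𝔽.J * (B * K)) := by
    rw [← mul_assoc, ← mul_assoc, 𝔽.J_mul_dirac, neg_mul, neg_neg]
  rw [← expectation_star_mul_self, ← expectation_star_mul_self, ← map_add, ← map_add,
    star_loc _ _ _ hh, hstarK, ← dirac_sq, hKB, loc, ← hK, ← hB]
  congr 1
  rw [add_mul, mul_add, mul_add, hJJ, hcross]
  noncomm_ring

theorem lie_dirac_Φ (s : Fin d → X → ℝ) (h : Matrix X X ℂ) :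
    ⁅𝔽.dirac s, 𝔽.Φ h⁆ = ∑ j, 𝔽.Φ ⁅realDiagonal (s j), h⁆ * 𝔽.Γ j := by
  simp only [dirac, Ring.lie_def, Finset.sum_mul, Finset.mul_sum, ← Finset.sum_sub_distrib,
    map_sub, map_mul, sub_mul, mult_apply]
  refine Finset.sum_congr rfl fun j _ => ?_
  rw [mul_assoc, (𝔽.Γ_comm j _).eq, ← mul_assoc, ← mul_assoc]

/-- The commutator of multiplication by `f` with `h` is the sum of a matrix of norm at most `e`
and of a matrix of norm at most `φ` compressed by `χ`. In the applications `χ` is an indicator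
function, so that the second part is localized on its support. -/
def CommutatorSplits (χ f : X → ℝ) (h : Matrix X X ℂ) (e φ : ℝ) : Prop :=
  ∃ A F : Matrix X X ℂ,
    ⁅realDiagonal f, h⁆ = A + realDiagonal χ * F * realDiagonal χ ∧ ‖A‖ ≤ e ∧ ‖F‖ ≤ φ

theorem abs_expectation_J_mul_mul_Γ_le {A : Matrix X X ℂ} {a : ℝ} (hA : ‖A‖ ≤ a) (j : Fin d)
    (ψ : E) : |expectation ψ (𝔽.J * (𝔽.Φ A * 𝔽.Γ j))| ≤ a * ‖ψ‖ ^ 2 := by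
  refine (abs_expectation_le _ _).trans (mul_le_mul_of_nonneg_right ?_ (by positivity))
  rw [CStarRing.norm_mem_unitary_mul _ 𝔽.J_mem_unitary,
    CStarRing.norm_mul_mem_unitary _ (𝔽.Γ_mem_unitary j)]
  exact (𝔽.norm_Φ_le A).trans hA

theorem abs_expectation_J_mul_lie_dirac_le {χ : X → ℝ} {s : Fin d → X → ℝ} {h : Matrix X X ℂ}
    {ε φ : ℝ} (hs : ∀ j, CommutatorSplits χ (s j) h ε φ) (ψ : E) :
    |expectation ψ (𝔽.J * ⁅𝔽.dirac s, 𝔽.Φ h⁆)|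
      ≤ d * (ε * ‖ψ‖ ^ 2 + φ * ‖𝔽.mult χ ψ‖ ^ 2) := by
  have hterm : ∀ j, |expectation ψ (𝔽.J * (𝔽.Φ ⁅realDiagonal (s j), h⁆ * 𝔽.Γ j))|
      ≤ ε * ‖ψ‖ ^ 2 + φ * ‖𝔽.mult χ ψ‖ ^ 2 := by
    intro j
    obtain ⟨A, F, hsplit, hA, hF⟩ := hs j
    have hcompress : 𝔽.J * (𝔽.Φ (realDiagonal χ * F * realDiagonal χ) * 𝔽.Γ j)
        = star (𝔽.mult χ) * (𝔽.J * (𝔽.Φ F * 𝔽.Γ j)) * 𝔽.mult χ := by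
      rw [(𝔽.isSelfAdjoint_mult χ).star_eq, map_mul, map_mul, ← mult_apply, mul_assoc _ (𝔽.mult χ),
        mult_apply, ← (𝔽.Γ_comm j _).eq]
      simp only [← mul_assoc]
      rw [(𝔽.J_comm _).eq]
    rw [hsplit, map_add, add_mul, mul_add, map_add, hcompress, expectation_star_mul_mul]
    exact (abs_add_le _ _).trans (add_le_add (𝔽.abs_expectation_J_mul_mul_Γ_le hA j _)
      (𝔽.abs_expectation_J_mul_mul_Γ_le hF j _))
  rw [lie_dirac_Φ, Finset.mul_sum, map_sum]
  refine (Finset.abs_sum_le_sum_abs _ _).trans ((Finset.sum_le_sum fun j _ => hterm j).trans ?_)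
  simp [mul_add]

theorem expectation_anticommutator_one_sub_cos_le {h : Matrix X X ℂ} (hh : h.IsHermitian)
    {θ : X → ℝ} {b ε : ℝ} (hb : ‖h‖ ≤ b) (hε : ‖⁅phase θ, h⁆‖ ≤ ε) (ψ : E) :
    expectation ψ (𝔽.mult (fun x => 1 - Real.cos (θ x)) * 𝔽.Φ h
      + 𝔽.Φ h * 𝔽.mult (fun x => 1 - Real.cos (θ x)))
      ≤ 2 * b * expectation ψ (𝔽.mult fun x => 1 - Real.cos (θ x)) + 2 * ε * ‖ψ‖ ^ 2 := by
  set v : Matrix X X ℂ := 1 - phase θ with hv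
  have hmult : 𝔽.mult (fun x => 1 - Real.cos (θ x))
      = (1 / 2 : ℝ) • (star (𝔽.Φ v) * 𝔽.Φ v) := by
    rw [mult_apply, realDiagonal_one_sub_cos, ← Complex.coe_smul, map_smul, map_mul, map_star,
      Complex.coe_smul]
  have hcomm : expectation ψ (star (𝔽.Φ v) * ⁅𝔽.Φ v, 𝔽.Φ h⁆) ≤ 2 * ε * ‖ψ‖ ^ 2 := by
    have hlie : star (𝔽.Φ v) * ⁅𝔽.Φ v, 𝔽.Φ h⁆ = 𝔽.Φ (-(star v * ⁅phase θ, h⁆)) := by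
      rw [hv]
      simp only [Ring.lie_def, map_neg, map_mul, map_star, map_sub, map_one]
      noncomm_ring
    rw [hlie]
    refine 𝔽.expectation_Φ_le ?_ ψ
    have hunit := CStarRing.norm_mem_unitary_mul ⁅phase θ, h⁆
      (Unitary.star_mem (phase_mem_unitary θ))
    rw [norm_neg, hv, star_sub, star_one, sub_mul, one_mul]
    linarith [norm_sub_le ⁅phase θ, h⁆ (star (phase θ) * ⁅phase θ, h⁆)]
  have hmain := 𝔽.expectation_Φ_le hb (𝔽.Φ v ψ)
  rw [hmult, smul_mul_assoc, mul_smul_comm, ← smul_add, map_smul, map_smul,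
    expectation_anticommutator_star_mul_self (𝔽.isSelfAdjoint_Φ hh), expectation_star_mul_self,
    smul_eq_mul, smul_eq_mul]
  linarith

theorem norm_mult_sub_Φ_apply_sq (c : X → ℝ) {h : Matrix X X ℂ} (hh : h.IsHermitian) (ψ : E) :
    ‖(𝔽.mult c - 𝔽.Φ h) ψ‖ ^ 2 = expectation ψ (𝔽.mult (c ^ 2))
      - expectation ψ (𝔽.mult c * 𝔽.Φ h + 𝔽.Φ h * 𝔽.mult c) + ‖𝔽.Φ h ψ‖ ^ 2 := by
  rw [← expectation_star_mul_self, ← expectation_star_mul_self, ← map_sub, ← map_add, star_sub,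
    (𝔽.isSelfAdjoint_Φ hh).star_eq, (𝔽.isSelfAdjoint_mult c).star_eq, map_pow]
  congr 1
  noncomm_ring

theorem two_mul_sum_one_sub_cos_le {ι : Type*} [Fintype ι] (θ : ι → ℝ) :
    2 * ∑ j, (1 - Real.cos (θ j)) ≤ (∑ j, (1 - Real.cos (θ j))) ^ 2 + ∑ j, Real.sin (θ j) ^ 2 := by
  calc 2 * ∑ j, (1 - Real.cos (θ j))
      = ∑ j, (1 - Real.cos (θ j)) ^ 2 + ∑ j, Real.sin (θ j) ^ 2 := by
        rw [← Finset.sum_add_distrib, Finset.mul_sum]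
        exact Finset.sum_congr rfl fun j _ => by rw [Real.sin_sq]; ring
    _ ≤ _ := by
        gcongr
        exact Finset.sum_sq_le_sq_sum_of_nonneg fun j _ => by linarith [Real.cos_le_one (θ j)]

theorem expectation_sum_one_sub_cos_mem_Icc (θ : Fin d → X → ℝ) (ψ : E) :
    expectation ψ (𝔽.mult (∑ j, fun x => 1 - Real.cos (θ j x)))
      ∈ Set.Icc 0 (2 * d * ‖ψ‖ ^ 2) := by
  constructor
  · refine 𝔽.expectation_mult_nonneg (Finset.sum_nonneg fun j _ x => ?_) ψ
    exact sub_nonneg.mpr (Real.cos_le_one _)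
  · have hle : ∑ j, (fun x => 1 - Real.cos (θ j x)) ≤ (2 * d : ℝ) • (1 : X → ℝ) := by
      refine (Finset.sum_le_sum (g := fun _ _ => 2) fun j _ x => ?_).trans (le_of_eq ?_)
      · linarith [Real.neg_one_le_cos (θ j x)]
      · funext x
        simp [mul_comm]
    simpa [expectation_one] using 𝔽.expectation_mult_mono hle ψ

theorem norm_loc_apply_sq_ge {h : Matrix X X ℂ} (hh : h.IsHermitian) (θ : Fin d → X → ℝ)
    {b γ ε : ℝ} (hb : ‖h‖ ≤ b) (hγ0 : 0 ≤ γ) (hγ : ∀ ψ, γ * ‖ψ‖ ≤ ‖𝔽.Φ h ψ‖)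
    (hε : ∀ j, ‖⁅phase (θ j), h⁆‖ ≤ ε) (ψ : E) :
    (γ ^ 2 - 4 * d * max (b - 1) 0 - 3 * d * ε) * ‖ψ‖ ^ 2
      ≤ ‖𝔽.loc (∑ j, fun x => 1 - Real.cos (θ j x)) (fun j x => Real.sin (θ j x)) h ψ‖ ^ 2 := by
  set c : X → ℝ := ∑ j, fun x => 1 - Real.cos (θ j x) with hc
  set s : Fin d → X → ℝ := fun j x => Real.sin (θ j x) with hs
  have hcomm : |expectation ψ (𝔽.J * ⁅𝔽.dirac s, 𝔽.Φ h⁆)| ≤ d * ε * ‖ψ‖ ^ 2 := by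
    have hsplit : ∀ j, CommutatorSplits 0 (s j) h ε 0 := fun j =>
      ⟨_, 0, by simp [hs], norm_lie_realDiagonal_sin_le hh (hε j), norm_zero.le⟩
    simpa [mul_assoc] using 𝔽.abs_expectation_J_mul_lie_dirac_le hsplit ψ
  have hanti : expectation ψ (𝔽.mult c * 𝔽.Φ h + 𝔽.Φ h * 𝔽.mult c)
      ≤ 2 * b * expectation ψ (𝔽.mult c) + 2 * d * ε * ‖ψ‖ ^ 2 := by
    simp only [hc, map_sum, Finset.sum_mul, Finset.mul_sum, ← Finset.sum_add_distrib]
    refine (Finset.sum_le_sum fun j _ =>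
      𝔽.expectation_anticommutator_one_sub_cos_le hh hb (hε j) ψ).trans (le_of_eq ?_)
    simp only [Finset.sum_add_distrib, Finset.sum_const, Finset.card_univ, Fintype.card_fin,
      nsmul_eq_mul]
    ring
  have hmass : 2 * expectation ψ (𝔽.mult c)
      ≤ expectation ψ (𝔽.mult (c ^ 2)) + expectation ψ (𝔽.mult (∑ j, s j ^ 2)) := by
    rw [← map_add, ← map_add, ← smul_eq_mul, ← map_smul, ← map_smul]
    refine 𝔽.expectation_mult_mono (fun x => ?_) ψ
    simpa [hc, hs] using two_mul_sum_one_sub_cos_le fun j => θ j x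
  have hgap : γ ^ 2 * ‖ψ‖ ^ 2 ≤ ‖𝔽.Φ h ψ‖ ^ 2 := by
    rw [← mul_pow]
    exact pow_le_pow_left₀ (by positivity) (hγ ψ) 2
  obtain ⟨hc0, hcd⟩ := 𝔽.expectation_sum_one_sub_cos_mem_Icc θ ψ
  have hexcess : (b - 1) * expectation ψ (𝔽.mult c) ≤ max (b - 1) 0 * (2 * d * ‖ψ‖ ^ 2) :=
    (mul_le_mul_of_nonneg_right (le_max_left _ _) hc0).trans
      (mul_le_mul_of_nonneg_left hcd (le_max_right _ _))
  rw [𝔽.norm_loc_apply_sq _ _ hh, 𝔽.norm_mult_sub_Φ_apply_sq _ hh]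
  linarith [neg_abs_le (expectation ψ (𝔽.J * ⁅𝔽.dirac s, 𝔽.Φ h⁆))]

section Kernel

variable {c χ : X → ℝ} {s : Fin d → X → ℝ} {h : Matrix X X ℂ} {ψ : E}

theorem expectation_mult_mul_of_loc_eq_zero (hψ : 𝔽.loc c s h ψ = 0) (w : X → ℝ) :
    expectation ψ (𝔽.mult (w * c)) = expectation ψ (𝔽.mult w * 𝔽.Φ h) := by
  have hJw : Commute 𝔽.J (𝔽.mult w) := 𝔽.J_comm _
  have hzero : expectation ψ (𝔽.mult w * 𝔽.J * 𝔽.loc c s h) = 0 := by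
    simp [expectation_apply, hψ]
  have hskew : star (𝔽.mult w * 𝔽.J * 𝔽.dirac s) = -(𝔽.mult w * 𝔽.J * 𝔽.dirac s) := by
    rw [star_mul, star_mul, star_dirac, star_J, (𝔽.isSelfAdjoint_mult w).star_eq, hJw.eq,
      ← mul_assoc, ← (𝔽.mult_commute_dirac w s).eq, mul_assoc, mul_assoc, J_mul_dirac, mul_neg,
      neg_neg]
  have hdirac : expectation ψ (𝔽.mult w * 𝔽.J * 𝔽.dirac s) = 0 := by
    have hstar := expectation_star ψ (𝔽.mult w * 𝔽.J * 𝔽.dirac s)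
    rw [hskew, map_neg] at hstar
    linarith
  have hexpand : 𝔽.mult w * 𝔽.J * 𝔽.loc c s h
      = 𝔽.mult (w * c) - 𝔽.mult w * 𝔽.Φ h + 𝔽.mult w * 𝔽.J * 𝔽.dirac s := by
    rw [loc, mul_add, map_mul, mul_assoc (𝔽.mult w), ← mul_assoc 𝔽.J 𝔽.J, J_sq, one_mul, mul_sub]
  rw [hexpand, map_add, map_sub, hdirac] at hzero
  linarith

theorem norm_mult_apply_le_of_loc_eq_zero (hψ : 𝔽.loc c s h ψ = 0) :
    ‖𝔽.mult c ψ‖ ≤ ‖𝔽.Φ h ψ‖ := by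
  have hsq : ‖𝔽.mult c ψ‖ ^ 2 ≤ ‖𝔽.mult c ψ‖ * ‖𝔽.Φ h ψ‖ := by
    have hcauchy := expectation_star_mul_le ψ (𝔽.mult c) (𝔽.Φ h)
    rwa [(𝔽.isSelfAdjoint_mult c).star_eq, ← 𝔽.expectation_mult_mul_of_loc_eq_zero hψ, ← sq,
      ← norm_mult_apply_sq] at hcauchy
  nlinarith [norm_nonneg (𝔽.mult c ψ), norm_nonneg (𝔽.Φ h ψ)]

theorem norm_mult_apply_le_four_mul (hχ : IsIdempotentElem χ) (hχc : χ ≤ 4 * c) (ψ : E) :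
    ‖𝔽.mult χ ψ‖ ≤ 4 * ‖𝔽.mult (χ * c) ψ‖ := by
  have hle : χ ^ 2 ≤ (16 : ℝ) • (χ * c) ^ 2 := by
    intro x
    have hχcx : χ x ≤ 4 * c x := hχc x
    rcases (IsIdempotentElem.iff_eq_zero_or_one (p := χ x)).mp (congrFun hχ x) with h0 | h1
    · simp [h0]
    · rw [h1] at hχcx
      simp only [Pi.pow_apply, Pi.smul_apply, Pi.mul_apply, h1, one_mul, one_pow, smul_eq_mul]
      nlinarith
  have hsq : ‖𝔽.mult χ ψ‖ ^ 2 ≤ (4 * ‖𝔽.mult (χ * c) ψ‖) ^ 2 := by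
    rw [mul_pow, norm_mult_apply_sq, norm_mult_apply_sq]
    have hmono := 𝔽.expectation_mult_mono hle ψ
    rw [map_smul, map_smul, smul_eq_mul] at hmono
    linarith
  exact le_of_sq_le_sq hsq (by positivity)

theorem mult_sq_mul_Φ_eq {A F : Matrix X X ℂ}
    (hcomm : ⁅realDiagonal c, h⁆ = A + realDiagonal χ * F * realDiagonal χ) :
    𝔽.mult (c * c) * 𝔽.Φ h = star (𝔽.mult c) * 𝔽.Φ h * 𝔽.mult c
      + star (𝔽.mult c) * 𝔽.Φ A + star (𝔽.mult (χ * c)) * (𝔽.Φ F * 𝔽.mult χ) := by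
  have hΦ : 𝔽.mult c * 𝔽.Φ h - 𝔽.Φ h * 𝔽.mult c = 𝔽.Φ A + 𝔽.mult χ * 𝔽.Φ F * 𝔽.mult χ := by
    simpa only [Ring.lie_def, map_sub, map_add, map_mul, ← mult_apply] using congrArg 𝔽.Φ hcomm
  rw [sub_eq_iff_eq_add] at hΦ
  rw [(𝔽.isSelfAdjoint_mult _).star_eq, (𝔽.isSelfAdjoint_mult _).star_eq, mul_comm χ c, map_mul,
    map_mul, mul_assoc (𝔽.mult c) (𝔽.mult c)]
  nth_rewrite 1 [hΦ]
  noncomm_ring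

theorem norm_mult_mul_apply_sq_le_of_loc_eq_zero (hψ : 𝔽.loc c s h ψ = 0)
    (hχ : IsIdempotentElem χ) (hχc : χ ≤ 4 * c) {b e φ : ℝ} (hb : ‖h‖ ≤ b)
    (hc : CommutatorSplits χ c h e φ) (hφ : 32 * φ ≤ 1) :
    ‖𝔽.mult (χ * c) ψ‖ ^ 2 ≤ 8 * b * (b ^ 2 + e) * ‖ψ‖ ^ 2 := by
  obtain ⟨A, F, hcomm, hA, hF⟩ := hc
  set a := ‖𝔽.mult c ψ‖
  set o := ‖𝔽.mult (χ * c) ψ‖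
  have hb0 : 0 ≤ b := (norm_nonneg _).trans hb
  have hφ0 : 0 ≤ φ := (norm_nonneg _).trans hF
  have ha : a ≤ b * ‖ψ‖ := (𝔽.norm_mult_apply_le_of_loc_eq_zero hψ).trans (𝔽.norm_Φ_apply_le hb ψ)
  have hcube : o ^ 2 ≤ 4 * expectation ψ (𝔽.mult (c * c * c)) := by
    rw [𝔽.norm_mult_apply_sq, ← smul_eq_mul (4 : ℝ), ← map_smul, ← map_smul, mul_pow, sq χ, hχ.eq]
    refine 𝔽.expectation_mult_mono (fun x => ?_) ψ
    have hχcx := mul_le_mul_of_nonneg_right (hχc x) (sq_nonneg (c x))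
    simp only [Pi.mul_apply, Pi.pow_apply, Pi.smul_apply, smul_eq_mul, Pi.ofNat_apply] at hχcx ⊢
    linarith
  rw [𝔽.expectation_mult_mul_of_loc_eq_zero hψ, 𝔽.mult_sq_mul_Φ_eq hcomm, map_add, map_add,
    expectation_star_mul_mul] at hcube
  have hinner : expectation (𝔽.mult c ψ) (𝔽.Φ h) ≤ b * (b * ‖ψ‖) ^ 2 :=
    (𝔽.expectation_Φ_le hb _).trans (by gcongr)
  have hbulk : expectation ψ (star (𝔽.mult c) * 𝔽.Φ A) ≤ b * ‖ψ‖ * (e * ‖ψ‖) :=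
    (expectation_star_mul_le _ _ _).trans
      (mul_le_mul ha (𝔽.norm_Φ_apply_le hA ψ) (norm_nonneg _) (by positivity))
  have hboundary : expectation ψ (star (𝔽.mult (χ * c)) * (𝔽.Φ F * 𝔽.mult χ))
      ≤ o * (φ * (4 * o)) := by
    refine (expectation_star_mul_le _ _ _).trans (mul_le_mul_of_nonneg_left ?_ (norm_nonneg _))
    exact (𝔽.norm_Φ_apply_le hF _).trans
      (mul_le_mul_of_nonneg_left (𝔽.norm_mult_apply_le_four_mul hχ hχc ψ) hφ0)
  linarith [mul_le_mul_of_nonneg_right hφ (sq_nonneg o)]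

theorem gap_mul_norm_le {h₁ r : Matrix X X ℂ} (hχ : IsIdempotentElem χ) {γ β : ℝ}
    (hγ : ∀ ψ, γ * ‖ψ‖ ≤ ‖𝔽.Φ h₁ ψ‖) (hr : h₁ - h = realDiagonal χ * r * realDiagonal χ)
    (hrβ : ‖r‖ ≤ β) (c : X → ℝ) (ψ : E) :
    γ * ‖ψ‖ ≤ ‖(𝔽.mult c - 𝔽.Φ h) ψ‖ + ‖𝔽.mult c ψ‖ + β * ‖𝔽.mult χ ψ‖ := by
  have hΦ : 𝔽.Φ h₁ = -(𝔽.mult c - 𝔽.Φ h) + 𝔽.mult c + 𝔽.mult χ * (𝔽.Φ r * 𝔽.mult χ) := by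
    rw [← sub_add_cancel h₁ h, hr]
    simp only [map_add, map_mul, mult_apply]
    noncomm_ring
  have hproj : ‖𝔽.mult χ‖ ≤ 1 :=
    IsStarProjection.norm_le _ ⟨hχ.map 𝔽.mult, 𝔽.isSelfAdjoint_mult χ⟩
  have hboundary : ‖𝔽.mult χ (𝔽.Φ r (𝔽.mult χ ψ))‖ ≤ β * ‖𝔽.mult χ ψ‖ :=
    ((𝔽.mult χ).le_of_opNorm_le hproj _).trans
      ((one_mul _).trans_le (𝔽.norm_Φ_apply_le hrβ _))
  calc γ * ‖ψ‖ ≤ ‖-(𝔽.mult c - 𝔽.Φ h) ψ + 𝔽.mult c ψ + 𝔽.mult χ (𝔽.Φ r (𝔽.mult χ ψ))‖ := by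
        have hγψ := hγ ψ
        rwa [hΦ] at hγψ
    _ ≤ ‖(𝔽.mult c - 𝔽.Φ h) ψ‖ + ‖𝔽.mult c ψ‖ + β * ‖𝔽.mult χ ψ‖ := by
        refine (norm_add_le _ _).trans (add_le_add ((norm_add_le _ _).trans ?_) hboundary)
        rw [norm_neg]

theorem sq_add_sq_le_of_loc_eq_zero (hψ : 𝔽.loc c s h ψ = 0) (hh : h.IsHermitian) (hd : 0 < d)
    (hχ : IsIdempotentElem χ) (hcs : (1 - χ) * c ^ 2 ≤ (d : ℝ) • ∑ j, s j ^ 2) {ε φ : ℝ}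
    (hs : ∀ j, CommutatorSplits χ (s j) h ε φ) :
    ‖(𝔽.mult c - 𝔽.Φ h) ψ‖ ^ 2 + ‖𝔽.mult c ψ‖ ^ 2
      ≤ ‖𝔽.mult (χ * c) ψ‖ ^ 2 + d * (d * (ε * ‖ψ‖ ^ 2 + φ * ‖𝔽.mult χ ψ‖ ^ 2)) := by
  have hd1 : (1 : ℝ) ≤ d := by exact_mod_cast hd
  have hinner : ‖𝔽.mult c ψ‖ ^ 2 - ‖𝔽.mult (χ * c) ψ‖ ^ 2
      ≤ d * expectation ψ (𝔽.mult (∑ j, s j ^ 2)) := by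
    have hmono := 𝔽.expectation_mult_mono hcs ψ
    rw [map_smul, map_smul, smul_eq_mul] at hmono
    rwa [norm_mult_apply_sq, norm_mult_apply_sq, ← map_sub, ← map_sub, mul_pow, sq χ, hχ.eq,
      ← one_sub_mul]
  have hzero := 𝔽.norm_loc_apply_sq c s hh ψ
  rw [hψ, norm_zero, zero_pow two_ne_zero] at hzero
  have hcomm := (abs_le.mp (𝔽.abs_expectation_J_mul_lie_dirac_le hs ψ)).1
  have hdzero := congrArg ((d : ℝ) * ·) hzero
  have hdcomm := mul_le_mul_of_nonneg_left hcomm (Nat.cast_nonneg (α := ℝ) d)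
  simp only [mul_add, mul_zero] at hdzero hdcomm ⊢
  linarith [le_mul_of_one_le_left (sq_nonneg ‖(𝔽.mult c - 𝔽.Φ h) ψ‖) hd1]

theorem eq_zero_of_loc_eq_zero {h₁ r : Matrix X X ℂ} (hh : h.IsHermitian) (hd : 0 < d)
    (hχ : IsIdempotentElem χ) (hχc : χ ≤ 4 * c)
    (hcs : (1 - χ) * c ^ 2 ≤ (d : ℝ) • ∑ j, s j ^ 2) {b γ e ε : ℝ} (hb : ‖h‖ ≤ b) (hγ0 : 0 ≤ γ)
    (hγ : ∀ ψ, γ * ‖ψ‖ ≤ ‖𝔽.Φ h₁ ψ‖) (hr : h₁ - h = realDiagonal χ * r * realDiagonal χ)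
    (hrb : ‖r‖ ≤ 2 * b) (hc : CommutatorSplits χ c h e (2 * d * b))
    (hs : ∀ j, CommutatorSplits χ (s j) h ε (2 * b)) (hbd : 64 * d * b ≤ 1)
    (hnum : 8 * b * (b ^ 2 + e) * (1 + 32 * b ^ 2 + 32 * d ^ 2 * b) + d ^ 2 * ε < γ ^ 2 / 4)
    (hψ : 𝔽.loc c s h ψ = 0) : ψ = 0 := by
  by_contra hne
  have hN : 0 < ‖ψ‖ := norm_pos_iff.mpr hne
  have hb0 : 0 ≤ b := (norm_nonneg _).trans hb
  set a := ‖𝔽.mult c ψ‖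
  set k := ‖(𝔽.mult c - 𝔽.Φ h) ψ‖
  set o := ‖𝔽.mult (χ * c) ψ‖
  set p := ‖𝔽.mult χ ψ‖
  have hp : p ^ 2 ≤ 16 * o ^ 2 := by
    have := pow_le_pow_left₀ (norm_nonneg _) (𝔽.norm_mult_apply_le_four_mul hχ hχc ψ) 2
    linarith [mul_pow 4 o 2]
  have ho : o ^ 2 ≤ 8 * b * (b ^ 2 + e) * ‖ψ‖ ^ 2 :=
    𝔽.norm_mult_mul_apply_sq_le_of_loc_eq_zero hψ hχ hχc hb hc (by linarith)
  have hka : k ^ 2 + a ^ 2 ≤ o ^ 2 + d * (d * (ε * ‖ψ‖ ^ 2 + 2 * b * p ^ 2)) :=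
    𝔽.sq_add_sq_le_of_loc_eq_zero hψ hh hd hχ hcs hs
  have hgap : (γ * ‖ψ‖) ^ 2 ≤ 4 * (k ^ 2 + a ^ 2 + 2 * b ^ 2 * p ^ 2) := by
    have := pow_le_pow_left₀ (by positivity) (𝔽.gap_mul_norm_le hχ hγ hr hrb c ψ) 2
    linarith [sq_nonneg (k - a), sq_nonneg (k + a - 2 * b * p)]
  have houter : (2 * b ^ 2 + 2 * d ^ 2 * b) * p ^ 2 ≤ (2 * b ^ 2 + 2 * d ^ 2 * b) * (16 * o ^ 2) :=
    mul_le_mul_of_nonneg_left hp (by positivity)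
  have htotal : (1 + 32 * b ^ 2 + 32 * d ^ 2 * b) * o ^ 2
      ≤ (1 + 32 * b ^ 2 + 32 * d ^ 2 * b) * (8 * b * (b ^ 2 + e) * ‖ψ‖ ^ 2) :=
    mul_le_mul_of_nonneg_left ho (by positivity)
  linarith [mul_lt_mul_of_pos_right hnum (pow_pos hN 2)]

end Kernel

end LocalizerFrame

/-! ### The localizer as a matrix -/

/-- The relations between square matrices `Γ_j` which say that the odd block matrices with
off-diagonal entries `Γ_j` and `Γ_j*` generate a Clifford algebra. -/
structure IsOddCliffordRep {d k : ℕ} (Γ : Fin d → Matrix (Fin k) (Fin k) ℂ) : Prop where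
  mul_conjTranspose_add : ∀ i j, Γ i * (Γ j)ᴴ + Γ j * (Γ i)ᴴ = if i = j then 2 else 0
  conjTranspose_mul_add : ∀ i j, (Γ i)ᴴ * Γ j + (Γ j)ᴴ * Γ i = if i = j then 2 else 0

theorem isOddCliffordRep_gammaHat {d k : ℕ} {γ : Fin (d - 1) → Matrix (Fin k) (Fin k) ℂ}
    (hsa : ∀ i, (γ i).IsHermitian)
    (hcl : ∀ i j, γ i * γ j + γ j * γ i = if i = j then 2 else 0) :
    IsOddCliffordRep (gammaHat (d := d) γ) := by
  constructor <;> intro i j <;>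
    rcases lt_or_ge (i : ℕ) (d - 1) with hi | hi <;> rcases lt_or_ge (j : ℕ) (d - 1) with hj | hj
  case mul_conjTranspose_add.inl.inl | conjTranspose_mul_add.inl.inl =>
    simp only [gammaHat, hi, hj, dif_pos, (hsa _).eq, hcl, Fin.ext_iff]
  case mul_conjTranspose_add.inr.inr | conjTranspose_mul_add.inr.inr =>
    have hij : i = j := Fin.ext (by omega)
    simp [hij, gammaHat, hj.not_gt, conjTranspose_smul, smul_smul, one_add_one_eq_two]
  all_goals
    have hij : i ≠ j := by rintro rfl; omega
    simp [gammaHat, hi, hj, hi.not_gt, hj.not_gt, hij, (hsa _).eq, conjTranspose_smul]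

section LocMat

theorem sub_kronecker {R l m n p : Type*} [NonUnitalNonAssocRing R] (A B : Matrix l m R)
    (C : Matrix n p R) : (A - B) ⊗ₖ C = A ⊗ₖ C - B ⊗ₖ C := by
  ext
  simp [sub_mul]

variable {X : Type*} [DecidableEq X] {d k : ℕ}

/-- The grading `1 ⊕ -1` on `(ℂ^X ⊗ ℂ^k)²`. -/
def grading (X : Type*) [DecidableEq X] (k : ℕ) :
    Matrix ((X × Fin k) ⊕ (X × Fin k)) ((X × Fin k) ⊕ (X × Fin k)) ℂ :=
  fromBlocks 1 0 0 (-1)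

/-- The odd matrix on `(ℂ^X ⊗ ℂ^k)²` with off-diagonal entries `1 ⊗ G` and `1 ⊗ G*`. -/
noncomputable def oddBlock (X : Type*) [DecidableEq X] (G : Matrix (Fin k) (Fin k) ℂ) :
    Matrix ((X × Fin k) ⊕ (X × Fin k)) ((X × Fin k) ⊕ (X × Fin k)) ℂ :=
  fromBlocks 0 (1 ⊗ₖ Gᴴ) (1 ⊗ₖ G) 0

theorem star_grading : star (grading X k) = grading X k := by
  simp [grading, star_eq_conjTranspose, fromBlocks_conjTranspose]

theorem star_oddBlock (G : Matrix (Fin k) (Fin k) ℂ) : star (oddBlock X G) = oddBlock X G := by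
  simp [oddBlock, star_eq_conjTranspose, fromBlocks_conjTranspose, conjTranspose_kronecker]

variable [Fintype X]

/-- The localizer of a Hamiltonian `h` with mass function `c` and position functions `s`. -/
noncomputable def locMat (Γ : Fin d → Matrix (Fin k) (Fin k) ℂ) (c : X → ℝ) (s : Fin d → X → ℝ)
    (h : Matrix X X ℂ) : Matrix ((X × Fin k) ⊕ (X × Fin k)) ((X × Fin k) ⊕ (X × Fin k)) ℂ :=
  fromBlocks ((realDiagonal c - h) ⊗ₖ 1) (∑ j, realDiagonal (s j) ⊗ₖ (Γ j)ᴴ)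
    (∑ j, realDiagonal (s j) ⊗ₖ Γ j) (-((realDiagonal c - h) ⊗ₖ 1))

theorem locMat_isHermitian (Γ : Fin d → Matrix (Fin k) (Fin k) ℂ) (c : X → ℝ)
    (s : Fin d → X → ℝ) {h : Matrix X X ℂ} (hh : h.IsHermitian) :
    (locMat Γ c s h).IsHermitian := by
  have hdiag : ∀ f : X → ℝ, (realDiagonal f)ᴴ = realDiagonal f := star_realDiagonal
  simp [locMat, Matrix.IsHermitian, fromBlocks_conjTranspose, conjTranspose_kronecker,
    conjTranspose_sum, hdiag, hh.eq, conjTranspose_sub]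

theorem perLocalizer_eq_locMat {L : ℕ} (H : Hilb d L →L[ℂ] Hilb d L)
    (γ : Fin (d - 1) → Matrix (Fin k) (Fin k) ℂ) (η : ℝ) (ρ : ℕ) :
    perLocalizer H γ η ρ
      = locMat (gammaHat γ)
        (∑ j, fun u : Torus d ρ × Fin L => 1 - Real.cos (Real.pi / ρ * (u.1.coord j : ℝ)))
        (fun j u => Real.sin (Real.pi / ρ * (u.1.coord j : ℝ)))
        (((1 / η : ℝ) : ℂ) • perHam H ρ) := by
  have hcos : ∀ j : Fin d, 1 - cosX L ρ j
      = realDiagonal fun u => 1 - Real.cos (Real.pi / ρ * (u.1.coord j : ℝ)) := fun j =>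
    (congrArg (· - cosX L ρ j) (map_one realDiagonal).symm).trans (map_sub realDiagonal _ _).symm
  rw [perLocalizer, locMat, map_sum, fromBlocks_smul, fromBlocks_add, smul_zero, add_zero,
    add_zero, smul_neg, ← smul_kronecker, ← sub_eq_add_neg, sub_kronecker, neg_sub, neg_add_eq_sub]
  simp only [hcos]
  rfl

/-- The diagonal embedding `A ↦ A ⊗ 1 ⊕ A ⊗ 1`. -/
noncomputable def doubled (X : Type*) [Fintype X] [DecidableEq X] (k : ℕ) :
    Matrix X X ℂ →⋆ₐ[ℂ] Matrix ((X × Fin k) ⊕ (X × Fin k)) ((X × Fin k) ⊕ (X × Fin k)) ℂ where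
  toFun A := fromBlocks (A ⊗ₖ 1) 0 0 (A ⊗ₖ 1)
  map_one' := by simp
  map_mul' A B := by simp [fromBlocks_multiply, ← mul_kronecker_mul]
  map_zero' := by simp
  map_add' A B := by simp [fromBlocks_add, add_kronecker]
  commutes' a := by
    rw [Algebra.algebraMap_eq_smul_one, Algebra.algebraMap_eq_smul_one, smul_kronecker,
      one_kronecker_one, ← fromBlocks_one, fromBlocks_smul]
    simp
  map_star' A := by
    simp [star_eq_conjTranspose, fromBlocks_conjTranspose, conjTranspose_kronecker]

theorem doubled_apply (A : Matrix X X ℂ) :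
    doubled X k A = fromBlocks (A ⊗ₖ 1) 0 0 (A ⊗ₖ 1) := rfl

theorem grading_mul_self : grading X k * grading X k = 1 := by
  simp [grading, fromBlocks_multiply]

theorem oddBlock_mul_add {Γ : Fin d → Matrix (Fin k) (Fin k) ℂ} (hΓ : IsOddCliffordRep Γ)
    (i j : Fin d) :
    oddBlock X (Γ i) * oddBlock X (Γ j) + oddBlock X (Γ j) * oddBlock X (Γ i)
      = if i = j then 2 else 0 := by
  have htwo : (1 : Matrix X X ℂ) ⊗ₖ (2 : Matrix (Fin k) (Fin k) ℂ) = 2 := by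
    rw [← one_add_one_eq_two, kronecker_add, one_kronecker_one, one_add_one_eq_two]
  simp only [oddBlock, fromBlocks_multiply, ← mul_kronecker_mul, fromBlocks_add, mul_zero,
    zero_mul, zero_add, add_zero, mul_one, ← kronecker_add, hΓ.mul_conjTranspose_add,
    hΓ.conjTranspose_mul_add]
  split_ifs
  · rw [htwo, ← one_add_one_eq_two, ← one_add_one_eq_two, ← fromBlocks_one, fromBlocks_add,
      add_zero]
  · simp

theorem grading_mul_oddBlock (G : Matrix (Fin k) (Fin k) ℂ) :
    grading X k * oddBlock X G = -(oddBlock X G * grading X k) := by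
  simp [grading, oddBlock, fromBlocks_multiply, fromBlocks_neg]

theorem commute_grading_doubled (A : Matrix X X ℂ) : Commute (grading X k) (doubled X k A) := by
  simp [commute_iff_eq, grading, fromBlocks_multiply, doubled_apply]

theorem commute_oddBlock_doubled (G : Matrix (Fin k) (Fin k) ℂ) (A : Matrix X X ℂ) :
    Commute (oddBlock X G) (doubled X k A) := by
  simp [commute_iff_eq, oddBlock, fromBlocks_multiply, doubled_apply, ← mul_kronecker_mul]

/-- The frame on `(ℂ^X ⊗ ℂ^k)²` associated with the matrices `Γ_j`. -/
noncomputable def matrixFrame (X : Type*) [Fintype X] [DecidableEq X]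
    {Γ : Fin d → Matrix (Fin k) (Fin k) ℂ} (hΓ : IsOddCliffordRep Γ) :
    LocalizerFrame X (EuclideanSpace ℂ ((X × Fin k) ⊕ (X × Fin k))) d where
  Φ := (toEuclideanCLM (n := (X × Fin k) ⊕ (X × Fin k)) (𝕜 := ℂ) : _ →⋆ₐ[ℂ] _).comp (doubled X k)
  J := toEuclideanCLM (𝕜 := ℂ) (grading X k)
  Γ j := toEuclideanCLM (𝕜 := ℂ) (oddBlock X (Γ j))
  star_J := by rw [← map_star, star_grading]
  J_sq := by rw [← map_mul, grading_mul_self, map_one]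
  star_Γ j := by rw [← map_star, star_oddBlock]
  clifford i j := by
    rw [← map_mul, ← map_mul, ← map_add, oddBlock_mul_add hΓ]
    split_ifs
    · rw [map_ofNat]
    · rw [map_zero]
  J_mul_Γ j := by rw [← map_mul, ← map_mul, ← map_neg, grading_mul_oddBlock]
  J_comm A := (commute_grading_doubled A).map (toEuclideanCLM (𝕜 := ℂ))
  Γ_comm j A := (commute_oddBlock_doubled _ A).map (toEuclideanCLM (𝕜 := ℂ))

theorem toEuclideanCLM_locMat {Γ : Fin d → Matrix (Fin k) (Fin k) ℂ} (hΓ : IsOddCliffordRep Γ)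
    (c : X → ℝ) (s : Fin d → X → ℝ) (h : Matrix X X ℂ) :
    toEuclideanCLM (𝕜 := ℂ) (locMat Γ c s h) = (matrixFrame X hΓ).loc c s h := by
  have hsum : ∑ j, doubled X k (realDiagonal (s j)) * oddBlock X (Γ j)
      = fromBlocks 0 (∑ j, realDiagonal (s j) ⊗ₖ (Γ j)ᴴ) (∑ j, realDiagonal (s j) ⊗ₖ Γ j) 0 := by
    simp only [doubled_apply, oddBlock, fromBlocks_multiply, ← mul_kronecker_mul, mul_one, one_mul,
      mul_zero, zero_mul, add_zero, zero_add]
    ext (_ | _) (_ | _) <;> simp [Matrix.sum_apply]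
  have hloc : locMat Γ c s h = grading X k * (doubled X k (realDiagonal c) - doubled X k h)
      + ∑ j, doubled X k (realDiagonal (s j)) * oddBlock X (Γ j) := by
    rw [hsum, ← map_sub, doubled_apply, grading, fromBlocks_multiply, fromBlocks_add, locMat]
    simp
  rw [hloc, map_add, map_mul, map_sub, map_sum]
  simp only [map_mul]
  rfl

end LocMat

/-! ### Operators of finite range on the lattice -/

section InfiniteVolume

variable {d L : ℕ}

/-- The points of `ℤ^d` at sup-distance at most `m` from `x`. -/
noncomputable def cube (m : ℕ) (x : Fin d → ℤ) : Finset (Fin d → ℤ) :=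
  Finset.Icc (x - m) (x + m)

theorem mem_cube {m : ℕ} {x y : Fin d → ℤ} : y ∈ cube m x ↔ ∀ j, |x j - y j| ≤ m := by
  simp only [cube, Finset.mem_Icc, Pi.le_def, abs_le, ← forall_and]
  refine forall_congr' fun j => ?_
  simp only [Pi.sub_apply, Pi.add_apply, Pi.natCast_apply]
  constructor <;> rintro ⟨h1, h2⟩ <;> constructor <;> linarith

theorem mem_cube_comm {m : ℕ} {x y : Fin d → ℤ} : y ∈ cube m x ↔ x ∈ cube m y := by
  simp only [mem_cube, abs_sub_comm]

theorem sum_cube_eq_sum_cube_zero {A : Type*} [AddCommMonoid A] (m : ℕ) (x : Fin d → ℤ)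
    (f : (Fin d → ℤ) → A) : ∑ y ∈ cube m x, f y = ∑ c ∈ cube m 0, f (x + c) := by
  have hmap : cube m x = (cube m 0).map (addLeftEmbedding x) := by
    simp only [cube, Finset.map_add_left_Icc, zero_add, sub_eq_add_neg]
  rw [hmap, Finset.sum_map]
  rfl

theorem apply_single_eq (H : Hilb d L →L[ℂ] Hilb d L) (x y : Fin d → ℤ)
    (v : EuclideanSpace ℂ (Fin L)) :
    H (lp.single 2 y v) x = WithLp.toLp 2 (kernel H x y *ᵥ v.ofLp) := by
  have hv : lp.single 2 y v
      = ∑ b, v b • (lp.single 2 y (EuclideanSpace.single b (1 : ℂ)) : Hilb d L) := by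
    simp only [← lp.single_smul]
    rw [← lp.singleAddMonoidHom_apply]
    simp only [← lp.singleAddMonoidHom_apply, ← map_sum]
    congr 1
    ext a
    simp [Pi.single_apply]
  rw [hv, map_sum]
  ext a
  simp only [map_smul, lp.coeFn_sum, Finset.sum_apply, lp.coeFn_smul, Pi.smul_apply,
    WithLp.ofLp_sum, WithLp.ofLp_smul, mulVec, dotProduct, kernel, of_apply, smul_eq_mul]
  exact Finset.sum_congr rfl fun b _ => mul_comm _ _

theorem hasSum_apply (H : Hilb d L →L[ℂ] Hilb d L) (ψ : Hilb d L) (x : Fin d → ℤ) :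
    HasSum (fun y => H (lp.single 2 y (ψ y)) x) (H ψ x) :=
  ((lp.evalCLM ℂ (fun _ : Fin d → ℤ => EuclideanSpace ℂ (Fin L)) 2 x).comp H).hasSum
    (lp.hasSum_single (by norm_num) ψ)

theorem apply_eq_sum_support (H : Hilb d L →L[ℂ] Hilb d L) {ψ : Hilb d L}
    {S : Finset (Fin d → ℤ)} (hS : ∀ y ∉ S, ψ y = 0) (x : Fin d → ℤ) :
    H ψ x = ∑ y ∈ S, H (lp.single 2 y (ψ y)) x :=
  (hasSum_apply H ψ x).unique (hasSum_sum_of_ne_finset_zero fun _ hy => by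
    rw [hS _ hy, lp.single_zero, map_zero]; rfl)

theorem eq_sum_single_of_support {ψ : Hilb d L} {S : Finset (Fin d → ℤ)}
    (hS : ∀ y ∉ S, ψ y = 0) : ψ = ∑ y ∈ S, lp.single 2 y (ψ y) := by
  refine lp.ext (funext fun x => ?_)
  simpa only [one_apply_eq_self, lp.coeFn_sum, Finset.sum_apply]
    using apply_eq_sum_support (1 : Hilb d L →L[ℂ] Hilb d L) hS x

theorem norm_sq_eq_sum_of_support {ψ : Hilb d L} {S : Finset (Fin d → ℤ)}
    (hS : ∀ y ∉ S, ψ y = 0) : ‖ψ‖ ^ 2 = ∑ y ∈ S, ‖ψ y‖ ^ 2 := by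
  have h := lp.norm_sum_single (p := 2) (by norm_num) (fun y => ψ y) S
  rw [← eq_sum_single_of_support hS] at h
  simpa only [ENNReal.toReal_ofNat, Real.rpow_ofNat] using h

variable {H : Hilb d L →L[ℂ] Hilb d L} {R : ℝ}

theorem HasFiniteRange.kernel_eq_zero (hR : HasFiniteRange H R) {x y : Fin d → ℤ} {j : Fin d}
    (h : R < |(x j : ℝ) - y j|) : kernel H x y = 0 := by
  refine hR x y (h.trans_le (Real.abs_le_sqrt ?_))
  exact Finset.single_le_sum (f := fun j => ((x j : ℝ) - (y j : ℝ)) ^ 2)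
    (fun i _ => sq_nonneg _) (Finset.mem_univ j)

theorem HasFiniteRange.kernel_eq_zero_of_notMem (hR : HasFiniteRange H R) {m : ℕ} (hm : R ≤ m)
    {x y : Fin d → ℤ} (h : y ∉ cube m x) : kernel H x y = 0 := by
  simp only [mem_cube, not_forall, not_le] at h
  obtain ⟨j, hj⟩ := h
  refine hR.kernel_eq_zero (j := j) (hm.trans_lt ?_)
  exact_mod_cast hj

theorem HasFiniteRange.apply_single_eq_zero (hR : HasFiniteRange H R) {m : ℕ} (hm : R ≤ m)
    {x y : Fin d → ℤ} (h : y ∉ cube m x) (v : EuclideanSpace ℂ (Fin L)) :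
    H (lp.single 2 y v) x = 0 := by
  rw [apply_single_eq, hR.kernel_eq_zero_of_notMem hm h, zero_mulVec, WithLp.toLp_zero]

theorem HasFiniteRange.apply_eq_sum (hR : HasFiniteRange H R) {m : ℕ} (hm : R ≤ m)
    (ψ : Hilb d L) (x : Fin d → ℤ) :
    H ψ x = ∑ y ∈ cube m x, H (lp.single 2 y (ψ y)) x :=
  (hasSum_apply H ψ x).unique (hasSum_sum_of_ne_finset_zero fun _ hy =>
    hR.apply_single_eq_zero hm hy _)

theorem HasFiniteRange.apply_eq_zero_of_notMem (hR : HasFiniteRange H R) {m : ℕ} (hm : R ≤ m)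
    {ψ : Hilb d L} {S : Finset (Fin d → ℤ)} (hS : ∀ y ∉ S, ψ y = 0) {x : Fin d → ℤ}
    (hx : x ∉ S.biUnion (cube m)) : H ψ x = 0 := by
  rw [apply_eq_sum_support H hS]
  refine Finset.sum_eq_zero fun y hy => hR.apply_single_eq_zero hm (fun h => hx ?_) _
  exact Finset.mem_biUnion.mpr ⟨y, hy, mem_cube_comm.mp h⟩

theorem HasFiniteRange.exists_support_apply (hR : HasFiniteRange H R) {ψ : Hilb d L}
    {S : Finset (Fin d → ℤ)} (hS : ∀ y ∉ S, ψ y = 0) :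
    ∃ T : Finset (Fin d → ℤ), ∀ x ∉ T, H ψ x = 0 := by
  obtain ⟨m, hm⟩ := exists_nat_ge R
  exact ⟨S.biUnion (cube m), fun x hx => hR.apply_eq_zero_of_notMem hm hS hx⟩

/-- Schur's test for kernels supported near the diagonal. -/
theorem norm_le_of_norm_apply_le_sum_cube {f ψ : Hilb d L} {K : ℝ} (hK : 0 ≤ K) (m : ℕ)
    (h : ∀ x, ‖f x‖ ≤ K * ∑ y ∈ cube m x, ‖ψ y‖) :
    ‖f‖ ≤ K * (cube (d := d) m 0).card * ‖ψ‖ := by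
  refine lp.norm_le_of_forall_sum_le (by norm_num) (by positivity) fun S => ?_
  simp only [ENNReal.toReal_ofNat, Real.rpow_ofNat]
  have hpoint : ∀ x, ‖f x‖ ^ 2
      ≤ K ^ 2 * ((cube (d := d) m 0).card * ∑ c ∈ cube m 0, ‖ψ (x + c)‖ ^ 2) := fun x => by
    refine (pow_le_pow_left₀ (norm_nonneg _) (h x) 2).trans ?_
    rw [mul_pow, sum_cube_eq_sum_cube_zero]
    exact mul_le_mul_of_nonneg_left sq_sum_le_card_mul_sum_sq (sq_nonneg _)
  have htranslate : ∀ c, ∑ x ∈ S, ‖ψ (x + c)‖ ^ 2 ≤ ‖ψ‖ ^ 2 := fun c => by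
    have := lp.sum_rpow_le_norm_rpow (by norm_num) ψ (S.map (addRightEmbedding c))
    simpa only [ENNReal.toReal_ofNat, Real.rpow_ofNat, Finset.sum_map, addRightEmbedding_apply]
      using this
  calc ∑ x ∈ S, ‖f x‖ ^ 2
      ≤ ∑ x ∈ S, K ^ 2 * ((cube (d := d) m 0).card * ∑ c ∈ cube m 0, ‖ψ (x + c)‖ ^ 2) :=
        Finset.sum_le_sum fun x _ => hpoint x
    _ = K ^ 2 * ((cube (d := d) m 0).card * ∑ c ∈ cube m 0, ∑ x ∈ S, ‖ψ (x + c)‖ ^ 2) := by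
        rw [← Finset.mul_sum, ← Finset.mul_sum, Finset.sum_comm]
    _ ≤ K ^ 2 * ((cube (d := d) m 0).card * ∑ _c ∈ cube (d := d) m 0, ‖ψ‖ ^ 2) := by
        gcongr with c
        exact htranslate c
    _ = (K * (cube (d := d) m 0).card * ‖ψ‖) ^ 2 := by
        rw [Finset.sum_const, nsmul_eq_mul]
        ring

theorem position_apply (j : Fin d) (ψ : (position L j).domain) (x : Fin d → ℤ) :
    (position L j ψ) x = ((x j : ℤ) : ℂ) • (ψ : Hilb d L) x := rfl

theorem mem_position_domain_of_support (j : Fin d) {ψ : Hilb d L} {S : Finset (Fin d → ℤ)}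
    (hS : ∀ y ∉ S, ψ y = 0) : ψ ∈ (position L j).domain := by
  refine (memℓp_zero (S.finite_toSet.subset fun x hx => ?_)).of_exponent_ge zero_le
  by_contra hxS
  exact hx (by simp only [hS x hxS, smul_zero])

/-- The domain of the commutator `[X_j, H]`: the vectors `ψ` for which both `X_j ψ` and `X_j H ψ`
are defined. -/
noncomputable def commutatorDomain (H : Hilb d L →L[ℂ] Hilb d L) (j : Fin d) :
    Submodule ℂ (Hilb d L) :=
  (position L j).domain ⊓ (position L j).domain.comap (H : Hilb d L →ₗ[ℂ] Hilb d L)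

/-- The commutator `[X_j, H]` as a linear map on its domain. -/
noncomputable def commutatorMap (H : Hilb d L →L[ℂ] Hilb d L) (j : Fin d) :
    commutatorDomain H j →ₗ[ℂ] Hilb d L :=
  (position L j).toFun ∘ₗ (H : Hilb d L →ₗ[ℂ] Hilb d L).restrict
      (p := commutatorDomain H j) (fun _ hψ => hψ.2)
    - (H : Hilb d L →ₗ[ℂ] Hilb d L) ∘ₗ (position L j).toFun ∘ₗ Submodule.inclusion inf_le_left

theorem commutatorMap_apply (j : Fin d) {ψ : Hilb d L} (hψ : ψ ∈ (position L j).domain)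
    (hHψ : H ψ ∈ (position L j).domain) :
    commutatorMap H j ⟨ψ, hψ, hHψ⟩ = position L j ⟨H ψ, hHψ⟩ - H (position L j ⟨ψ, hψ⟩) := rfl

theorem HasFiniteRange.norm_commutatorMap_le_card_cube (hR : HasFiniteRange H R) {m : ℕ}
    (hm : R ≤ m) (j : Fin d) (ψ : commutatorDomain H j) :
    ‖commutatorMap H j ψ‖ ≤ m * ‖H‖ * (cube (d := d) m 0).card * ‖(ψ : Hilb d L)‖ := by
  obtain ⟨ψ, hψ, hHψ⟩ := ψ
  refine norm_le_of_norm_apply_le_sum_cube (by positivity) m fun x => ?_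
  have hsum : commutatorMap H j ⟨ψ, hψ, hHψ⟩ x
      = ∑ y ∈ cube m x, ((x j : ℂ) - y j) • H (lp.single 2 y (ψ y)) x := by
    rw [commutatorMap_apply j hψ hHψ, lp.coeFn_sub, Pi.sub_apply, position_apply,
      hR.apply_eq_sum hm (position L j ⟨ψ, hψ⟩)]
    simp only [hR.apply_eq_sum hm ψ, Finset.smul_sum, ← Finset.sum_sub_distrib,
      position_apply, sub_smul, lp.single_smul, map_smul, lp.coeFn_smul, Pi.smul_apply]
  rw [hsum, Finset.mul_sum]
  refine norm_sum_le_of_le _ fun y hy => ?_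
  rw [norm_smul, mul_assoc, ← Int.cast_sub, Complex.norm_intCast]
  gcongr
  · exact_mod_cast mem_cube.mp hy j
  · calc ‖H (lp.single 2 y (ψ y)) x‖ ≤ ‖H (lp.single 2 y (ψ y))‖ :=
          lp.norm_apply_le_norm (by norm_num) _ x
      _ ≤ ‖H‖ * ‖ψ y‖ := by
          refine (H.le_opNorm _).trans_eq ?_
          rw [lp.norm_single (by norm_num)]

theorem commutatorNorm_le_maxCommutator (H : Hilb d L →L[ℂ] Hilb d L) (j : Fin d) :
    commutatorNorm H j ≤ maxCommutator H :=
  le_ciSup (Set.finite_range fun j : Fin d => commutatorNorm H j).bddAbove j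

theorem commutatorNorm_nonneg (H : Hilb d L →L[ℂ] Hilb d L) (j : Fin d) :
    0 ≤ commutatorNorm H j := by
  refine Real.sSup_nonneg ?_
  rintro r ⟨ψ, h, -, rfl⟩
  exact norm_nonneg _

theorem maxCommutator_nonneg (H : Hilb d L →L[ℂ] Hilb d L) : 0 ≤ maxCommutator H :=
  Real.iSup_nonneg fun j => commutatorNorm_nonneg H j

theorem HasFiniteRange.norm_commutatorMap_le (hR : HasFiniteRange H R) (j : Fin d)
    (ψ : commutatorDomain H j) :
    ‖commutatorMap H j ψ‖ ≤ maxCommutator H * ‖(ψ : Hilb d L)‖ := by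
  obtain ⟨m, hm⟩ := exists_nat_ge R
  let C := (commutatorMap H j).mkContinuous _ (hR.norm_commutatorMap_le_card_cube hm j)
  have hC : ‖C‖ ≤ commutatorNorm H j := by
    refine C.opNorm_le_of_unit_norm (commutatorNorm_nonneg H j) fun φ hφ => ?_
    refine le_csSup ⟨m * ‖H‖ * (cube (d := d) m 0).card, ?_⟩
      ⟨⟨φ, φ.2.1⟩, φ.2.2, hφ.le, rfl⟩
    rintro r ⟨χ, hχ, hχ1, rfl⟩
    refine (hR.norm_commutatorMap_le_card_cube hm j ⟨χ, χ.2, hχ⟩).trans ?_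
    exact mul_le_of_le_one_right (by positivity) hχ1
  exact C.le_of_opNorm_le (hC.trans (commutatorNorm_le_maxCommutator H j)) ψ

/-- Multiplication by the phase `e^{iθ}` on `ℓ²(ℤ^d, ℂ^L)`. -/
noncomputable def modulate (L : ℕ) (θ : (Fin d → ℤ) → ℝ) : Hilb d L →ₗᵢ[ℂ] Hilb d L where
  toFun ψ := ⟨fun x => Complex.exp (θ x * Complex.I) • ψ x,
    (lp.memℓp ψ).mono' fun x => by rw [norm_smul, Complex.norm_exp_ofReal_mul_I, one_mul]⟩
  map_add' ψ φ := lp.ext (funext fun x => smul_add _ (ψ x) (φ x))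
  map_smul' c ψ := lp.ext (funext fun x => smul_comm _ c (ψ x))
  norm_map' ψ := by
    have hnorm : ∀ x, ‖Complex.exp (θ x * Complex.I) • ψ x‖ = ‖ψ x‖ := fun x => by
      rw [norm_smul, Complex.norm_exp_ofReal_mul_I, one_mul]
    exact le_antisymm (lp.norm_mono (by norm_num) fun x => (hnorm x).le)
      (lp.norm_mono (by norm_num) fun x => (hnorm x).ge)

theorem modulate_apply (θ : (Fin d → ℤ) → ℝ) (ψ : Hilb d L) (x : Fin d → ℤ) :
    modulate L θ ψ x = Complex.exp (θ x * Complex.I) • ψ x := rfl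

theorem modulate_apply_eq_zero (θ : (Fin d → ℤ) → ℝ) {ψ : Hilb d L} {y : Fin d → ℤ}
    (h : ψ y = 0) : modulate L θ ψ y = 0 := by
  rw [modulate_apply, h, smul_zero]

theorem modulate_zero_apply (ψ : Hilb d L) : modulate L (fun _ => 0) ψ = ψ :=
  lp.ext (funext fun x => by
    rw [modulate_apply, Complex.ofReal_zero, zero_mul, Complex.exp_zero, one_smul])

theorem modulate_modulate_neg (θ : (Fin d → ℤ) → ℝ) (ψ : Hilb d L) :
    modulate L θ (modulate L (fun x => -θ x) ψ) = ψ :=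
  lp.ext (funext fun x => by
    rw [modulate_apply, modulate_apply, smul_smul, ← Complex.exp_add, Complex.ofReal_neg,
      ← add_mul, add_neg_cancel, zero_mul, Complex.exp_zero, one_smul])

theorem modulate_single (θ : (Fin d → ℤ) → ℝ) (y : Fin d → ℤ) (v : EuclideanSpace ℂ (Fin L)) :
    modulate L θ (lp.single 2 y v) = Complex.exp (θ y * Complex.I) • lp.single 2 y v := by
  refine lp.ext (funext fun x => ?_)
  rw [modulate_apply, lp.coeFn_smul, Pi.smul_apply, lp.single_apply]
  by_cases hx : x = y
  · rw [hx]
  · rw [Pi.single_eq_of_ne hx, smul_zero, smul_zero]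

theorem hasDerivAt_modulate (j : Fin d) {ψ : Hilb d L} {S : Finset (Fin d → ℤ)}
    (hS : ∀ y ∉ S, ψ y = 0) (t : ℝ)
    (ht : modulate L (fun x => t * x j) ψ ∈ (position L j).domain) :
    HasDerivAt (fun t : ℝ => modulate L (fun x => t * x j) ψ)
      (Complex.I • position L j ⟨_, ht⟩) t := by
  have hsum : ∀ t : ℝ, modulate L (fun x => t * x j) ψ
      = ∑ y ∈ S, Complex.exp (((t * y j : ℝ) : ℂ) * Complex.I) • lp.single 2 y (ψ y) := by
    intro t
    conv_lhs => rw [eq_sum_single_of_support hS]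
    rw [map_sum]
    exact Finset.sum_congr rfl fun y _ => modulate_single _ y _
  have hexp : ∀ y : Fin d → ℤ, HasDerivAt
      (fun t : ℝ => Complex.exp (((t * y j : ℝ) : ℂ) * Complex.I))
      (Complex.exp (((t * y j : ℝ) : ℂ) * Complex.I) * ((y j : ℂ) * Complex.I)) t := by
    intro y
    have h := (((hasDerivAt_id t).mul_const (y j : ℝ)).ofReal_comp.mul_const Complex.I).cexp
    simpa only [id, one_mul, Complex.ofReal_intCast] using h
  have hderiv : Complex.I • position L j ⟨_, ht⟩
      = ∑ y ∈ S, (Complex.exp (((t * y j : ℝ) : ℂ) * Complex.I) * ((y j : ℂ) * Complex.I))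
        • lp.single 2 y (ψ y) := by
    have hsupp : ∀ y ∉ S, (Complex.I • position L j ⟨_, ht⟩) y = 0 := fun y hy => by
      rw [lp.coeFn_smul, Pi.smul_apply, position_apply, modulate_apply_eq_zero _ (hS y hy),
        smul_zero, smul_zero]
    rw [eq_sum_single_of_support hsupp]
    refine Finset.sum_congr rfl fun y _ => ?_
    rw [lp.coeFn_smul, Pi.smul_apply, position_apply, modulate_apply, smul_smul, smul_smul,
      lp.single_smul]
    congr 1
    ring
  rw [hderiv, funext hsum]
  exact HasDerivAt.fun_sum fun y _ =>
    (hexp y).smul_const (lp.single 2 y (ψ y) : Hilb d L)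

theorem inner_position_left (j : Fin d) (ψ φ : (position L j).domain) :
    inner ℂ (position L j ψ) (φ : Hilb d L) = inner ℂ (ψ : Hilb d L) (position L j φ) := by
  rw [lp.inner_eq_tsum, lp.inner_eq_tsum]
  refine tsum_congr fun x => ?_
  rw [position_apply, position_apply, inner_smul_left, inner_smul_right, map_intCast]

theorem hasDerivAt_inner_modulate (hR : HasFiniteRange H R) (j : Fin d) {φ ψ : Hilb d L}
    {S T : Finset (Fin d → ℤ)} (hT : ∀ y ∉ T, φ y = 0) (hS : ∀ y ∉ S, ψ y = 0) (t : ℝ) :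
    ∃ χ : commutatorDomain H j, (χ : Hilb d L) = modulate L (fun x => t * x j) ψ ∧
      HasDerivAt (fun t : ℝ => inner ℂ (modulate L (fun x => t * x j) φ)
          (H (modulate L (fun x => t * x j) ψ)))
        (-Complex.I * inner ℂ (modulate L (fun x => t * x j) φ) (commutatorMap H j χ)) t := by
  have hφ := mem_position_domain_of_support j fun y hy =>
    modulate_apply_eq_zero (fun x => t * x j) (hT y hy)
  have hψ := mem_position_domain_of_support j fun y hy =>
    modulate_apply_eq_zero (fun x => t * x j) (hS y hy)
  obtain ⟨T', hT'⟩ := hR.exists_support_apply fun y hy =>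
    modulate_apply_eq_zero (fun x => t * x j) (hS y hy)
  have hHψ := mem_position_domain_of_support j hT'
  refine ⟨⟨_, hψ, hHψ⟩, rfl, ?_⟩
  have h := (hasDerivAt_modulate j hT t hφ).inner ℂ
    ((H.restrictScalars ℝ).hasFDerivAt.comp_hasDerivAt t (hasDerivAt_modulate j hS t hψ))
  refine h.congr_deriv ?_
  have hsymm := inner_position_left j ⟨_, hφ⟩ ⟨_, hHψ⟩
  simp only [commutatorMap_apply j hψ hHψ, ContinuousLinearMap.coe_restrictScalars',
    Function.comp_apply, map_smul, inner_smul_left, inner_smul_right, inner_sub_right,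
    Complex.conj_I, hsymm]
  ring

/-- Duhamel's formula: the derivative of `e^{-isX_j} H e^{isX_j}` is, up to conjugation and a
factor of modulus one, the commutator `[X_j, H]`. -/
theorem HasFiniteRange.norm_modulate_comm_le (hR : HasFiniteRange H R) (j : Fin d)
    {ψ : Hilb d L} {S : Finset (Fin d → ℤ)} (hS : ∀ y ∉ S, ψ y = 0) {s : ℝ} (hs : 0 ≤ s) :
    ‖modulate L (fun x => s * x j) (H ψ) - H (modulate L (fun x => s * x j) ψ)‖
      ≤ s * maxCommutator H * ‖ψ‖ := by
  set U : ℝ → Hilb d L →ₗᵢ[ℂ] Hilb d L := fun t => modulate L (fun x => t * x j) with hU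
  set v := U s (H ψ) - H (U s ψ) with hv
  obtain ⟨T₁, hT₁⟩ := hR.exists_support_apply hS
  obtain ⟨T₂, hT₂⟩ := hR.exists_support_apply (H := H) (ψ := U s ψ) fun y hy =>
    modulate_apply_eq_zero _ (hS y hy)
  set φ := modulate L (fun x => -(s * x j)) v with hφ
  have hUφ : U s φ = v := modulate_modulate_neg _ v
  have hT : ∀ y ∉ T₁ ∪ T₂, φ y = 0 := fun y hy => by
    rw [Finset.notMem_union] at hy
    refine modulate_apply_eq_zero _ ?_
    rw [hv, lp.coeFn_sub, Pi.sub_apply, hT₂ y hy.2, sub_zero]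
    exact modulate_apply_eq_zero _ (hT₁ y hy.1)
  choose χ hχ hderiv using hasDerivAt_inner_modulate hR j hT hS
  have hbound : ∀ t, ‖-Complex.I * inner ℂ (U t φ) (commutatorMap H j (χ t))‖
      ≤ ‖v‖ * (maxCommutator H * ‖ψ‖) := fun t => by
    rw [norm_mul, norm_neg, Complex.norm_I, one_mul]
    refine (norm_inner_le_norm _ _).trans ?_
    rw [(U t).norm_map, hφ, (modulate L _).norm_map]
    refine mul_le_mul_of_nonneg_left ((hR.norm_commutatorMap_le j _).trans_eq ?_) (norm_nonneg _)
    rw [hχ, (modulate L _).norm_map]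
  have hmean := norm_image_sub_le_of_norm_deriv_le_segment' (a := 0) (b := s)
    (fun t _ => (hderiv t).hasDerivWithinAt) (fun t _ => hbound t) s ⟨hs, le_rfl⟩
  have hsq : ‖v‖ ^ 2 ≤ ‖v‖ * (maxCommutator H * ‖ψ‖) * (s - 0) := by
    have hinner : inner ℂ v v = inner ℂ (U 0 φ) (H (U 0 ψ)) - inner ℂ (U s φ) (H (U s ψ)) := by
      have hzero : ∀ ξ, U 0 ξ = ξ := fun ξ => by
        simpa only [hU, zero_mul] using modulate_zero_apply ξ
      rw [hzero, hzero, ← (U s).inner_map_map φ, hUφ, ← inner_sub_right]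
    calc ‖v‖ ^ 2 = ‖(inner ℂ v v : ℂ)‖ := by
          rw [inner_self_eq_norm_sq_to_K, norm_pow, RCLike.norm_ofReal, abs_norm]
      _ ≤ _ := by
          rw [hinner, norm_sub_rev]
          exact hmean
  nlinarith [norm_nonneg v, mul_nonneg hs (mul_nonneg (maxCommutator_nonneg H) (norm_nonneg ψ))]

end InfiniteVolume

/-! ### Periodization -/

section Cells

variable {d L ρ : ℕ}

/-- The point of `ℤ^d` lying over `u` in the fundamental cell with index `a`. -/
def cell (u : Torus d ρ) (a : Fin d → ℤ) : Fin d → ℤ := u.coord + (2 * (ρ : ℤ)) • a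

theorem cell_apply (u : Torus d ρ) (a : Fin d → ℤ) (j : Fin d) :
    cell u a j = u.coord j + 2 * ρ * a j := by
  rw [cell, Pi.add_apply, Pi.smul_apply, smul_eq_mul]

theorem coord_mem (u : Torus d ρ) (j : Fin d) : -(ρ : ℤ) < u.coord j ∧ u.coord j ≤ ρ :=
  Finset.mem_Ioc.mp (u j).2

theorem coord_injective : Function.Injective (Torus.coord (d := d) (ρ := ρ)) :=
  fun _ _ h => funext fun j => Subtype.ext (congrFun h j)

theorem cell_injective : Function.Injective2 (cell (d := d) (ρ := ρ)) := by
  intro u v a b h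
  have hab : a = b := by
    funext j
    have hj := congrFun h j
    rw [cell_apply, cell_apply] at hj
    have hu := coord_mem u j
    have hv := coord_mem v j
    by_contra hne
    rcases lt_or_gt_of_ne hne with hlt | hlt <;> nlinarith
  subst hab
  exact ⟨coord_injective (add_right_cancel h), rfl⟩

theorem exists_cell_eq (hρ : 0 < ρ) (x : Fin d → ℤ) : ∃ (u : Torus d ρ) (a : _), cell u a = x := by
  have hρ' : (0 : ℤ) < 2 * ρ := by omega
  have hmem : ∀ j, x j - 2 * ρ * ((x j + ρ - 1) / (2 * ρ)) ∈ Finset.Ioc (-(ρ : ℤ)) ρ := by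
    intro j
    have hdiv := Int.emod_add_mul_ediv (x j + ρ - 1) (2 * ρ)
    have hnonneg := Int.emod_nonneg (x j + ρ - 1) hρ'.ne'
    have hlt := Int.emod_lt_of_pos (x j + ρ - 1) hρ'
    rw [Finset.mem_Ioc]
    constructor <;> linarith
  refine ⟨fun j => ⟨_, hmem j⟩, fun j => (x j + ρ - 1) / (2 * ρ), funext fun j => ?_⟩
  rw [cell_apply]
  exact sub_add_cancel _ _

/-- The points in the cells with index in `Q`. -/
noncomputable def cells (ρ : ℕ) (Q : Finset (Fin d → ℤ)) : Finset (Fin d → ℤ) :=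
  (Q ×ˢ (Finset.univ : Finset (Torus d ρ))).image fun q => cell q.2 q.1

theorem cell_mem_cells {Q : Finset (Fin d → ℤ)} {u : Torus d ρ} {a : Fin d → ℤ} :
    cell u a ∈ cells ρ Q ↔ a ∈ Q := by
  simp only [cells, Finset.mem_image, Finset.mem_product, Finset.mem_univ, and_true]
  constructor
  · rintro ⟨⟨b, v⟩, hb, h⟩
    rwa [← (cell_injective h).2]
  · exact fun h => ⟨⟨a, u⟩, h, rfl⟩

theorem sum_cells {A : Type*} [AddCommMonoid A] (Q : Finset (Fin d → ℤ))
    (f : (Fin d → ℤ) → A) :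
    ∑ x ∈ cells ρ Q, f x = ∑ a ∈ Q, ∑ u : Torus d ρ, f (cell u a) := by
  rw [cells, Finset.sum_image, Finset.sum_product]
  rintro ⟨a, u⟩ _ ⟨b, v⟩ _ h
  obtain ⟨huv, hab⟩ := cell_injective h
  exact Prod.ext hab huv

/-- The component of `ψ` at the site `u`. -/
noncomputable def fiber (ψ : EuclideanSpace ℂ (Torus d ρ × Fin L)) (u : Torus d ρ) :
    EuclideanSpace ℂ (Fin L) := WithLp.toLp 2 fun b => ψ (u, b)

theorem fiber_add (ψ φ : EuclideanSpace ℂ (Torus d ρ × Fin L)) (u : Torus d ρ) :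
    fiber (ψ + φ) u = fiber ψ u + fiber φ u := rfl

theorem fiber_smul (c : ℂ) (ψ : EuclideanSpace ℂ (Torus d ρ × Fin L)) (u : Torus d ρ) :
    fiber (c • ψ) u = c • fiber ψ u := rfl

theorem norm_sq_eq_sum_fiber (ψ : EuclideanSpace ℂ (Torus d ρ × Fin L)) :
    ‖ψ‖ ^ 2 = ∑ u, ‖fiber ψ u‖ ^ 2 := by
  simp only [EuclideanSpace.norm_sq_eq, fiber, Fintype.sum_prod_type]

/-- The restriction of the periodic extension of `ψ` to the cells with index in `Q`. -/
noncomputable def periodize (Q : Finset (Fin d → ℤ)) :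
    EuclideanSpace ℂ (Torus d ρ × Fin L) →ₗ[ℂ] Hilb d L where
  toFun ψ := ∑ a ∈ Q, ∑ u : Torus d ρ, lp.single 2 (cell u a) (fiber ψ u)
  map_add' ψ φ := by simp only [fiber_add, lp.single_add, Finset.sum_add_distrib]
  map_smul' c ψ := by simp only [fiber_smul, lp.single_smul, Finset.smul_sum, RingHom.id_apply]

theorem periodize_apply_cell (Q : Finset (Fin d → ℤ)) (ψ : EuclideanSpace ℂ (Torus d ρ × Fin L))
    (u : Torus d ρ) (a : Fin d → ℤ) :
    periodize Q ψ (cell u a) = if a ∈ Q then fiber ψ u else 0 := by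
  have hsingle : ∀ (b : Fin d → ℤ) (v : Torus d ρ),
      (lp.single 2 (cell v b) (fiber ψ v) : Hilb d L) (cell u a)
        = if b = a then (if v = u then fiber ψ v else 0) else 0 := fun b v => by
    rw [lp.single_apply, Pi.single_apply, ← ite_and]
    refine if_congr ⟨fun h => ?_, fun ⟨hb, hv⟩ => by rw [hb, hv]⟩ rfl rfl
    obtain ⟨hu, ha⟩ := cell_injective h
    exact ⟨ha.symm, hu.symm⟩
  simp only [periodize, LinearMap.coe_mk, AddHom.coe_mk, lp.coeFn_sum, Finset.sum_apply, hsingle,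
    Finset.sum_ite_irrel, Finset.sum_const_zero, Finset.sum_ite_eq', Finset.mem_univ, if_true]

theorem periodize_apply_eq_zero (Q : Finset (Fin d → ℤ))
    (ψ : EuclideanSpace ℂ (Torus d ρ × Fin L)) {x : Fin d → ℤ} (hx : x ∉ cells ρ Q) :
    periodize Q ψ x = 0 := by
  simp only [periodize, LinearMap.coe_mk, AddHom.coe_mk, lp.coeFn_sum, Finset.sum_apply]
  refine Finset.sum_eq_zero fun a ha => Finset.sum_eq_zero fun u _ => ?_
  refine lp.single_apply_ne _ _ _ fun h => hx ?_
  rw [h]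
  exact cell_mem_cells.mpr ha

theorem norm_periodize (Q : Finset (Fin d → ℤ)) (ψ : EuclideanSpace ℂ (Torus d ρ × Fin L)) :
    ‖periodize Q ψ‖ = √Q.card * ‖ψ‖ := by
  have hsq : ‖periodize Q ψ‖ ^ 2 = Q.card * ‖ψ‖ ^ 2 := by
    rw [norm_sq_eq_sum_of_support fun x => periodize_apply_eq_zero Q ψ, norm_sq_eq_sum_fiber,
      sum_cells, ← nsmul_eq_mul, ← Finset.sum_const]
    refine Finset.sum_congr rfl fun a ha => Finset.sum_congr rfl fun u _ => ?_
    rw [periodize_apply_cell, if_pos ha]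
  rw [← Real.sqrt_sq (norm_nonneg (periodize Q ψ)), hsq,
    Real.sqrt_mul (Nat.cast_nonneg _), Real.sqrt_sq (norm_nonneg _)]

/-- The coordinate angles `π x_j / ρ` of the torus. -/
noncomputable def angle (L : ℕ) (j : Fin d) (u : Torus d ρ × Fin L) : ℝ :=
  Real.pi / ρ * (u.1.coord j : ℝ)

theorem exp_angle_cell (hρ : 0 < ρ) (u : Torus d ρ) (a : Fin d → ℤ) (j : Fin d) :
    Complex.exp (((Real.pi / ρ * (cell u a j : ℝ) : ℝ) : ℂ) * Complex.I)
      = Complex.exp (((Real.pi / ρ * (u.coord j : ℝ) : ℝ) : ℂ) * Complex.I) := by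
  rw [Complex.exp_eq_exp_iff_exists_int]
  refine ⟨a j, ?_⟩
  have : (ρ : ℂ) ≠ 0 := by exact_mod_cast hρ.ne'
  rw [cell_apply]
  push_cast
  field_simp

theorem periodize_phase (hρ : 0 < ρ) (Q : Finset (Fin d → ℤ)) (j : Fin d)
    (ψ : EuclideanSpace ℂ (Torus d ρ × Fin L)) :
    periodize Q (toEuclideanCLM (𝕜 := ℂ) (phase (angle L j)) ψ)
      = modulate L (fun x => Real.pi / ρ * x j) (periodize Q ψ) := by
  have hfiber : ∀ u : Torus d ρ, fiber (toEuclideanCLM (𝕜 := ℂ) (phase (angle L j)) ψ) u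
      = Complex.exp (((Real.pi / ρ * (u.coord j : ℝ) : ℝ) : ℂ) * Complex.I) • fiber ψ u := by
    intro u
    ext b
    simp only [fiber, ofLp_toEuclideanCLM, phase, mulVec_diagonal, angle, WithLp.ofLp_smul,
      Pi.smul_apply, smul_eq_mul]
  refine lp.ext (funext fun x => ?_)
  obtain ⟨u, a, rfl⟩ := exists_cell_eq hρ x
  rw [modulate_apply, periodize_apply_cell, periodize_apply_cell, smul_ite, smul_zero, hfiber,
    exp_angle_cell hρ]

end Cells

section PeriodicHamiltonian

variable {d L ρ : ℕ} {H : Hilb d L →L[ℂ] Hilb d L} {R : ℝ} {p : Fin d → ℕ}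

theorem notMem_cube_cell {m : ℕ} (u v : Torus d ρ) {c : Fin d → ℤ} (hc : c ∉ cube (m + 1) 0) :
    cell v c ∉ cube m u.coord := by
  refine fun h => hc ?_
  rw [mem_cube] at h ⊢
  intro j
  have hj := h j
  have hu := coord_mem u j
  have hv := coord_mem v j
  rw [cell_apply, abs_le] at hj
  rw [Pi.zero_apply, zero_sub, abs_neg, abs_le]
  push_cast
  constructor <;> by_contra hlt <;> push Not at hlt <;> nlinarith

/-- The contribution of the cell at distance `c` to the value of `H` at `u` on the periodic
extension of `ψ`. -/
noncomputable def hopping (H : Hilb d L →L[ℂ] Hilb d L)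
    (ψ : EuclideanSpace ℂ (Torus d ρ × Fin L)) (c : Fin d → ℤ) (u : Torus d ρ) :
    EuclideanSpace ℂ (Fin L) :=
  ∑ v, H (lp.single 2 (cell v c) (fiber ψ v)) u.coord

theorem HasFiniteRange.hopping_eq_zero (hR : HasFiniteRange H R) {m : ℕ} (hm : R ≤ m)
    (ψ : EuclideanSpace ℂ (Torus d ρ × Fin L)) (u : Torus d ρ) {c : Fin d → ℤ}
    (hc : c ∉ cube (m + 1) 0) : hopping H ψ c u = 0 :=
  Finset.sum_eq_zero fun v _ => hR.apply_single_eq_zero hm (notMem_cube_cell u v hc) _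

theorem HasFiniteRange.fiber_perHam (hR : HasFiniteRange H R) {m : ℕ} (hm : R ≤ m)
    (ψ : EuclideanSpace ℂ (Torus d ρ × Fin L)) (u : Torus d ρ) :
    fiber (toEuclideanCLM (𝕜 := ℂ) (perHam H ρ) ψ) u = ∑ c ∈ cube (m + 1) 0, hopping H ψ c u := by
  have hentry : ∀ i v b, perHam H ρ (u, i) (v, b)
      = ∑ c ∈ cube (m + 1) 0, kernel H u.coord (cell v c) i b := by
    refine fun i v b => finsum_eq_finsetSum_of_support_subset _ fun c hc => ?_
    by_contra hcube
    refine hc ?_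
    change kernel H u.coord (cell v c) i b = 0
    rw [hR.kernel_eq_zero_of_notMem hm (notMem_cube_cell u v hcube), Matrix.zero_apply]
  ext i
  simp only [hopping, fiber, ofLp_toEuclideanCLM, mulVec, dotProduct, WithLp.ofLp_sum,
    Finset.sum_apply, apply_single_eq, Fintype.sum_prod_type, hentry, Finset.sum_mul]
  simp only [Finset.sum_comm (t := cube (m + 1) 0)]

theorem IsPeriodic.apply_single_cell (hp : IsPeriodic H p) (hdvd : ∀ j, p j ∣ 2 * ρ)
    (u v : Torus d ρ) (a b : Fin d → ℤ) (w : EuclideanSpace ℂ (Fin L)) :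
    H (lp.single 2 (cell v b) w) (cell u a) = H (lp.single 2 (cell v (b - a)) w) u.coord := by
  rw [apply_single_eq, apply_single_eq, ← hp.shift hdvd a u.coord]
  congr 3
  simp only [cell, smul_sub]
  abel

theorem HasFiniteRange.apply_periodize_cell (hR : HasFiniteRange H R) (hp : IsPeriodic H p)
    (hdvd : ∀ j, p j ∣ 2 * ρ) {m : ℕ} (hm : R ≤ m) (Q : Finset (Fin d → ℤ))
    (ψ : EuclideanSpace ℂ (Torus d ρ × Fin L)) (u : Torus d ρ) (a : Fin d → ℤ) :
    H (periodize Q ψ) (cell u a)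
      = ∑ c ∈ cube (m + 1) 0, if a + c ∈ Q then hopping H ψ c u else 0 := by
  have hsum : H (periodize Q ψ) (cell u a) = ∑ b ∈ Q, hopping H ψ (b - a) u := by
    rw [apply_eq_sum_support H fun x => periodize_apply_eq_zero Q ψ, sum_cells]
    refine Finset.sum_congr rfl fun b hb => Finset.sum_congr rfl fun v _ => ?_
    rw [periodize_apply_cell, if_pos hb, hp.apply_single_cell hdvd]
  rw [hsum, ← Finset.sum_filter, ← Finset.sum_filter_of_ne
    (s := Q) (p := fun b => b - a ∈ cube (m + 1) 0) fun b _ hne => by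
      by_contra hb
      exact hne (hR.hopping_eq_zero hm ψ u hb)]
  refine Finset.sum_bij' (fun b _ => b - a) (fun c _ => a + c) ?_ ?_ (fun b _ => add_sub_cancel _ _)
    (fun c _ => add_sub_cancel_left _ _) (fun b _ => rfl)
  · simp only [Finset.mem_filter, add_sub_cancel]
    exact fun b hb => hb.symm
  · simp only [Finset.mem_filter, add_sub_cancel_left]
    exact fun c hc => hc.symm

/-- The cell indices in `{0, …, N}^d`. -/
noncomputable def box (d N : ℕ) : Finset (Fin d → ℤ) := Finset.Icc 0 N

theorem card_box (d N : ℕ) : (box d N).card = (N + 1) ^ d := by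
  simp [box, Pi.card_Icc]

/-- The cell indices at distance less than or about `m` from the boundary of `box d N`. -/
noncomputable def shell (d m N : ℕ) : Finset (Fin d → ℤ) :=
  Finset.Icc (-m) (N + m) \ Finset.Icc m (N - m)

theorem card_shell {d m N : ℕ} (h : 2 * m ≤ N) :
    ((shell d m N).card : ℝ) = ((N : ℝ) + 1 + 2 * m) ^ d - ((N : ℝ) + 1 - 2 * m) ^ d := by
  have hsub : Finset.Icc (m : Fin d → ℤ) (N - m) ⊆ Finset.Icc (-m) (N + m) :=
    Finset.Icc_subset_Icc (fun j => by simp only [Pi.neg_apply, Pi.natCast_apply]; omega)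
      (fun j => by simp only [Pi.sub_apply, Pi.add_apply, Pi.natCast_apply]; omega)
  have houter : (N + m + 1 - -m : ℤ).toNat = N + 1 + 2 * m := by omega
  have hinner : (N - m + 1 - m : ℤ).toNat = N + 1 - 2 * m := by omega
  rw [shell, Finset.card_sdiff_of_subset hsub, Nat.cast_sub (Finset.card_le_card hsub)]
  simp only [Pi.card_Icc, Int.card_Icc, Pi.add_apply, Pi.sub_apply, Pi.neg_apply, Pi.natCast_apply,
    Finset.prod_const, Finset.card_univ, Fintype.card_fin, houter, hinner]
  push_cast [Nat.cast_sub (by omega : 2 * m ≤ N + 1)]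
  ring

theorem add_mem_box_iff_of_notMem_shell {m N : ℕ} {a c : Fin d → ℤ} (ha : a ∉ shell d m N)
    (hc : c ∈ cube m 0) : a + c ∈ box d N ↔ a ∈ box d N := by
  simp only [shell, Finset.mem_sdiff, not_and_not_right, Finset.mem_Icc, Pi.le_def, Pi.add_apply,
    Pi.sub_apply, Pi.neg_apply, Pi.natCast_apply, ← forall_and] at ha
  simp only [box, Finset.mem_Icc, Pi.le_def, Pi.add_apply, Pi.zero_apply, Pi.natCast_apply,
    ← forall_and]
  have hc' : ∀ j, -(m : ℤ) ≤ c j ∧ c j ≤ m := fun j => by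
    simpa only [Pi.zero_apply, zero_sub, abs_neg, abs_le] using mem_cube.mp hc j
  constructor
  · intro h
    have hinner := ha fun j => ⟨by linarith [h j, hc' j], by linarith [h j, hc' j]⟩
    exact fun j => ⟨by linarith [hinner j], by linarith [hinner j]⟩
  · intro h
    have hinner := ha fun j => ⟨by linarith [h j], by linarith [h j]⟩
    exact fun j => ⟨by linarith [hinner j, hc' j], by linarith [hinner j, hc' j]⟩

theorem tendsto_card_shell_div_card_box (d m : ℕ) :
    Filter.Tendsto (fun N : ℕ => ((shell d m N).card : ℝ) / (box d N).card) Filter.atTop (𝓝 0) := by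
  have hdiv : Filter.Tendsto (fun N : ℕ => 2 * (m : ℝ) / ((N + 1 : ℕ) : ℝ)) Filter.atTop (𝓝 0) :=
    (tendsto_const_div_atTop_nhds_zero_nat _).comp (Filter.tendsto_add_atTop_nat 1)
  have hpow := ((hdiv.const_add 1).pow d).sub ((hdiv.const_sub 1).pow d)
  simp only [add_zero, sub_zero, sub_self] at hpow
  refine hpow.congr' ?_
  filter_upwards [Filter.eventually_ge_atTop (2 * m)] with N hN
  have hN' : ((N + 1 : ℕ) : ℝ) ≠ 0 := by positivity
  rw [card_shell hN, card_box, Nat.cast_pow, sub_div, ← div_pow, ← div_pow, one_add_div hN',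
    one_sub_div hN', Nat.cast_succ]

theorem HasFiniteRange.exists_norm_sq_apply_periodize_sub_le (hρ : 0 < ρ)
    (hR : HasFiniteRange H R) (hp : IsPeriodic H p) (hdvd : ∀ j, p j ∣ 2 * ρ)
    (ψ : EuclideanSpace ℂ (Torus d ρ × Fin L)) :
    ∃ (m : ℕ) (K : ℝ), ∀ N, ‖H (periodize (box d N) ψ)
      - periodize (box d N) (toEuclideanCLM (𝕜 := ℂ) (perHam H ρ) ψ)‖ ^ 2
        ≤ K * (shell d m N).card := by
  obtain ⟨m, hm⟩ := exists_nat_ge R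
  refine ⟨m + 1, ∑ u : Torus d ρ, (∑ c ∈ cube (m + 1) 0, ‖hopping H ψ c u‖) ^ 2, fun N => ?_⟩
  set δ := H (periodize (box d N) ψ)
    - periodize (box d N) (toEuclideanCLM (𝕜 := ℂ) (perHam H ρ) ψ) with hδ
  have hvalue : ∀ (u : Torus d ρ) (a : Fin d → ℤ), δ (cell u a) = ∑ c ∈ cube (m + 1) 0,
      ((if a + c ∈ box d N then hopping H ψ c u else 0)
        - if a ∈ box d N then hopping H ψ c u else 0) := fun u a => by
    rw [hδ, lp.coeFn_sub, Pi.sub_apply, hR.apply_periodize_cell hp hdvd hm, periodize_apply_cell,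
      hR.fiber_perHam hm, Finset.sum_sub_distrib, Finset.sum_ite_irrel, Finset.sum_const_zero]
  have hsupport : ∀ x ∉ cells ρ (shell d (m + 1) N), δ x = 0 := fun x hx => by
    obtain ⟨u, a, rfl⟩ := exists_cell_eq hρ x
    rw [cell_mem_cells] at hx
    rw [hvalue]
    refine Finset.sum_eq_zero fun c hc => ?_
    rw [if_congr (add_mem_box_iff_of_notMem_shell hx hc) rfl rfl, sub_self]
  have hbound : ∀ (a : Fin d → ℤ) (u : Torus d ρ),
      ‖δ (cell u a)‖ ^ 2 ≤ (∑ c ∈ cube (m + 1) 0, ‖hopping H ψ c u‖) ^ 2 := fun a u => by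
    rw [hvalue]
    gcongr
    refine norm_sum_le_of_le _ fun c _ => ?_
    split_ifs <;> simp
  rw [norm_sq_eq_sum_of_support hsupport, sum_cells, mul_comm, ← nsmul_eq_mul, ← Finset.sum_const]
  exact Finset.sum_le_sum fun a _ => Finset.sum_le_sum fun u _ => hbound a u

/-- The periodic extension of a vector on the torus to a box of `(N + 1)^d` cells, normalized to
an isometry. -/
noncomputable def periodization (L ρ N : ℕ) :
    EuclideanSpace ℂ (Torus d ρ × Fin L) →ₗᵢ[ℂ] Hilb d L where
  toLinearMap := (((√(box d N).card)⁻¹ : ℝ) : ℂ) • periodize (box d N)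
  norm_map' ψ := by
    have hpos : 0 < √((box d N).card : ℝ) := by
      rw [card_box]
      positivity
    rw [LinearMap.smul_apply, norm_smul, Complex.norm_real, Real.norm_of_nonneg (by positivity),
      norm_periodize, inv_mul_cancel_left₀ hpos.ne']

theorem periodization_apply (N : ℕ) (ψ : EuclideanSpace ℂ (Torus d ρ × Fin L)) :
    periodization L ρ N ψ = (((√(box d N).card)⁻¹ : ℝ) : ℂ) • periodize (box d N) ψ := rfl

theorem periodization_phase (hρ : 0 < ρ) (N : ℕ) (j : Fin d)
    (ψ : EuclideanSpace ℂ (Torus d ρ × Fin L)) :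
    periodization L ρ N (toEuclideanCLM (𝕜 := ℂ) (phase (angle L j)) ψ)
      = modulate L (fun x => Real.pi / ρ * x j) (periodization L ρ N ψ) := by
  rw [periodization_apply, periodization_apply, periodize_phase hρ, map_smul]

theorem HasFiniteRange.tendsto_apply_periodization_sub (hρ : 0 < ρ) (hR : HasFiniteRange H R)
    (hp : IsPeriodic H p) (hdvd : ∀ j, p j ∣ 2 * ρ) (ψ : EuclideanSpace ℂ (Torus d ρ × Fin L)) :
    Filter.Tendsto (fun N => H (periodization L ρ N ψ)
      - periodization L ρ N (toEuclideanCLM (𝕜 := ℂ) (perHam H ρ) ψ)) Filter.atTop (𝓝 0) := by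
  obtain ⟨m, K, hK⟩ := hR.exists_norm_sq_apply_periodize_sub_le hρ hp hdvd ψ
  have hsqrt := ((tendsto_card_shell_div_card_box d m).const_mul K).sqrt
  rw [mul_zero, Real.sqrt_zero] at hsqrt
  refine squeeze_zero_norm (fun N => ?_) hsqrt
  refine Real.le_sqrt_of_sq_le ?_
  rw [periodization_apply, periodization_apply, map_smul, ← smul_sub, norm_smul,
    Complex.norm_real, mul_pow, Real.norm_eq_abs, sq_abs, inv_pow, Real.sq_sqrt (Nat.cast_nonneg _),
    ← mul_div_assoc, div_eq_inv_mul]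
  exact mul_le_mul_of_nonneg_left (hK N) (by positivity)

theorem tendsto_norm_of_tendsto_sub_zero {E : Type*} [SeminormedAddCommGroup E] {v w : ℕ → E}
    {r : ℝ} (h : Filter.Tendsto (fun n => v n - w n) Filter.atTop (𝓝 0)) (hw : ∀ n, ‖w n‖ = r) :
    Filter.Tendsto (fun n => ‖v n‖) Filter.atTop (𝓝 r) := by
  rw [tendsto_iff_norm_sub_tendsto_zero]
  refine squeeze_zero (fun n => norm_nonneg _) (fun n => ?_)
    (tendsto_zero_iff_norm_tendsto_zero.mp h)
  rw [← hw n]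
  exact abs_norm_sub_norm_le _ _

theorem HasFiniteRange.tendsto_norm_apply_periodization (hρ : 0 < ρ) (hR : HasFiniteRange H R)
    (hp : IsPeriodic H p) (hdvd : ∀ j, p j ∣ 2 * ρ) (ψ : EuclideanSpace ℂ (Torus d ρ × Fin L)) :
    Filter.Tendsto (fun N => ‖H (periodization L ρ N ψ)‖) Filter.atTop
      (𝓝 ‖toEuclideanCLM (𝕜 := ℂ) (perHam H ρ) ψ‖) :=
  tendsto_norm_of_tendsto_sub_zero (hR.tendsto_apply_periodization_sub hρ hp hdvd ψ) fun N =>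
    (periodization L ρ N).norm_map _

theorem HasFiniteRange.norm_perHam_le (hρ : 0 < ρ) (hR : HasFiniteRange H R)
    (hp : IsPeriodic H p) (hdvd : ∀ j, p j ∣ 2 * ρ) : ‖perHam H ρ‖ ≤ ‖H‖ := by
  refine ContinuousLinearMap.opNorm_le_bound _ (norm_nonneg _) fun ψ => ?_
  refine le_of_tendsto' (hR.tendsto_norm_apply_periodization hρ hp hdvd ψ) fun N => ?_
  simpa only [LinearIsometry.norm_map] using H.le_opNorm (periodization L ρ N ψ)

theorem HasFiniteRange.mul_norm_le_norm_perHam_apply (hρ : 0 < ρ) (hR : HasFiniteRange H R)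
    (hp : IsPeriodic H p) (hdvd : ∀ j, p j ∣ 2 * ρ) {g : ℝ} (hg : ∀ φ, g * ‖φ‖ ≤ ‖H φ‖)
    (ψ : EuclideanSpace ℂ (Torus d ρ × Fin L)) :
    g * ‖ψ‖ ≤ ‖toEuclideanCLM (𝕜 := ℂ) (perHam H ρ) ψ‖ := by
  refine ge_of_tendsto' (hR.tendsto_norm_apply_periodization hρ hp hdvd ψ) fun N => ?_
  simpa only [LinearIsometry.norm_map] using hg (periodization L ρ N ψ)

theorem HasFiniteRange.norm_lie_phase_perHam_le (hρ : 0 < ρ) (hR : HasFiniteRange H R)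
    (hp : IsPeriodic H p) (hdvd : ∀ j, p j ∣ 2 * ρ) (j : Fin d) :
    ‖⁅phase (angle (ρ := ρ) L j), perHam H ρ⁆‖ ≤ Real.pi / ρ * maxCommutator H := by
  have hM := maxCommutator_nonneg H
  refine ContinuousLinearMap.opNorm_le_bound _ (by positivity) fun ψ => ?_
  set h := toEuclideanCLM (𝕜 := ℂ) (perHam H ρ)
  set U := toEuclideanCLM (𝕜 := ℂ) (phase (angle (ρ := ρ) L j)) with hU
  set W := modulate (d := d) L (fun x => Real.pi / ρ * x j) with hW
  have hcomm : toEuclideanCLM (𝕜 := ℂ) ⁅phase (angle (ρ := ρ) L j), perHam H ρ⁆ ψ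
      = U (h ψ) - h (U ψ) := by
    rw [Ring.lie_def, map_sub, map_mul, map_mul]
    rfl
  have hlim : Filter.Tendsto (fun N => (W (H (periodization L ρ N ψ))
      - H (W (periodization L ρ N ψ))) - periodization L ρ N (U (h ψ) - h (U ψ)))
      Filter.atTop (𝓝 0) := by
    have hψ := hR.tendsto_apply_periodization_sub hρ hp hdvd ψ
    have hUψ := hR.tendsto_apply_periodization_sub hρ hp hdvd (U ψ)
    have hdiff := ((W.continuous.tendsto 0).comp hψ).sub hUψ
    rw [map_zero, sub_zero] at hdiff
    refine hdiff.congr fun N => ?_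
    simp only [Function.comp_apply, map_sub, hU, hW, periodization_phase hρ]
    abel
  refine le_of_tendsto' (tendsto_norm_of_tendsto_sub_zero hlim fun N => ?_) fun N => ?_
  · exact ((periodization L ρ N).norm_map _).trans (congrArg norm hcomm.symm)
  · have hsupport : ∀ x ∉ cells ρ (box d N), periodization L ρ N ψ x = 0 := fun x hx => by
      rw [periodization_apply, lp.coeFn_smul, Pi.smul_apply, periodize_apply_eq_zero _ ψ hx,
        smul_zero]
    simpa only [LinearIsometry.norm_map] using
      hR.norm_modulate_comm_le j hsupport (s := Real.pi / ρ) (by positivity)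

end PeriodicHamiltonian

section Gap

variable {d L : ℕ} {H : Hilb d L →L[ℂ] Hilb d L}

theorem nontrivial_hilb (hL : 0 < L) : Nontrivial (Hilb d L) := by
  refine ⟨⟨lp.single 2 0 (EuclideanSpace.single ⟨0, hL⟩ 1), 0, fun h => ?_⟩⟩
  have := congrArg norm h
  rw [lp.norm_single (by norm_num)] at this
  simp at this

theorem inverse_mul_self (h0 : (0 : ℂ) ∉ spectrum ℂ H) : Ring.inverse H * H = 1 :=
  Ring.inverse_mul_cancel _ ((spectrum.zero_notMem_iff ℂ).mp h0)

theorem gap_pos (hL : 0 < L) (h0 : (0 : ℂ) ∉ spectrum ℂ H) : 0 < gap H := by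
  have := nontrivial_hilb (d := d) hL
  refine inv_pos.mpr (norm_pos_iff.mpr fun h => ?_)
  have hinv := inverse_mul_self h0
  rw [h, zero_mul] at hinv
  exact zero_ne_one hinv

theorem gap_mul_norm_le (h0 : (0 : ℂ) ∉ spectrum ℂ H) (φ : Hilb d L) : gap H * ‖φ‖ ≤ ‖H φ‖ := by
  have hinv : Ring.inverse H (H φ) = φ := congrArg (fun T => T φ) (inverse_mul_self h0)
  have hle := (Ring.inverse H).le_opNorm (H φ)
  rw [hinv] at hle
  exact inv_mul_le_of_le_mul₀ (norm_nonneg _) (norm_nonneg _) hle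

theorem gap_le_norm (hL : 0 < L) (h0 : (0 : ℂ) ∉ spectrum ℂ H) : gap H ≤ ‖H‖ := by
  have := nontrivial_hilb (d := d) hL
  obtain ⟨φ, hφ⟩ := exists_ne (0 : Hilb d L)
  exact le_of_mul_le_mul_right ((gap_mul_norm_le h0 φ).trans (H.le_opNorm φ))
    (norm_pos_iff.mpr hφ)

end Gap

section LowerBound

variable {X : Type*} [Fintype X] [DecidableEq X]

theorem det_ne_zero_of_injective {A : Matrix X X ℂ}
    (h : ∀ ψ, toEuclideanCLM (𝕜 := ℂ) A ψ = 0 → ψ = 0) : A.det ≠ 0 := by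
  intro hdet
  obtain ⟨v, hv, hA⟩ := exists_mulVec_eq_zero_iff.mpr hdet
  refine hv ?_
  have := h (WithLp.toLp 2 v) (by ext i; rw [ofLp_toEuclideanCLM, hA]; rfl)
  simpa using congrArg WithLp.ofLp this

theorem det_ne_zero_of_mul_norm_sq_le {A : Matrix X X ℂ} {c : ℝ} (hc : 0 < c)
    (h : ∀ ψ, c * ‖ψ‖ ^ 2 ≤ ‖toEuclideanCLM (𝕜 := ℂ) A ψ‖ ^ 2) : A.det ≠ 0 := by
  refine det_ne_zero_of_injective fun ψ hψ => ?_
  have hle := h ψ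
  rw [hψ, norm_zero, zero_pow two_ne_zero] at hle
  have hsq : ‖ψ‖ ^ 2 ≤ 0 := le_of_mul_le_mul_left (by simpa using hle) hc
  exact norm_eq_zero.mp (pow_eq_zero_iff two_ne_zero |>.mp (le_antisymm hsq (sq_nonneg _)))

theorem posSemidef_sq_sub_smul_one {A : Matrix X X ℂ} (hA : A.IsHermitian) {c : ℝ}
    (h : ∀ ψ, c * ‖ψ‖ ^ 2 ≤ ‖toEuclideanCLM (𝕜 := ℂ) A ψ‖ ^ 2) :
    (A ^ 2 - (c : ℂ) • (1 : Matrix X X ℂ)).PosSemidef := by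
  have hc : ((c : ℂ) • (1 : Matrix X X ℂ)).IsHermitian := by
    simp [Matrix.IsHermitian, conjTranspose_smul]
  have hstar : toEuclideanCLM (𝕜 := ℂ) (A ^ 2 - (c : ℂ) • (1 : Matrix X X ℂ))
      = star (toEuclideanCLM (𝕜 := ℂ) A) * toEuclideanCLM (𝕜 := ℂ) A
        - c • (1 : EuclideanSpace ℂ X →L[ℂ] EuclideanSpace ℂ X) := by
    rw [← map_star, star_eq_conjTranspose, hA.eq, map_sub, map_smul, map_one, pow_two, map_mul]
    rfl
  refine isPositive_toEuclideanLin_iff.mp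
    ⟨isSymmetric_toEuclideanLin_iff.mpr ((hA.pow 2).sub hc), fun ψ => ?_⟩
  rw [inner_re_symm]
  change 0 ≤ expectation ψ (toEuclideanCLM (𝕜 := ℂ) (A ^ 2 - (c : ℂ) • (1 : Matrix X X ℂ)))
  rw [hstar, map_sub, map_smul, expectation_star_mul_self, expectation_one]
  exact sub_nonneg.mpr (h ψ)

theorem norm_inv_le_of_mul_norm_le {h : Matrix X X ℂ} (hunit : IsUnit h.det) {γ : ℝ} (hγ0 : 0 < γ)
    (hγ : ∀ ψ, γ * ‖ψ‖ ≤ ‖toEuclideanCLM (𝕜 := ℂ) h ψ‖) : ‖h⁻¹‖ ≤ γ⁻¹ := by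
  refine ContinuousLinearMap.opNorm_le_bound
    (toEuclideanCLM (𝕜 := ℂ) h⁻¹) (inv_nonneg.mpr hγ0.le) fun φ => ?_
  have hle := hγ (toEuclideanCLM (𝕜 := ℂ) h⁻¹ φ)
  rw [← mul_apply_eq_comp, ← map_mul, mul_nonsing_inv _ hunit, map_one] at hle
  rw [inv_mul_eq_div, le_div_iff₀' hγ0]
  exact hle

theorem LocalizerFrame.mul_norm_le_norm_Φ_apply {E : Type*} [NormedAddCommGroup E]
    [InnerProductSpace ℂ E] [CompleteSpace E] {d : ℕ} (𝔽 : LocalizerFrame X E d)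
    {h : Matrix X X ℂ} {γ : ℝ} (hγ0 : 0 < γ)
    (hγ : ∀ ψ, γ * ‖ψ‖ ≤ ‖toEuclideanCLM (𝕜 := ℂ) h ψ‖) (ψ : E) :
    γ * ‖ψ‖ ≤ ‖𝔽.Φ h ψ‖ := by
  have hunit : IsUnit h.det := isUnit_iff_ne_zero.mpr <| det_ne_zero_of_injective fun φ hφ => by
    have hle := hγ φ
    rw [hφ, norm_zero] at hle
    exact norm_le_zero_iff.mp (le_of_mul_le_mul_left (by simpa using hle) hγ0)
  have hinv : 𝔽.Φ h⁻¹ (𝔽.Φ h ψ) = ψ := by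
    rw [← mul_apply_eq_comp, ← map_mul, nonsing_inv_mul _ hunit, map_one]
    rfl
  have hle := (𝔽.Φ h⁻¹).le_of_opNorm_le
    ((𝔽.norm_Φ_le _).trans (norm_inv_le_of_mul_norm_le hunit hγ0 hγ)) (𝔽.Φ h ψ)
  rwa [hinv, inv_mul_eq_div, le_div_iff₀' hγ0] at hle

end LowerBound

section PerLocalizer

/-- The standing assumptions on the Hamiltonian: a selfadjoint, invertible operator on a nonzero
fibre space that has range `R` and periods `p`. -/
structure IsGappedPeriodic {d L : ℕ} (H : Hilb d L →L[ℂ] Hilb d L) (R : ℝ) (p : Fin d → ℕ) :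
    Prop where
  nontrivial : 0 < L
  isSelfAdjoint : IsSelfAdjoint H
  zero_notMem_spectrum : (0 : ℂ) ∉ spectrum ℂ H
  hasFiniteRange : HasFiniteRange H R
  isPeriodic : IsPeriodic H p

/-- Conditions on `(η, ρ)` under which a direct estimate of the square makes the localizer
invertible. Unlike the bounds of `Admissible`, those on `η` persist when `η` grows up to a value of
order `ρ`. -/
structure WeaklyAdmissible {d L : ℕ} (H : Hilb d L →L[ℂ] Hilb d L) (p : Fin d → ℕ) (η : ℝ)
    (ρ : ℕ) : Prop where
  rho_pos : 0 < ρ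
  period_dvd : ∀ j, p j ∣ 2 * ρ
  eta_pos : 0 < η
  mul_sub_le : 16 * d * (η * (‖H‖ - η)) ≤ gap H ^ 2
  size_le : 40 * d * maxCommutator H * η ≤ gap H ^ 2 * ρ

/-- The mass function `∑_j (1 - cos((π/ρ) X_j))` of the periodic localizer. -/
noncomputable def mass (d L ρ : ℕ) (u : Torus d ρ × Fin L) : ℝ :=
  ∑ j, (1 - Real.cos (angle L j u))

/-- The Hamiltonian term `η⁻¹ H_ρ^per` of the periodic localizer. -/
noncomputable def scaledPerHam {d L : ℕ} (H : Hilb d L →L[ℂ] Hilb d L) (η : ℝ) (ρ : ℕ) :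
    Matrix (Torus d ρ × Fin L) (Torus d ρ × Fin L) ℂ :=
  ((1 / η : ℝ) : ℂ) • perHam H ρ

variable {d L k ρ : ℕ} {H : Hilb d L →L[ℂ] Hilb d L} {R : ℝ} {p : Fin d → ℕ}
  {γ : Fin (d - 1) → Matrix (Fin k) (Fin k) ℂ} {η : ℝ}

theorem mass_eq_sum : mass d L ρ = ∑ j, fun u => 1 - Real.cos (angle L j u) := by
  funext u
  rw [mass, Finset.sum_apply]

theorem perLocalizer_eq_locMat_mass (H : Hilb d L →L[ℂ] Hilb d L)
    (γ : Fin (d - 1) → Matrix (Fin k) (Fin k) ℂ) (η : ℝ) (ρ : ℕ) :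
    perLocalizer H γ η ρ = locMat (gammaHat γ) (mass d L ρ) (fun j u => Real.sin (angle L j u))
      (scaledPerHam H η ρ) := by
  rw [perLocalizer_eq_locMat, mass_eq_sum]
  rfl

namespace IsGappedPeriodic

theorem gap_pos (hS : IsGappedPeriodic H R p) : 0 < gap H :=
  PeriodicLocalizer.gap_pos hS.nontrivial hS.zero_notMem_spectrum

theorem gap_le_norm (hS : IsGappedPeriodic H R p) : gap H ≤ ‖H‖ :=
  PeriodicLocalizer.gap_le_norm hS.nontrivial hS.zero_notMem_spectrum

theorem scaledPerHam_isHermitian (hS : IsGappedPeriodic H R p) (hdvd : ∀ j, p j ∣ 2 * ρ) :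
    (scaledPerHam H η ρ).IsHermitian := by
  rw [Matrix.IsHermitian, scaledPerHam, conjTranspose_smul,
    (perHam_isHermitian hS.isSelfAdjoint hS.isPeriodic hdvd).eq]
  simp

theorem norm_scaledPerHam_le (hS : IsGappedPeriodic H R p) (hρ : 0 < ρ)
    (hdvd : ∀ j, p j ∣ 2 * ρ) (hη : 0 < η) : ‖scaledPerHam H η ρ‖ ≤ ‖H‖ / η := by
  rw [scaledPerHam, norm_smul, Complex.norm_real, Real.norm_of_nonneg (by positivity),
    one_div_mul_eq_div]
  gcongr
  exact HasFiniteRange.norm_perHam_le hρ hS.hasFiniteRange hS.isPeriodic hdvd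

theorem norm_lie_phase_scaledPerHam_le (hS : IsGappedPeriodic H R p) (hρ : 0 < ρ)
    (hdvd : ∀ j, p j ∣ 2 * ρ) (hη : 0 < η) (j : Fin d) :
    ‖⁅phase (angle (ρ := ρ) L j), scaledPerHam H η ρ⁆‖
      ≤ Real.pi * (maxCommutator H / (η * ρ)) := by
  rw [Ring.lie_def, scaledPerHam, mul_smul_comm, smul_mul_assoc, ← smul_sub, ← Ring.lie_def,
    norm_smul, Complex.norm_real, Real.norm_of_nonneg (by positivity)]
  calc 1 / η * _ ≤ 1 / η * (Real.pi / ρ * maxCommutator H) := by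
        gcongr
        exact HasFiniteRange.norm_lie_phase_perHam_le hρ hS.hasFiniteRange hS.isPeriodic hdvd j
    _ = _ := by field_simp

theorem mul_norm_le_norm_Φ_scaledPerHam_apply (hS : IsGappedPeriodic H R p) (hρ : 0 < ρ)
    (hdvd : ∀ j, p j ∣ 2 * ρ) (hη : 0 < η) {E : Type*} [NormedAddCommGroup E]
    [InnerProductSpace ℂ E] [CompleteSpace E] (𝔽 : LocalizerFrame (Torus d ρ × Fin L) E d) (ψ : E) :
    gap H / η * ‖ψ‖ ≤ ‖𝔽.Φ (scaledPerHam H η ρ) ψ‖ := by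
  refine 𝔽.mul_norm_le_norm_Φ_apply (div_pos hS.gap_pos hη) (fun φ => ?_) ψ
  have hle := HasFiniteRange.mul_norm_le_norm_perHam_apply hρ hS.hasFiniteRange hS.isPeriodic hdvd
    (gap_mul_norm_le hS.zero_notMem_spectrum) φ
  rw [scaledPerHam, map_smul, _root_.smul_apply, norm_smul, Complex.norm_real,
    Real.norm_of_nonneg (by positivity), one_div_mul_eq_div, div_mul_eq_mul_div]
  gcongr

end IsGappedPeriodic

namespace WeaklyAdmissible

theorem norm_perLocalizer_apply_sq_ge (hS : IsGappedPeriodic H R p)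
    (hΓ : IsOddCliffordRep (gammaHat γ)) (h : WeaklyAdmissible H p η ρ)
    (ψ : EuclideanSpace ℂ (LocIndex d L k ρ)) :
    gap H ^ 2 / (2 * η ^ 2) * ‖ψ‖ ^ 2
      ≤ ‖toEuclideanCLM (𝕜 := ℂ) (perLocalizer H γ η ρ) ψ‖ ^ 2 := by
  have hη := h.eta_pos
  have hρ : (0 : ℝ) < ρ := by exact_mod_cast h.rho_pos
  have hloc := (matrixFrame (Torus d ρ × Fin L) hΓ).norm_loc_apply_sq_ge
    (hS.scaledPerHam_isHermitian h.period_dvd) (fun j => angle L j)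
    (hS.norm_scaledPerHam_le h.rho_pos h.period_dvd hη) (div_pos hS.gap_pos hη).le
    (hS.mul_norm_le_norm_Φ_scaledPerHam_apply h.rho_pos h.period_dvd hη _)
    (hS.norm_lie_phase_scaledPerHam_le h.rho_pos h.period_dvd hη) ψ
  rw [perLocalizer_eq_locMat_mass, toEuclideanCLM_locMat hΓ, mass_eq_sum]
  refine le_trans ?_ hloc
  gcongr
  have hnorm : 4 * d * max (‖H‖ / η - 1) 0 ≤ gap H ^ 2 / η ^ 2 / 4 := by
    rw [mul_max_of_nonneg _ _ (by positivity), mul_zero, max_le_iff, div_div,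
      le_div_iff₀ (by positivity)]
    refine ⟨?_, by positivity⟩
    calc 4 * d * (‖H‖ / η - 1) * (η ^ 2 * 4) = 16 * d * (η * (‖H‖ - η)) := by
          field_simp
          ring
      _ ≤ _ := h.mul_sub_le
  have hcomm : 3 * d * (Real.pi * (maxCommutator H / (η * ρ))) ≤ gap H ^ 2 / η ^ 2 / 4 := by
    have hM := maxCommutator_nonneg H
    rw [div_div, le_div_iff₀ (by positivity)]
    calc 3 * d * (Real.pi * (maxCommutator H / (η * ρ))) * (η ^ 2 * 4)
        = 12 * Real.pi * (d * maxCommutator H * η / ρ) := by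
          field_simp
          ring
      _ ≤ 40 * (d * maxCommutator H * η / ρ) := by
          gcongr
          linarith [Real.pi_lt_d2]
      _ = 40 * d * maxCommutator H * η / ρ := by ring
      _ ≤ _ := (div_le_iff₀ hρ).mpr h.size_le
  have hhalf : gap H ^ 2 / (2 * η ^ 2) = gap H ^ 2 / η ^ 2 / 2 := by field_simp
  rw [hhalf, div_pow]
  linarith

theorem det_perLocalizer_ne_zero (hS : IsGappedPeriodic H R p)
    (hΓ : IsOddCliffordRep (gammaHat γ)) (h : WeaklyAdmissible H p η ρ) :
    (perLocalizer H γ η ρ).det ≠ 0 := by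
  have hg := hS.gap_pos
  have hη := h.eta_pos
  exact det_ne_zero_of_mul_norm_sq_le (by positivity) (h.norm_perLocalizer_apply_sq_ge hS hΓ)

end WeaklyAdmissible

theorem signature_perLocalizer_eq_of_segment (hS : IsGappedPeriodic H R p)
    (hΓ : IsOddCliffordRep (gammaHat γ)) (hdvd : ∀ j, p j ∣ 2 * ρ) {η' : ℝ}
    (hη : ∀ t ∈ segment ℝ η η', WeaklyAdmissible H p t ρ) :
    signature (perLocalizer H γ η ρ)
        (perLocalizer_isHermitian hS.isSelfAdjoint hS.isPeriodic hdvd γ η)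
      = signature (perLocalizer H γ η' ρ)
        (perLocalizer_isHermitian hS.isSelfAdjoint hS.isPeriodic hdvd γ η') := by
  have hmem : ∀ t : unitInterval, AffineMap.lineMap η η' (t : ℝ) ∈ segment ℝ η η' := fun t => by
    rw [segment_eq_image_lineMap]
    exact ⟨t, t.2, rfl⟩
  have hcont : Continuous fun t : unitInterval =>
      perLocalizer H γ (AffineMap.lineMap η η' (t : ℝ)) ρ := by
    have hinv : Continuous fun t : unitInterval =>
        (((1 / (AffineMap.lineMap η η' (t : ℝ) : ℝ) : ℝ)) : ℂ) := by
      refine Complex.continuous_ofReal.comp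
        (continuous_const.div ?_ fun t => (hη _ (hmem t)).eta_pos.ne')
      exact AffineMap.lineMap_continuous.comp continuous_subtype_val
    exact continuous_const.add (hinv.smul continuous_const)
  have hpath := signature_eq_of_path _ hcont
    (fun t => perLocalizer_isHermitian hS.isSelfAdjoint hS.isPeriodic hdvd γ _)
    (fun t => (hη _ (hmem t)).det_perLocalizer_ne_zero hS hΓ)
  simpa using hpath

end PerLocalizer

section Extension

variable {X X' : Type*} [DecidableEq X']

/-- The matrix of the linear map `ℂ^X → ℂ^X'` that sends the basis vector at `x` to the one at
`ι x`. -/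
def inclusion (ι : X → X') : Matrix X' X ℂ := of fun u x => if u = ι x then 1 else 0

variable [Fintype X] {ι : X → X'}

/-- The extension of a matrix by zero along `ι`. -/
def extendZero (ι : X → X') (h : Matrix X X ℂ) : Matrix X' X' ℂ :=
  inclusion ι * h * (inclusion ι)ᴴ

theorem extendZero_isHermitian (ι : X → X') {h : Matrix X X ℂ} (hh : h.IsHermitian) :
    (extendZero ι h).IsHermitian := by
  simp [extendZero, Matrix.IsHermitian, conjTranspose_mul, hh.eq, Matrix.mul_assoc]

theorem extendZero_apply (hι : Function.Injective ι) (h : Matrix X X ℂ) (x y : X) :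
    extendZero ι h (ι x) (ι y) = h x y := by
  classical
  simp [extendZero, inclusion, mul_apply, hι.eq_iff]

theorem extendZero_apply_of_left_notMem_range (h : Matrix X X ℂ) {u : X'}
    (hu : u ∉ Set.range ι) (v : X') : extendZero ι h u v = 0 := by
  have hne : ∀ x, u ≠ ι x := fun x hx => hu ⟨x, hx.symm⟩
  simp [extendZero, inclusion, mul_apply, hne]

theorem extendZero_apply_of_right_notMem_range (h : Matrix X X ℂ) (u : X') {v : X'}
    (hv : v ∉ Set.range ι) : extendZero ι h u v = 0 := by
  have hne : ∀ x, v ≠ ι x := fun x hx => hv ⟨x, hx.symm⟩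
  simp [extendZero, inclusion, mul_apply, hne]

variable [DecidableEq X] [Fintype X']

theorem norm_inclusion_le (hι : Function.Injective ι) : ‖inclusion ι‖ ≤ 1 := by
  have hsq := l2_opNorm_conjTranspose_mul_self (inclusion ι)
  have hisometry : (inclusion ι)ᴴ * inclusion ι = 1 := by
    ext x y
    simp [mul_apply, inclusion, one_apply, hι.eq_iff, eq_comm]
  rw [hisometry] at hsq
  have hone : ‖(1 : Matrix X X ℂ)‖ ≤ 1 := IsStarProjection.norm_le _ (.one _)
  nlinarith [norm_nonneg (inclusion ι)]

theorem norm_extendZero_le (hι : Function.Injective ι) (h : Matrix X X ℂ) :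
    ‖extendZero ι h‖ ≤ ‖h‖ := by
  have hincl := norm_inclusion_le hι
  calc ‖extendZero ι h‖ ≤ ‖inclusion ι‖ * ‖h‖ * ‖(inclusion ι)ᴴ‖ :=
        (l2_opNorm_mul _ _).trans (by gcongr; exact l2_opNorm_mul _ _)
    _ ≤ 1 * ‖h‖ * 1 := by
        rw [l2_opNorm_conjTranspose]
        gcongr
    _ = ‖h‖ := by ring

theorem realDiagonal_mul_inclusion (ι : X → X') (f : X' → ℝ) :
    realDiagonal f * inclusion ι = inclusion ι * realDiagonal (f ∘ ι) := by
  ext u x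
  simp only [realDiagonal_apply, diagonal_mul, mul_diagonal, inclusion, of_apply,
    Function.comp_apply]
  split_ifs with h
  · rw [h, mul_comm]
  · rw [mul_zero, zero_mul]

theorem inclusion_conjTranspose_mul_realDiagonal (ι : X → X') (f : X' → ℝ) :
    (inclusion ι)ᴴ * realDiagonal f = realDiagonal (f ∘ ι) * (inclusion ι)ᴴ := by
  have hstar := congrArg conjTranspose (realDiagonal_mul_inclusion ι f)
  rwa [conjTranspose_mul, conjTranspose_mul, ← star_eq_conjTranspose (realDiagonal f),
    ← star_eq_conjTranspose (realDiagonal (f ∘ ι)), star_realDiagonal, star_realDiagonal] at hstar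

theorem lie_realDiagonal_extendZero (ι : X → X') (f : X' → ℝ) (h : Matrix X X ℂ) :
    ⁅realDiagonal f, extendZero ι h⁆ = extendZero ι ⁅realDiagonal (f ∘ ι), h⁆ := by
  rw [Ring.lie_def, Ring.lie_def, extendZero, extendZero, Matrix.mul_assoc (inclusion ι * h),
    inclusion_conjTranspose_mul_realDiagonal, ← Matrix.mul_assoc, ← Matrix.mul_assoc,
    realDiagonal_mul_inclusion, Matrix.mul_sub, Matrix.sub_mul]
  simp only [Matrix.mul_assoc]

theorem norm_lie_realDiagonal_extend_le (hι : Function.Injective ι) (f : X → ℝ) (f' : X' → ℝ)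
    (h : Matrix X X ℂ) :
    ‖⁅realDiagonal (Function.extend ι f f'), extendZero ι h⁆‖ ≤ ‖⁅realDiagonal f, h⁆‖ := by
  rw [lie_realDiagonal_extendZero, Function.extend_comp hι]
  exact norm_extendZero_le hι _

variable {d k : ℕ}

open Classical in
/-- The splitting of the index set of a localizer over `X'` into the part over the range of `ι` and
the part over its complement. -/
noncomputable def splitIndex (k : ℕ) (hι : Function.Injective ι) :
    ((X × Fin k) ⊕ (X × Fin k)) ⊕
      (({u // u ∉ Set.range ι} × Fin k) ⊕ ({u // u ∉ Set.range ι} × Fin k))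
    ≃ (X' × Fin k) ⊕ (X' × Fin k) :=
  let e : X ⊕ {u // u ∉ Set.range ι} ≃ X' :=
    (Equiv.sumCongr (Equiv.ofInjective ι hι) (Equiv.refl _)).trans (Equiv.sumCompl _)
  let f := (Equiv.sumProdDistrib _ _ _).symm.trans (Equiv.prodCongr e (Equiv.refl (Fin k)))
  (Equiv.sumSumSumComm _ _ _ _).trans (Equiv.sumCongr f f)

theorem submatrix_locMat_extend (Γ : Fin d → Matrix (Fin k) (Fin k) ℂ)
    (hι : Function.Injective ι) (c : X → ℝ) (m : X' → ℝ) (s : Fin d → X → ℝ)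
    (h : Matrix X X ℂ) :
    (locMat Γ (Function.extend ι c m) (fun j => Function.extend ι (s j) 0)
        (extendZero ι h)).submatrix (splitIndex k hι) (splitIndex k hι)
      = fromBlocks (locMat Γ c s h) 0 0
        (fromBlocks (diagonal fun y => (m y.1 : ℂ)) 0 0 (-diagonal fun y => (m y.1 : ℂ))) := by
  have hin₁ : ∀ x i, splitIndex k hι (Sum.inl (Sum.inl (x, i))) = Sum.inl (ι x, i) :=
    fun _ _ => rfl
  have hin₂ : ∀ x i, splitIndex k hι (Sum.inl (Sum.inr (x, i))) = Sum.inr (ι x, i) :=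
    fun _ _ => rfl
  have hout₁ : ∀ y i, splitIndex k hι (Sum.inr (Sum.inl (y, i))) = Sum.inl (y.1, i) :=
    fun _ _ => rfl
  have hout₂ : ∀ y i, splitIndex k hι (Sum.inr (Sum.inr (y, i))) = Sum.inr (y.1, i) :=
    fun _ _ => rfl
  have hne : ∀ (x : X) (y : {u // u ∉ Set.range ι}), ι x ≠ y.1 := fun x y hxy => y.2 ⟨x, hxy⟩
  have hne' : ∀ (x : X) (y : {u // u ∉ Set.range ι}), y.1 ≠ ι x := fun x y => (hne x y).symm
  ext a b
  rcases a with (⟨x, i⟩ | ⟨x, i⟩) | (⟨x, i⟩ | ⟨x, i⟩) <;>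
  rcases b with (⟨y, l⟩ | ⟨y, l⟩) | (⟨y, l⟩ | ⟨y, l⟩) <;>
  simp [hin₁, hin₂, hout₁, hout₂, locMat, realDiagonal_apply, kroneckerMap_apply, diagonal_apply,
    hι.eq_iff, hι.extend_apply, extendZero_apply hι, hne, hne', Matrix.sum_apply, one_apply,
    extendZero_apply_of_left_notMem_range, extendZero_apply_of_right_notMem_range]
  all_goals
    by_cases hxy : x = y
    · subst hxy
      by_cases hil : i = l <;> simp [hil]
    · have hval : x.1 ≠ y.1 := fun h => hxy (Subtype.ext h)
      simp [hxy, hval]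

theorem signature_locMat_extend (Γ : Fin d → Matrix (Fin k) (Fin k) ℂ)
    (hι : Function.Injective ι) (c : X → ℝ) (m : X' → ℝ) (s : Fin d → X → ℝ)
    {h : Matrix X X ℂ} (hh : h.IsHermitian) :
    signature (locMat Γ (Function.extend ι c m) (fun j => Function.extend ι (s j) 0)
        (extendZero ι h)) (locMat_isHermitian Γ _ _ (extendZero_isHermitian ι hh))
      = signature (locMat Γ c s h) (locMat_isHermitian Γ c s hh) := by
  let D : Matrix ({u // u ∉ Set.range ι} × Fin k) ({u // u ∉ Set.range ι} × Fin k) ℂ :=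
    diagonal fun y => (m y.1 : ℂ)
  have hD : D.IsHermitian := by
    simp [D, Matrix.IsHermitian, diagonal_conjTranspose, Pi.star_def]
  have hDD : (fromBlocks D 0 0 (-D)).IsHermitian :=
    isHermitian_fromBlocks_iff.mpr ⟨hD, by simp, by simp, hD.neg⟩
  have hloc := locMat_isHermitian Γ c s hh
  have hext := locMat_isHermitian Γ (Function.extend ι c m)
    (fun j => Function.extend ι (s j) 0) (extendZero_isHermitian ι hh)
  rw [← signature_submatrix hext (splitIndex k hι),
    signature_congr (submatrix_locMat_extend Γ hι c m s h) (hext.submatrix _)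
      (isHermitian_fromBlocks_iff.mpr ⟨hloc, by simp, by simp, hDD⟩),
    signature_fromBlocks hloc hDD, signature_fromBlocks_diagonal_neg _ hDD, add_zero]

end Extension

section Interpolation

theorem lie_lineMap {K A : Type*} [CommRing K] [Ring A] [Algebra K A] (x₀ x₁ y₀ y₁ : A) (t : K) :
    ⁅AffineMap.lineMap x₀ x₁ t, AffineMap.lineMap y₀ y₁ t⁆
      = AffineMap.lineMap ⁅x₀, y₀⁆ ⁅x₁, y₁⁆ t - (t * (1 - t)) • ⁅x₁ - x₀, y₁ - y₀⁆ := by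
  simp only [AffineMap.lineMap_apply_module, Ring.lie_def, add_mul, mul_add, sub_mul, mul_sub,
    smul_mul_assoc, mul_smul_comm]
  module

theorem lie_mul_mul_of_commute {A : Type*} [Ring A] {x p : A} (hxp : Commute x p) (y : A) :
    ⁅x, p * y * p⁆ = p * ⁅x, y⁆ * p := by
  rw [Ring.lie_def, Ring.lie_def, mul_assoc (p * y), ← hxp.eq, ← mul_assoc x, ← mul_assoc x, hxp.eq,
    mul_sub, sub_mul]
  simp only [mul_assoc, hxp.eq]

theorem norm_lie_le_two_mul {A : Type*} [NonUnitalNormedRing A] (x y : A) :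
    ‖⁅x, y⁆‖ ≤ 2 * (‖x‖ * ‖y‖) := by
  calc ‖⁅x, y⁆‖ ≤ ‖x * y‖ + ‖y * x‖ := norm_sub_le _ _
    _ ≤ ‖x‖ * ‖y‖ + ‖y‖ * ‖x‖ := add_le_add (norm_mul_le _ _) (norm_mul_le _ _)
    _ = 2 * (‖x‖ * ‖y‖) := by ring

theorem norm_lineMap_le {V : Type*} [NormedAddCommGroup V] [NormedSpace ℝ V] {x₀ x₁ : V}
    {a t : ℝ} (h₀ : ‖x₀‖ ≤ a) (h₁ : ‖x₁‖ ≤ a) (ht : t ∈ Set.Icc (0 : ℝ) 1) :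
    ‖AffineMap.lineMap x₀ x₁ t‖ ≤ a := by
  simpa using (convex_closedBall (0 : V) a).lineMap_mem (by simpa using h₀) (by simpa using h₁) ht

variable {X : Type*} [Fintype X] [DecidableEq X] {d k : ℕ}

theorem norm_realDiagonal (f : X → ℝ) : ‖realDiagonal f‖ = ‖f‖ := by
  rw [realDiagonal_apply, l2_opNorm_diagonal]
  simp [Pi.norm_def]

theorem isHermitian_lineMap {A B : Matrix X X ℂ} (hA : A.IsHermitian) (hB : B.IsHermitian)
    (t : ℝ) : (AffineMap.lineMap A B t).IsHermitian := by
  simp [AffineMap.lineMap_apply_module, Matrix.IsHermitian, conjTranspose_add, conjTranspose_smul,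
    hA.eq, hB.eq]

theorem locMat_lineMap (Γ : Fin d → Matrix (Fin k) (Fin k) ℂ) (c₀ c₁ : X → ℝ)
    (s₀ s₁ : Fin d → X → ℝ) (h₀ h₁ : Matrix X X ℂ) (t : ℝ) :
    locMat Γ (AffineMap.lineMap c₀ c₁ t) (AffineMap.lineMap s₀ s₁ t) (AffineMap.lineMap h₀ h₁ t)
      = AffineMap.lineMap (locMat Γ c₀ s₀ h₀) (locMat Γ c₁ s₁ h₁) t := by
  simp only [AffineMap.lineMap_apply_module, locMat, fromBlocks_smul, fromBlocks_add, map_add,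
    map_smul, Pi.add_apply, Pi.smul_apply, sub_kronecker, add_kronecker, smul_kronecker,
    Finset.sum_add_distrib, Finset.smul_sum]
  congr 1 <;> module

theorem commutatorSplits_lineMap {χ f₀ f₁ : X → ℝ} {h₀ h₁ : Matrix X X ℂ} {a b e t : ℝ}
    (ht : t ∈ Set.Icc (0 : ℝ) 1) (hf : ‖f₁ - f₀‖ ≤ a)
    (h0 : ‖⁅realDiagonal f₀, h₀⁆‖ ≤ e) (h1 : ‖⁅realDiagonal f₁, h₁⁆‖ ≤ e)
    (hr : h₁ - h₀ = realDiagonal χ * (h₁ - h₀) * realDiagonal χ) (hb : ‖h₁ - h₀‖ ≤ 2 * b) :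
    LocalizerFrame.CommutatorSplits χ (AffineMap.lineMap f₀ f₁ t) (AffineMap.lineMap h₀ h₁ t) e
      (a * b) := by
  have ht' : 0 ≤ t * (1 - t) := mul_nonneg ht.1 (sub_nonneg.mpr ht.2)
  have ha : 0 ≤ a := (norm_nonneg _).trans hf
  have hmap : realDiagonal (AffineMap.lineMap f₀ f₁ t)
      = AffineMap.lineMap (realDiagonal f₀) (realDiagonal f₁) t := by
    simp only [AffineMap.lineMap_apply_module, map_add, map_smul]
  have hlocal : ⁅realDiagonal (f₁ - f₀), h₁ - h₀⁆
      = realDiagonal χ * ⁅realDiagonal (f₁ - f₀), h₁ - h₀⁆ * realDiagonal χ := by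
    conv_lhs => rw [hr]
    exact lie_mul_mul_of_commute ((Commute.all _ _).map realDiagonal) _
  refine ⟨AffineMap.lineMap ⁅realDiagonal f₀, h₀⁆ ⁅realDiagonal f₁, h₁⁆ t,
    -(t * (1 - t)) • ⁅realDiagonal (f₁ - f₀), h₁ - h₀⁆, ?_, norm_lineMap_le h0 h1 ht, ?_⟩
  · rw [mul_smul_comm, smul_mul_assoc, ← hlocal, hmap, map_sub, neg_smul, ← sub_eq_add_neg]
    exact lie_lineMap _ _ _ _ t
  · have hlie : ‖⁅realDiagonal (f₁ - f₀), h₁ - h₀⁆‖ ≤ 2 * (a * (2 * b)) := by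
      rw [← norm_realDiagonal] at hf
      exact (norm_lie_le_two_mul _ _).trans (by gcongr)
    rw [neg_smul, norm_neg, norm_smul, Real.norm_of_nonneg ht']
    have hab : 0 ≤ a * b := by linarith [(norm_nonneg _).trans hlie]
    calc t * (1 - t) * ‖⁅realDiagonal (f₁ - f₀), h₁ - h₀⁆‖
        ≤ t * (1 - t) * (2 * (a * (2 * b))) := by gcongr
      _ = 4 * (t * (1 - t)) * (a * b) := by ring
      _ ≤ 1 * (a * b) := by
        gcongr
        linarith [sq_nonneg (2 * t - 1)]
      _ = a * b := one_mul _

/-- Bounds under which a Hamiltonian `h` with position functions `c` and `s`, and a cutoff `χ`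
supported where `c` is large, can be interpolated with another such model. -/
structure IsLocalizerModel (χ c : X → ℝ) (s : Fin d → X → ℝ) (h : Matrix X X ℂ) (b e ε : ℝ) :
    Prop where
  isHermitian : h.IsHermitian
  le_four_mul : χ ≤ 4 * c
  mem_Icc : ∀ x, c x ∈ Set.Icc (0 : ℝ) (2 * d)
  abs_le_one : ∀ j x, |s j x| ≤ 1
  norm_le : ‖h‖ ≤ b
  norm_lie_mass_le : ‖⁅realDiagonal c, h⁆‖ ≤ e
  norm_lie_position_le : ∀ j, ‖⁅realDiagonal (s j), h⁆‖ ≤ ε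

variable {χ c₀ c₁ : X → ℝ} {s₀ s₁ : Fin d → X → ℝ} {h₀ h₁ : Matrix X X ℂ} {b g e ε : ℝ}

theorem IsLocalizerModel.norm_sub_le_two_mul (m₀ : IsLocalizerModel χ c₀ s₀ h₀ b e ε)
    (m₁ : IsLocalizerModel χ c₁ s₁ h₁ b e ε) : ‖c₁ - c₀‖ ≤ 2 * d := by
  refine (pi_norm_le_iff_of_nonneg (by positivity)).mpr fun x => ?_
  exact abs_sub_le_of_nonneg_of_le (m₁.mem_Icc x).1 (m₁.mem_Icc x).2 (m₀.mem_Icc x).1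
    (m₀.mem_Icc x).2

theorem IsLocalizerModel.norm_sub_le_two (m₀ : IsLocalizerModel χ c₀ s₀ h₀ b e ε)
    (m₁ : IsLocalizerModel χ c₁ s₁ h₁ b e ε) (j : Fin d) : ‖s₁ j - s₀ j‖ ≤ 2 := by
  refine (pi_norm_le_iff_of_nonneg zero_le_two).mpr fun x => ?_
  rw [Pi.sub_apply, Real.norm_eq_abs]
  linarith [abs_sub (s₁ j x) (s₀ j x), m₀.abs_le_one j x, m₁.abs_le_one j x]

theorem IsLocalizerModel.det_locMat_lineMap_ne_zero {Γ : Fin d → Matrix (Fin k) (Fin k) ℂ}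
    (hΓ : IsOddCliffordRep Γ) (hd : 0 < d) (hχ : IsIdempotentElem χ)
    (m₀ : IsLocalizerModel χ c₀ s₀ h₀ b e ε) (m₁ : IsLocalizerModel χ c₁ s₁ h₁ b e ε)
    (hr : h₁ - h₀ = realDiagonal χ * (h₁ - h₀) * realDiagonal χ) (hg : 0 ≤ g)
    (hgap : ∀ ψ, g * ‖ψ‖ ≤ ‖(matrixFrame X hΓ).Φ h₁ ψ‖) (hbd : 64 * d * b ≤ 1)
    (hnum : 8 * b * (b ^ 2 + e) * (1 + 32 * b ^ 2 + 32 * d ^ 2 * b) + d ^ 2 * ε < g ^ 2 / 4)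
    {t : ℝ} (ht : t ∈ Set.Icc (0 : ℝ) 1)
    (hcs : (1 - χ) * (AffineMap.lineMap c₀ c₁ t) ^ 2
      ≤ (d : ℝ) • ∑ j, AffineMap.lineMap s₀ s₁ t j ^ 2) :
    (AffineMap.lineMap (locMat Γ c₀ s₀ h₀) (locMat Γ c₁ s₁ h₁) t).det ≠ 0 := by
  have hb : ‖h₁ - h₀‖ ≤ 2 * b := (norm_sub_le _ _).trans (by linarith [m₀.norm_le, m₁.norm_le])
  rw [← locMat_lineMap]
  refine det_ne_zero_of_injective fun ψ hψ => ?_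
  rw [toEuclideanCLM_locMat hΓ] at hψ
  refine (matrixFrame X hΓ).eq_zero_of_loc_eq_zero (r := (1 - t) • (h₁ - h₀))
    (isHermitian_lineMap m₀.isHermitian m₁.isHermitian t) hd hχ ?_ ?_
    (norm_lineMap_le m₀.norm_le m₁.norm_le ht) hg hgap ?_ ?_
    (commutatorSplits_lineMap ht (m₀.norm_sub_le_two_mul m₁) m₀.norm_lie_mass_le
      m₁.norm_lie_mass_le hr hb)
    (fun j => ?_) hbd hnum hψ
  · intro x
    have hx₀ := m₀.le_four_mul x
    have hx₁ := m₁.le_four_mul x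
    simp only [Pi.mul_apply, Pi.ofNat_apply, AffineMap.pi_lineMap_apply] at hx₀ hx₁ ⊢
    have := (convex_Ici (χ x / 4)).lineMap_mem (x := c₀ x) (y := c₁ x)
      (Set.mem_Ici.mpr (by linarith)) (Set.mem_Ici.mpr (by linarith)) ht
    linarith [Set.mem_Ici.mp this]
  · exact hcs
  · rw [mul_smul_comm, smul_mul_assoc, ← hr, AffineMap.lineMap_apply_module]
    module
  · rw [norm_smul, Real.norm_of_nonneg (sub_nonneg.mpr ht.2)]
    exact (mul_le_of_le_one_left (norm_nonneg _) (by linarith [ht.1])).trans hb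
  · rw [AffineMap.pi_lineMap_apply]
    exact commutatorSplits_lineMap ht (m₀.norm_sub_le_two m₁ j) (m₀.norm_lie_position_le j)
      (m₁.norm_lie_position_le j) hr hb

theorem IsLocalizerModel.signature_locMat_eq {Γ : Fin d → Matrix (Fin k) (Fin k) ℂ}
    (hΓ : IsOddCliffordRep Γ) (hd : 0 < d) (hχ : IsIdempotentElem χ)
    (m₀ : IsLocalizerModel χ c₀ s₀ h₀ b e ε) (m₁ : IsLocalizerModel χ c₁ s₁ h₁ b e ε)
    (hr : h₁ - h₀ = realDiagonal χ * (h₁ - h₀) * realDiagonal χ) (hg : 0 ≤ g)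
    (hgap : ∀ ψ, g * ‖ψ‖ ≤ ‖(matrixFrame X hΓ).Φ h₁ ψ‖) (hbd : 64 * d * b ≤ 1)
    (hnum : 8 * b * (b ^ 2 + e) * (1 + 32 * b ^ 2 + 32 * d ^ 2 * b) + d ^ 2 * ε < g ^ 2 / 4)
    (hcs : ∀ t ∈ Set.Icc (0 : ℝ) 1, (1 - χ) * (AffineMap.lineMap c₀ c₁ t) ^ 2
      ≤ (d : ℝ) • ∑ j, AffineMap.lineMap s₀ s₁ t j ^ 2) :
    signature (locMat Γ c₀ s₀ h₀) (locMat_isHermitian Γ c₀ s₀ m₀.isHermitian)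
      = signature (locMat Γ c₁ s₁ h₁) (locMat_isHermitian Γ c₁ s₁ m₁.isHermitian) := by
  simpa using signature_eq_of_path
    (fun t : unitInterval => AffineMap.lineMap (locMat Γ c₀ s₀ h₀) (locMat Γ c₁ s₁ h₁) (t : ℝ))
    (AffineMap.lineMap_continuous.comp continuous_subtype_val)
    (fun t => isHermitian_lineMap (locMat_isHermitian Γ c₀ s₀ m₀.isHermitian)
      (locMat_isHermitian Γ c₁ s₁ m₁.isHermitian) t)
    (fun t => m₀.det_locMat_lineMap_ne_zero hΓ hd hχ m₁ hr hg hgap hbd hnum t.2 (hcs t t.2))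

end Interpolation

/-! ### Comparison of volumes -/

section Trigonometry

theorem cos_le_three_quarters {θ : ℝ} (h : Real.pi / 4 ≤ |θ|) (h' : |θ| ≤ Real.pi) :
    Real.cos θ ≤ 3 / 4 := by
  have hcos := Real.cos_le_cos_of_nonneg_of_le_pi (by positivity) h' h
  rw [Real.cos_abs, Real.cos_pi_div_four] at hcos
  have hsqrt : √2 ≤ 3 / 2 := Real.sqrt_le_iff.mpr ⟨by norm_num, by norm_num⟩
  linarith

theorem one_sub_cos_le_sin {θ : ℝ} (h0 : 0 ≤ θ) (h1 : θ ≤ Real.pi / 2) :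
    1 - Real.cos θ ≤ Real.sin θ := by
  have hc := Real.cos_nonneg_of_neg_pi_div_two_le_of_le (by linarith [Real.pi_pos]) h1
  have hs := Real.sin_nonneg_of_nonneg_of_le_pi h0 (by linarith [Real.pi_pos])
  nlinarith [Real.sin_sq_add_cos_sq θ, Real.cos_le_one θ, Real.sin_le_one θ]

theorem lineMap_one_sub_cos_sq_le_of_nonneg {θ θ' t : ℝ} (h0 : 0 ≤ θ) (h0' : 0 ≤ θ')
    (h1 : θ ≤ Real.pi / 2) (h1' : θ' ≤ Real.pi / 2) (ht : t ∈ Set.Icc (0 : ℝ) 1) :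
    (AffineMap.lineMap (1 - Real.cos θ) (1 - Real.cos θ') t) ^ 2
      ≤ (AffineMap.lineMap (Real.sin θ) (Real.sin θ') t) ^ 2 := by
  have ht0 := ht.1
  have ht1 : 0 ≤ 1 - t := sub_nonneg.mpr ht.2
  have hcos := sub_nonneg.mpr (Real.cos_le_one θ)
  have hcos' := sub_nonneg.mpr (Real.cos_le_one θ')
  simp only [AffineMap.lineMap_apply_module, smul_eq_mul]
  gcongr
  · exact one_sub_cos_le_sin h0 h1
  · exact one_sub_cos_le_sin h0' h1'

theorem lineMap_one_sub_cos_sq_le {θ θ' t : ℝ} (h0 : 0 ≤ θ * θ') (h1 : |θ| ≤ Real.pi / 2)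
    (h1' : |θ'| ≤ Real.pi / 2) (ht : t ∈ Set.Icc (0 : ℝ) 1) :
    (AffineMap.lineMap (1 - Real.cos θ) (1 - Real.cos θ') t) ^ 2
      ≤ (AffineMap.lineMap (Real.sin θ) (Real.sin θ') t) ^ 2 := by
  rw [abs_le] at h1 h1'
  rcases mul_nonneg_iff.mp h0 with ⟨hθ, hθ'⟩ | ⟨hθ, hθ'⟩
  · exact lineMap_one_sub_cos_sq_le_of_nonneg hθ hθ' h1.2 h1'.2 ht
  · have hneg := lineMap_one_sub_cos_sq_le_of_nonneg (neg_nonneg.mpr hθ) (neg_nonneg.mpr hθ')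
      (by linarith) (by linarith) ht
    simp only [Real.cos_neg, Real.sin_neg, AffineMap.lineMap_apply_module, smul_eq_mul] at hneg ⊢
    linarith

end Trigonometry

section Angle

variable {d L ρ : ℕ}

theorem abs_coord_le (u : Torus d ρ) (j : Fin d) : |u.coord j| ≤ ρ :=
  abs_le.mpr ⟨(coord_mem u j).1.le, (coord_mem u j).2⟩

theorem abs_angle (j : Fin d) (u : Torus d ρ × Fin L) :
    |angle L j u| = Real.pi * ((|u.1.coord j| : ℤ) / ρ) := by
  rw [angle, abs_mul, abs_of_nonneg (by positivity), Int.cast_abs]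
  ring

theorem abs_angle_le_pi (j : Fin d) (u : Torus d ρ × Fin L) : |angle L j u| ≤ Real.pi := by
  rw [abs_angle]
  refine mul_le_of_le_one_right Real.pi_pos.le (div_le_one_of_le₀ ?_ (Nat.cast_nonneg ρ))
  exact_mod_cast abs_coord_le u.1 j

theorem pi_div_four_le_abs_angle {r : ℕ} (hr : 0 < r) (hρ : ρ ≤ 2 * r) {j : Fin d}
    {u : Torus d ρ × Fin L} (hj : (r : ℤ) ≤ 2 * |u.1.coord j|) :
    Real.pi / 4 ≤ |angle L j u| := by
  have hcoord := abs_coord_le u.1 j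
  have hpos : (0 : ℝ) < ρ := by exact_mod_cast (by omega : 0 < ρ)
  have hquarter : (ρ : ℝ) ≤ 4 * (|u.1.coord j| : ℤ) := by
    exact_mod_cast (by omega : (ρ : ℤ) ≤ 4 * |u.1.coord j|)
  rw [abs_angle, div_eq_mul_one_div Real.pi]
  refine mul_le_mul_of_nonneg_left ?_ Real.pi_pos.le
  rw [le_div_iff₀ hpos]
  linarith

theorem abs_angle_le_pi_div_two {j : Fin d} {u : Torus d ρ × Fin L}
    (hj : 2 * |u.1.coord j| ≤ ρ) : |angle L j u| ≤ Real.pi / 2 := by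
  have hhalf : (2 : ℝ) * (|u.1.coord j| : ℤ) ≤ ρ := by exact_mod_cast hj
  rw [abs_angle, div_eq_mul_one_div Real.pi]
  refine mul_le_mul_of_nonneg_left ?_ Real.pi_pos.le
  exact div_le_of_le_mul₀ (Nat.cast_nonneg ρ) (by positivity) (by linarith)

theorem mass_nonneg (u : Torus d ρ × Fin L) : 0 ≤ mass d L ρ u :=
  Finset.sum_nonneg fun _ _ => sub_nonneg.mpr (Real.cos_le_one _)

theorem mass_le (u : Torus d ρ × Fin L) : mass d L ρ u ≤ 2 * d := by
  refine (Finset.sum_le_card_nsmul _ _ 2 fun j _ => ?_).trans (by simp [mul_comm])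
  linarith [Real.neg_one_le_cos (angle L j u)]

theorem one_le_four_mul_mass {j : Fin d} {u : Torus d ρ × Fin L}
    (hj : Real.pi / 4 ≤ |angle L j u|) : 1 ≤ 4 * mass d L ρ u := by
  have hcos := cos_le_three_quarters hj (abs_angle_le_pi j u)
  have hsum : 1 - Real.cos (angle L j u) ≤ mass d L ρ u :=
    Finset.single_le_sum (f := fun j => 1 - Real.cos (angle L j u))
      (fun _ _ => sub_nonneg.mpr (Real.cos_le_one _)) (Finset.mem_univ j)
  linarith

end Angle

section Embedding

variable {d L ρ ρ' : ℕ}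

/-- The map of tori of different sizes that identifies points with the same representative in
`ℤ^d`. It cuts the smaller torus open, so it does not respect the group structure. -/
def torusEmbed (L : ℕ) (h : ρ ≤ ρ') (u : Torus d ρ × Fin L) : Torus d ρ' × Fin L :=
  (fun j => ⟨u.1 j, Finset.Ioc_subset_Ioc (by omega) (by omega) (u.1 j).2⟩, u.2)

theorem coord_torusEmbed (h : ρ ≤ ρ') (u : Torus d ρ × Fin L) :
    (torusEmbed L h u).1.coord = u.1.coord := rfl

theorem torusEmbed_injective (h : ρ ≤ ρ') :
    Function.Injective (torusEmbed (d := d) L h) := fun _ _ huv =>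
  Prod.ext (coord_injective (congrArg (fun w => w.1.coord) huv)) (congrArg (fun w => w.2) huv)

theorem exists_torusEmbed_eq (h : ρ ≤ ρ') {u : Torus d ρ' × Fin L}
    (hu : ∀ j, |u.1.coord j| < ρ) : ∃ v, torusEmbed L h v = u := by
  refine ⟨(fun j => ⟨u.1.coord j, Finset.mem_Ioc.mpr ?_⟩, u.2), Prod.ext (coord_injective rfl) rfl⟩
  have hj := abs_lt.mp (hu j)
  exact ⟨hj.1, hj.2.le⟩

theorem exists_le_abs_coord_of_notMem_range (h : ρ ≤ ρ') {u : Torus d ρ' × Fin L}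
    (hu : u ∉ Set.range (torusEmbed L h)) : ∃ j, (ρ : ℤ) ≤ |u.1.coord j| := by
  by_contra! hlt
  exact hu (exists_torusEmbed_eq h hlt)

/-- The indicator function of the points with a coordinate of modulus at least `r / 2`, the region
in which the Hamiltonian on the torus of size `r` feels the boundary conditions. -/
noncomputable def outer (L r : ℕ) : Torus d ρ × Fin L → ℝ :=
  Set.indicator {u | ∃ j, (r : ℤ) ≤ 2 * |u.1.coord j|} 1

theorem outer_le_one {r : ℕ} : outer (d := d) (ρ := ρ) L r ≤ 1 :=
  Set.indicator_le_self' fun _ _ => zero_le_one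

theorem outer_eq_zero_iff {r : ℕ} {u : Torus d ρ × Fin L} :
    outer L r u = 0 ↔ ∀ j, 2 * |u.1.coord j| < r := by
  simp [outer]

theorem outer_eq_zero_or_one {r : ℕ} (u : Torus d ρ × Fin L) :
    outer L r u = 0 ∨ outer L r u = 1 :=
  Set.indicator_eq_zero_or_self _ _ _

theorem isIdempotentElem_outer {r : ℕ} : IsIdempotentElem (outer (d := d) (ρ := ρ) L r) := by
  funext u
  rcases outer_eq_zero_or_one (r := r) u with hu | hu <;> simp [hu]

theorem outer_le_four_mul_mass {r : ℕ} (hr : 0 < r) (hρ : ρ ≤ 2 * r) :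
    outer L r ≤ 4 * mass d L ρ :=
  Set.indicator_le' (fun _ ⟨_, hj⟩ => one_le_four_mul_mass (pi_div_four_le_abs_angle hr hρ hj))
    fun u _ => mul_nonneg zero_le_four (mass_nonneg u)

theorem exists_torusEmbed_eq_of_outer_eq_zero (h : ρ ≤ ρ') {u : Torus d ρ' × Fin L}
    (hu : outer L ρ u = 0) : ∃ v, torusEmbed L h v = u :=
  exists_torusEmbed_eq h fun j => by
    have := outer_eq_zero_iff.mp hu j
    have := abs_nonneg (u.1.coord j)
    omega

theorem lineMap_mass_sq_le (h : ρ ≤ ρ') {t : ℝ} (ht : t ∈ Set.Icc (0 : ℝ) 1)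
    {u : Torus d ρ × Fin L} (hu : ∀ j, 2 * |u.1.coord j| < ρ) :
    (AffineMap.lineMap (mass d L ρ u) (mass d L ρ' (torusEmbed L h u)) t) ^ 2
      ≤ d * ∑ j, (AffineMap.lineMap (Real.sin (angle L j u))
        (Real.sin (angle L j (torusEmbed L h u))) t) ^ 2 := by
  have hsum : AffineMap.lineMap (mass d L ρ u) (mass d L ρ' (torusEmbed L h u)) t
      = ∑ j, AffineMap.lineMap (1 - Real.cos (angle L j u))
        (1 - Real.cos (angle L j (torusEmbed L h u))) t := by
    simp only [mass, AffineMap.lineMap_apply_module, smul_eq_mul, Finset.mul_sum,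
      Finset.sum_add_distrib]
  rw [hsum]
  refine sq_sum_le_card_mul_sum_sq.trans ?_
  rw [Finset.card_univ, Fintype.card_fin]
  gcongr _ * ∑ j, ?_ with j
  refine lineMap_one_sub_cos_sq_le ?_ (abs_angle_le_pi_div_two (hu j).le)
    (abs_angle_le_pi_div_two ?_) ht
  · rw [angle, angle, coord_torusEmbed, mul_mul_mul_comm]
    exact mul_nonneg (by positivity) (mul_self_nonneg _)
  · rw [coord_torusEmbed]
    exact (hu j).le.trans (by exact_mod_cast h)

theorem outer_lineMap_mass_sq_le (h : ρ ≤ ρ') {t : ℝ} (ht : t ∈ Set.Icc (0 : ℝ) 1)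
    (m : Torus d ρ' × Fin L → ℝ) :
    (1 - outer L ρ) * (AffineMap.lineMap (Function.extend (torusEmbed L h) (mass d L ρ) m)
        (mass d L ρ') t) ^ 2
      ≤ (d : ℝ) • ∑ j, AffineMap.lineMap
        (fun j => Function.extend (torusEmbed L h) (fun u => Real.sin (angle L j u)) 0)
        (fun j u => Real.sin (angle L j u)) t j ^ 2 := by
  intro u
  simp only [Pi.mul_apply, Pi.sub_apply, Pi.one_apply, Pi.pow_apply, Pi.smul_apply,
    Finset.sum_apply, smul_eq_mul, AffineMap.pi_lineMap_apply]
  rcases outer_eq_zero_or_one u with hu | hu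
  · obtain ⟨u, rfl⟩ := exists_torusEmbed_eq_of_outer_eq_zero h hu
    simp only [hu, sub_zero, one_mul, (torusEmbed_injective h).extend_apply]
    exact lineMap_mass_sq_le h ht (outer_eq_zero_iff.mp hu)
  · rw [hu, sub_self, zero_mul]
    positivity

end Embedding

section Core

variable {d L ρ ρ' : ℕ} {H : Hilb d L →L[ℂ] Hilb d L} {R : ℝ} {p : Fin d → ℕ} {η : ℝ}

theorem HasFiniteRange.kernel_eq_zero_of_core (hR : HasFiniteRange H R) (hRρ : 2 * R ≤ ρ)
    {x y : Fin d → ℤ} (hx : ∀ j, 2 * |x j| < ρ) {j : Fin d} (hy : (ρ : ℤ) ≤ |y j|) :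
    kernel H x y = 0 := by
  refine hR.kernel_eq_zero (j := j) ?_
  have hx' : 2 * |(x j : ℝ)| < ρ := by exact_mod_cast hx j
  have hy' : (ρ : ℝ) ≤ |(y j : ℝ)| := by exact_mod_cast hy
  have hsub := abs_sub_abs_le_abs_sub (y j : ℝ) (x j)
  rw [abs_sub_comm] at hsub
  linarith

theorem le_abs_coord_add {v : Torus d ρ} {a : Fin d → ℤ} {j : Fin d} (ha : a j ≠ 0) :
    (ρ : ℤ) ≤ |(v.coord + (2 * (ρ : ℤ)) • a) j| := by
  have hcoord := abs_coord_le v j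
  have hone : (1 : ℤ) ≤ |a j| := Int.one_le_abs ha
  have hmul : |2 * (ρ : ℤ) * a j| = 2 * ρ * |a j| := by
    rw [abs_mul, abs_of_nonneg (by positivity)]
  have hsub := abs_sub_abs_le_abs_sub (2 * (ρ : ℤ) * a j) (-v.coord j)
  rw [abs_neg, sub_neg_eq_add, hmul, add_comm (2 * (ρ : ℤ) * a j)] at hsub
  simp only [Pi.add_apply, Pi.smul_apply, smul_eq_mul]
  nlinarith

theorem HasFiniteRange.perHam_apply_of_core (hR : HasFiniteRange H R) (hRρ : 2 * R ≤ ρ)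
    (h : ρ ≤ ρ') {u : Torus d ρ' × Fin L} (hu : ∀ j, 2 * |u.1.coord j| < ρ)
    (v : Torus d ρ' × Fin L) :
    perHam H ρ' u v = kernel H u.1.coord v.1.coord u.2 v.2 := by
  rw [perHam, of_apply, finsum_eq_single _ 0]
  · simp
  · intro a ha
    obtain ⟨j, hj⟩ := Function.ne_iff.mp ha
    have hle : (ρ : ℤ) ≤ |(v.1.coord + (2 * (ρ' : ℤ)) • a) j| :=
      (Int.ofNat_le.mpr h).trans (le_abs_coord_add hj)
    rw [hR.kernel_eq_zero_of_core hRρ hu hle]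
    rfl

theorem HasFiniteRange.extendZero_scaledPerHam_apply_of_core (hR : HasFiniteRange H R)
    (hRρ : 2 * R ≤ ρ) (h : ρ ≤ ρ') {u : Torus d ρ' × Fin L} (hu : outer L ρ u = 0)
    (v : Torus d ρ' × Fin L) :
    extendZero (torusEmbed L h) (scaledPerHam H η ρ) u v = scaledPerHam H η ρ' u v := by
  have hcore := outer_eq_zero_iff.mp hu
  obtain ⟨u, rfl⟩ := exists_torusEmbed_eq_of_outer_eq_zero h hu
  rw [scaledPerHam, scaledPerHam, Matrix.smul_apply, hR.perHam_apply_of_core hRρ h hcore]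
  by_cases hv : v ∈ Set.range (torusEmbed L h)
  · obtain ⟨v, rfl⟩ := hv
    rw [extendZero_apply (torusEmbed_injective h), Matrix.smul_apply,
      hR.perHam_apply_of_core hRρ le_rfl hcore]
    rfl
  · obtain ⟨j, hj⟩ := exists_le_abs_coord_of_notMem_range h hv
    rw [extendZero_apply_of_right_notMem_range _ _ hv, hR.kernel_eq_zero_of_core hRρ hcore hj]
    simp

theorem eq_realDiagonal_mul_mul_realDiagonal {X : Type*} [Fintype X] [DecidableEq X]
    {r : Matrix X X ℂ} (hr : r.IsHermitian) {χ : X → ℝ} (hχ : ∀ x, χ x = 0 ∨ χ x = 1)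
    (h0 : ∀ x y, χ x = 0 → r x y = 0) : r = realDiagonal χ * r * realDiagonal χ := by
  ext x y
  rw [realDiagonal_apply, mul_diagonal, diagonal_mul]
  rcases hχ x with hx | hx
  · simp [h0 x y hx]
  · rcases hχ y with hy | hy
    · have hstar := hr.apply x y
      rw [h0 y x hy, star_zero] at hstar
      simp [← hstar]
    · simp [hx, hy]

theorem IsGappedPeriodic.scaledPerHam_sub_extendZero (hS : IsGappedPeriodic H R p)
    (hdvd : ∀ j, p j ∣ 2 * ρ) (hdvd' : ∀ j, p j ∣ 2 * ρ') (hRρ : 2 * R ≤ ρ) (h : ρ ≤ ρ') :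
    scaledPerHam H η ρ' - extendZero (torusEmbed L h) (scaledPerHam H η ρ)
      = realDiagonal (outer L ρ)
        * (scaledPerHam H η ρ' - extendZero (torusEmbed L h) (scaledPerHam H η ρ))
        * realDiagonal (outer L ρ) := by
  refine eq_realDiagonal_mul_mul_realDiagonal
    ((hS.scaledPerHam_isHermitian hdvd').sub
      (extendZero_isHermitian _ (hS.scaledPerHam_isHermitian hdvd)))
    outer_eq_zero_or_one fun u v hu => ?_
  rw [Matrix.sub_apply,
    hS.hasFiniteRange.extendZero_scaledPerHam_apply_of_core hRρ h hu, sub_self]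

end Core

section Comparison

variable {d L k ρ ρ' : ℕ} {H : Hilb d L →L[ℂ] Hilb d L} {R : ℝ} {p : Fin d → ℕ}
  {γ : Fin (d - 1) → Matrix (Fin k) (Fin k) ℂ} {η : ℝ}

theorem norm_lie_realDiagonal_mass_le {h : Matrix (Torus d ρ × Fin L) (Torus d ρ × Fin L) ℂ}
    (hh : h.IsHermitian) {ε : ℝ} (hε : ∀ j : Fin d, ‖⁅phase (angle (ρ := ρ) L j), h⁆‖ ≤ ε) :
    ‖⁅realDiagonal (mass d L ρ), h⁆‖ ≤ d * ε := by
  have hcos (j : Fin d) :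
      ‖⁅realDiagonal (fun u => 1 - Real.cos (angle (ρ := ρ) L j u)), h⁆‖ ≤ ε := by
    have hsub : realDiagonal (fun u => 1 - Real.cos (angle (ρ := ρ) L j u))
        = 1 - realDiagonal (fun u => Real.cos (angle L j u)) := by
      rw [← map_one realDiagonal, ← map_sub]
      rfl
    rw [hsub, Ring.lie_def, sub_mul, mul_sub, one_mul, mul_one, sub_sub_sub_cancel_left,
      norm_sub_rev, ← Ring.lie_def]
    exact norm_lie_realDiagonal_cos_le hh (hε j)
  rw [mass_eq_sum, map_sum, Ring.lie_def, Finset.sum_mul, Finset.mul_sum,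
    ← Finset.sum_sub_distrib]
  refine (norm_sum_le _ _).trans ((Finset.sum_le_card_nsmul _ _ ε fun j _ => hcos j).trans ?_)
  simp

theorem IsLocalizerModel.extend {X X' : Type*} [Fintype X] [DecidableEq X] [Fintype X']
    [DecidableEq X'] {ι : X → X'} (hι : Function.Injective ι) (hd : 0 < d) {χ' : X' → ℝ}
    (hχ : χ' ≤ 1) {c : X → ℝ} {s : Fin d → X → ℝ} {h : Matrix X X ℂ} {b e ε : ℝ}
    (m : IsLocalizerModel (χ' ∘ ι) c s h b e ε) :
    IsLocalizerModel χ' (Function.extend ι c 2) (fun j => Function.extend ι (s j) 0)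
      (extendZero ι h) b e ε where
  isHermitian := extendZero_isHermitian ι m.isHermitian
  le_four_mul u := by
    by_cases hu : u ∈ Set.range ι
    · obtain ⟨v, rfl⟩ := hu
      rw [Pi.mul_apply, hι.extend_apply]
      exact m.le_four_mul v
    · rw [Pi.mul_apply, Function.extend_apply' _ _ _ hu]
      exact (hχ u).trans (by norm_num)
  mem_Icc u := by
    by_cases hu : u ∈ Set.range ι
    · obtain ⟨v, rfl⟩ := hu
      simpa only [hι.extend_apply] using m.mem_Icc v
    · have hd1 : (1 : ℝ) ≤ d := by exact_mod_cast hd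
      rw [Function.extend_apply' _ _ _ hu, Pi.ofNat_apply]
      constructor <;> linarith
  abs_le_one j u := by
    by_cases hu : u ∈ Set.range ι
    · obtain ⟨v, rfl⟩ := hu
      simpa only [hι.extend_apply] using m.abs_le_one j v
    · simp [Function.extend_apply' _ _ _ hu]
  norm_le := (norm_extendZero_le hι h).trans m.norm_le
  norm_lie_mass_le := (norm_lie_realDiagonal_extend_le hι c 2 h).trans m.norm_lie_mass_le
  norm_lie_position_le j :=
    (norm_lie_realDiagonal_extend_le hι (s j) 0 h).trans (m.norm_lie_position_le j)

theorem IsGappedPeriodic.isLocalizerModel (hS : IsGappedPeriodic H R p) (hη : 0 < η)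
    (hρ : 0 < ρ) (h : ρ ≤ ρ') (h2 : ρ' ≤ 2 * ρ) (hdvd' : ∀ j, p j ∣ 2 * ρ') :
    IsLocalizerModel (outer L ρ) (mass d L ρ') (fun j u => Real.sin (angle L j u))
      (scaledPerHam H η ρ') (‖H‖ / η) (d * (Real.pi * (maxCommutator H / (η * ρ))))
      (Real.pi * (maxCommutator H / (η * ρ))) := by
  have hh := hS.scaledPerHam_isHermitian (η := η) hdvd'
  have hρ' := hρ.trans_le h
  have hM := maxCommutator_nonneg H
  have hphase : ∀ j, ‖⁅phase (angle (ρ := ρ') L j), scaledPerHam H η ρ'⁆‖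
      ≤ Real.pi * (maxCommutator H / (η * ρ)) := fun j =>
    (hS.norm_lie_phase_scaledPerHam_le hρ' hdvd' hη j).trans (by gcongr)
  exact {
    isHermitian := hh
    le_four_mul := outer_le_four_mul_mass hρ h2
    mem_Icc := fun u => ⟨mass_nonneg u, mass_le u⟩
    abs_le_one := fun j u => Real.abs_sin_le_one _
    norm_le := hS.norm_scaledPerHam_le hρ' hdvd' hη
    norm_lie_mass_le := norm_lie_realDiagonal_mass_le hh hphase
    norm_lie_position_le := fun j => norm_lie_realDiagonal_sin_le hh (hphase j) }

/-- A value of `η` at which the localizers of volumes `ρ ≤ ρ' ≤ 2ρ` can be deformed into each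
other: so large that the Hamiltonian term is small against the mass in the outer region. -/
noncomputable def comparisonScale (H : Hilb d L →L[ℂ] Hilb d L) : ℝ :=
  100 * d ^ 2 * ‖H‖ ^ 3 / gap H ^ 2

theorem comparisonScale_pos (hd : 0 < d) (hg : 0 < gap H) (hgn : gap H ≤ ‖H‖) :
    0 < comparisonScale H := by
  have hn : 0 < ‖H‖ := hg.trans_le hgn
  rw [comparisonScale]
  positivity

theorem norm_div_comparisonScale (hg : 0 < gap H) (hgn : gap H ≤ ‖H‖) :
    ‖H‖ / comparisonScale H = (gap H / ‖H‖) ^ 2 / (100 * d ^ 2) := by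
  have hn : 0 < ‖H‖ := hg.trans_le hgn
  rw [comparisonScale]
  field_simp

theorem comparison_numerics {d P b δ : ℝ} (hd : 1 ≤ d) (hP0 : 0 < P) (hP1 : P ≤ 1)
    (hb : b = P / (100 * d ^ 2)) (hδ0 : 0 ≤ δ) (hδ : δ ≤ P ^ 3 * b / (11 * 10 ^ 6 * d ^ 4)) :
    8 * b * (b ^ 2 + d * (Real.pi * δ)) * (1 + 32 * b ^ 2 + 32 * d ^ 2 * b)
      + d ^ 2 * (Real.pi * δ) < P * b ^ 2 / 4 := by
  have hd2 : 1 ≤ d ^ 2 := one_le_pow₀ hd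
  have hb0 : 0 < b := by rw [hb]; positivity
  have hdb : d ^ 2 * b = P / 100 := by rw [hb]; field_simp
  have hbP : b ≤ P / 100 := by nlinarith
  have hPb : 0 < P * b ^ 2 := by positivity
  have hfactor : 1 + 32 * b ^ 2 + 32 * d ^ 2 * b ≤ 4 / 3 := by nlinarith
  have hposition : d ^ 2 * (Real.pi * δ) ≤ P * b ^ 2 / 10000 := by
    calc d ^ 2 * (Real.pi * δ) ≤ d ^ 2 * (3.15 * (P ^ 3 * b / (11 * 10 ^ 6 * d ^ 4))) := by
          gcongr
          exact Real.pi_lt_d2.le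
      _ = 3.15 * 100 / (11 * 10 ^ 6) * (P ^ 2 * b * (P / (100 * d ^ 2))) := by
          field_simp
      _ = 3.15 * 100 / (11 * 10 ^ 6) * (P * (P * b ^ 2)) := by rw [← hb]; ring
      _ ≤ 3.15 * 100 / (11 * 10 ^ 6) * (1 * (P * b ^ 2)) := by gcongr
      _ ≤ P * b ^ 2 / 10000 := by nlinarith
  have hmass : d * (Real.pi * δ) ≤ P * b ^ 2 / 10000 :=
    (mul_le_mul_of_nonneg_right (by nlinarith) (by positivity)).trans hposition
  have hcubic : b * (b ^ 2 + d * (Real.pi * δ)) ≤ P * b ^ 2 / 99 := by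
    calc b * (b ^ 2 + d * (Real.pi * δ))
        ≤ b * b ^ 2 + 1 / 100 * (P * b ^ 2 / 10000) := by
          rw [mul_add]
          gcongr
          linarith
      _ ≤ P / 100 * b ^ 2 + 1 / 100 * (P * b ^ 2 / 10000) := by gcongr
      _ ≤ P * b ^ 2 / 99 := by linarith
  calc 8 * b * (b ^ 2 + d * (Real.pi * δ)) * (1 + 32 * b ^ 2 + 32 * d ^ 2 * b)
        + d ^ 2 * (Real.pi * δ)
      ≤ 8 * (P * b ^ 2 / 99) * (4 / 3) + P * b ^ 2 / 10000 := by
        rw [mul_assoc 8 b]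
        gcongr
    _ < P * b ^ 2 / 4 := by linarith

theorem comparisonScale_numerics (hd : 0 < d) (hg : 0 < gap H) (hgn : gap H ≤ ‖H‖) (hρ : 0 < ρ)
    (hsize : 11 * 10 ^ 6 * d ^ 4 * maxCommutator H * ‖H‖ ^ 5 ≤ ρ * gap H ^ 6)
    {η : ℝ} (hη : η = comparisonScale H) :
    8 * (‖H‖ / η) * ((‖H‖ / η) ^ 2 + d * (Real.pi * (maxCommutator H / (η * ρ))))
          * (1 + 32 * (‖H‖ / η) ^ 2 + 32 * d ^ 2 * (‖H‖ / η))
        + d ^ 2 * (Real.pi * (maxCommutator H / (η * ρ)))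
      < (gap H / η) ^ 2 / 4 := by
  have hn : 0 < ‖H‖ := hg.trans_le hgn
  have hη0 : 0 < η := hη ▸ comparisonScale_pos hd hg hgn
  have hM := maxCommutator_nonneg H
  have hd1 : (1 : ℝ) ≤ d := by exact_mod_cast hd
  have hratio : (gap H / ‖H‖) ^ 2 ≤ 1 :=
    pow_le_one₀ (by positivity) ((div_le_one hn).mpr hgn)
  have hδ : maxCommutator H / (η * ρ)
      ≤ ((gap H / ‖H‖) ^ 2) ^ 3 * (‖H‖ / η) / (11 * 10 ^ 6 * d ^ 4) := by
    rw [div_le_div_iff₀ (by positivity) (by positivity)]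
    have hcancel : ((gap H / ‖H‖) ^ 2) ^ 3 * (‖H‖ / η) * (η * ρ) = ρ * gap H ^ 6 / ‖H‖ ^ 5 := by
      field_simp
    rw [hcancel, le_div_iff₀ (by positivity)]
    linarith
  have hgap : (gap H / η) ^ 2 = (gap H / ‖H‖) ^ 2 * (‖H‖ / η) ^ 2 := by field_simp
  rw [hgap]
  exact comparison_numerics hd1 (by positivity) hratio
    (hη ▸ norm_div_comparisonScale hg hgn) (by positivity) hδ

theorem mul_norm_div_comparisonScale_le_one (hd : 0 < d) (hg : 0 < gap H) (hgn : gap H ≤ ‖H‖) :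
    64 * d * (‖H‖ / comparisonScale H) ≤ 1 := by
  have hn : 0 < ‖H‖ := hg.trans_le hgn
  have hd1 : (1 : ℝ) ≤ d := by exact_mod_cast hd
  have hratio : (gap H / ‖H‖) ^ 2 ≤ 1 :=
    pow_le_one₀ (by positivity) ((div_le_one hn).mpr hgn)
  rw [norm_div_comparisonScale hg hgn, mul_div_assoc', div_le_one (by positivity)]
  nlinarith

theorem signature_perLocalizer_eq_of_le_two_mul (hS : IsGappedPeriodic H R p)
    (hΓ : IsOddCliffordRep (gammaHat γ)) (hd : 0 < d) (hρ : 0 < ρ) (h : ρ ≤ ρ')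
    (h2 : ρ' ≤ 2 * ρ) (hdvd : ∀ j, p j ∣ 2 * ρ) (hdvd' : ∀ j, p j ∣ 2 * ρ') (hRρ : 2 * R ≤ ρ)
    (hsize : 11 * 10 ^ 6 * d ^ 4 * maxCommutator H * ‖H‖ ^ 5 ≤ ρ * gap H ^ 6) :
    signature (perLocalizer H γ (comparisonScale H) ρ)
        (perLocalizer_isHermitian hS.isSelfAdjoint hS.isPeriodic hdvd γ _)
      = signature (perLocalizer H γ (comparisonScale H) ρ')
        (perLocalizer_isHermitian hS.isSelfAdjoint hS.isPeriodic hdvd' γ _) := by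
  have hη := comparisonScale_pos hd hS.gap_pos hS.gap_le_norm
  have hι := torusEmbed_injective (d := d) (L := L) h
  have m := hS.isLocalizerModel hη hρ le_rfl (by omega) hdvd
  have m' := hS.isLocalizerModel hη hρ h h2 hdvd'
  rw [signature_congr (perLocalizer_eq_locMat_mass H γ _ ρ) _ (locMat_isHermitian _ _ _
      m.isHermitian), signature_congr (perLocalizer_eq_locMat_mass H γ _ ρ') _
      (locMat_isHermitian _ _ _ m'.isHermitian), ← signature_locMat_extend (gammaHat γ) hι _ 2 _
      m.isHermitian]
  exact IsLocalizerModel.signature_locMat_eq hΓ hd isIdempotentElem_outer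
    (m.extend hι hd outer_le_one) m' (hS.scaledPerHam_sub_extendZero hdvd hdvd' hRρ h)
    (div_pos hS.gap_pos hη).le
    (hS.mul_norm_le_norm_Φ_scaledPerHam_apply (hρ.trans_le h) hdvd' hη _)
    (mul_norm_div_comparisonScale_le_one hd hS.gap_pos hS.gap_le_norm)
    (comparisonScale_numerics hd hS.gap_pos hS.gap_le_norm hρ hsize rfl)
    fun t ht => outer_lineMap_mass_sq_le h ht 2

theorem signature_perLocalizer_eq_of_le (hS : IsGappedPeriodic H R p)
    (hΓ : IsOddCliffordRep (gammaHat γ)) (hd : 0 < d) (hρ : 0 < ρ) (h : ρ ≤ ρ')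
    (hdvd : ∀ j, p j ∣ 2 * ρ) (hdvd' : ∀ j, p j ∣ 2 * ρ') (hRρ : 2 * R ≤ ρ)
    (hsize : 11 * 10 ^ 6 * d ^ 4 * maxCommutator H * ‖H‖ ^ 5 ≤ ρ * gap H ^ 6) :
    signature (perLocalizer H γ (comparisonScale H) ρ)
        (perLocalizer_isHermitian hS.isSelfAdjoint hS.isPeriodic hdvd γ _)
      = signature (perLocalizer H γ (comparisonScale H) ρ')
        (perLocalizer_isHermitian hS.isSelfAdjoint hS.isPeriodic hdvd' γ _) := by
  obtain ⟨m, hm⟩ : ∃ m, ρ' ≤ 2 ^ m * ρ :=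
    ⟨ρ', Nat.lt_two_pow_self.le.trans (Nat.le_mul_of_pos_right _ hρ)⟩
  induction m generalizing ρ with
  | zero =>
    exact signature_perLocalizer_eq_of_le_two_mul hS hΓ hd hρ h (by omega) hdvd hdvd' hRρ hsize
  | succ m ih =>
    rcases le_total ρ' (2 * ρ) with h2 | h2
    · exact signature_perLocalizer_eq_of_le_two_mul hS hΓ hd hρ h h2 hdvd hdvd' hRρ hsize
    · have hg := hS.gap_pos
      have hdvd2 : ∀ j, p j ∣ 2 * (2 * ρ) := fun j => (hdvd j).mul_left 2
      have hcast : (ρ : ℝ) ≤ (2 * ρ : ℕ) := by exact_mod_cast Nat.le_mul_of_pos_left ρ two_pos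
      rw [signature_perLocalizer_eq_of_le_two_mul hS hΓ hd hρ (by omega) le_rfl hdvd hdvd2 hRρ
        hsize]
      exact ih (by omega) h2 hdvd2 (hRρ.trans hcast) (hsize.trans (by gcongr))
        (by rwa [← mul_assoc, ← pow_succ])

end Comparison

section Admissibility

variable {d L k ρ ρ' : ℕ} {H : Hilb d L →L[ℂ] Hilb d L} {R : ℝ} {p : Fin d → ℕ} {η η' : ℝ}
  {γ : Fin (d - 1) → Matrix (Fin k) (Fin k) ℂ}

theorem Admissible.mul_sub_le (ha : Admissible H R p η ρ) (hd : 0 < d) (hn : 0 < ‖H‖) :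
    16 * d * (η * (‖H‖ - η)) ≤ gap H ^ 2 := by
  have hη := ha.eta_pos
  have hflat : 4 * (1 - η / ‖H‖) ≤ gap H ^ 2 / (4 * d * η * ‖H‖) :=
    (le_add_of_nonneg_left (sq_nonneg _)).trans ha.flatness
  rw [le_div_iff₀ (by positivity)] at hflat
  calc 16 * d * (η * (‖H‖ - η)) = 4 * (1 - η / ‖H‖) * (4 * d * η * ‖H‖) := by
        field_simp
        ring
    _ ≤ gap H ^ 2 := hflat

theorem Admissible.mul_norm_le_eta (ha : Admissible H R p η ρ) (hd : 0 < d) (hg : 0 < gap H)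
    (hgn : gap H ≤ ‖H‖) : 7 / 8 * ‖H‖ ≤ η := by
  have hn : 0 < ‖H‖ := hg.trans_le hgn
  have hη := ha.eta_pos
  have hgη := ha.eta_ge
  by_contra! hlt
  have hd1 : (1 : ℝ) ≤ d := by exact_mod_cast hd
  have hmul : 16 * (η * (‖H‖ - η)) ≤ gap H ^ 2 := by
    refine le_trans ?_ (ha.mul_sub_le hd hn)
    have : 0 ≤ η * (‖H‖ - η) := mul_nonneg hη.le (by linarith)
    nlinarith
  have hhalf : ‖H‖ ≤ 2 * η := by
    have : gap H ^ 2 ≤ (4 * η) ^ 2 := by gcongr; linarith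
    nlinarith
  nlinarith [mul_nonneg (sub_nonneg.mpr hhalf) (sub_nonneg.mpr hlt.le)]

theorem Admissible.mul_eta_sq_le (ha : Admissible H R p η ρ) (hg : 0 < gap H) :
    15 * 10 ^ 6 * d ^ 4 * maxCommutator H * ‖H‖ ^ 3 * η ^ 2 ≤ ρ * gap H ^ 6 :=
  (div_le_iff₀ (by positivity)).mp ha.rho_ge

theorem Admissible.mul_norm_pow_le (ha : Admissible H R p η ρ) (hd : 0 < d)
    (hg : 0 < gap H) (hgn : gap H ≤ ‖H‖) :
    11 * 10 ^ 6 * d ^ 4 * maxCommutator H * ‖H‖ ^ 5 ≤ ρ * gap H ^ 6 := by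
  have hM := maxCommutator_nonneg H
  have hsq : (7 / 8 * ‖H‖) ^ 2 ≤ η ^ 2 := by
    gcongr
    exact ha.mul_norm_le_eta hd hg hgn
  calc 11 * 10 ^ 6 * d ^ 4 * maxCommutator H * ‖H‖ ^ 5
      = 10 ^ 6 * d ^ 4 * maxCommutator H * ‖H‖ ^ 3 * (11 * ‖H‖ ^ 2) := by ring
    _ ≤ 10 ^ 6 * d ^ 4 * maxCommutator H * ‖H‖ ^ 3 * (15 * η ^ 2) := by
        gcongr _ * ?_
        nlinarith
    _ = 15 * 10 ^ 6 * d ^ 4 * maxCommutator H * ‖H‖ ^ 3 * η ^ 2 := by ring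
    _ ≤ ρ * gap H ^ 6 := ha.mul_eta_sq_le hg

theorem Admissible.size_le (ha : Admissible H R p η ρ) (hd : 0 < d) (hg : 0 < gap H)
    (hgn : gap H ≤ ‖H‖) : 40 * d * maxCommutator H * η ≤ gap H ^ 2 * ρ := by
  have hM := maxCommutator_nonneg H
  have hη := ha.eta_pos
  have hgη : gap H ≤ 2 * η := by linarith [ha.mul_norm_le_eta hd hg hgn]
  have hd4 : (d : ℝ) ≤ d ^ 4 := le_self_pow₀ (by exact_mod_cast hd) (by norm_num)
  refine le_of_mul_le_mul_right ?_ (pow_pos hg 4)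
  calc 40 * d * maxCommutator H * η * gap H ^ 4
      = 40 * d * maxCommutator H * η * gap H ^ 3 * gap H := by ring
    _ ≤ 40 * d ^ 4 * maxCommutator H * η * ‖H‖ ^ 3 * (2 * η) := by gcongr
    _ = 80 * (d ^ 4 * maxCommutator H * ‖H‖ ^ 3 * η ^ 2) := by ring
    _ ≤ 15 * 10 ^ 6 * (d ^ 4 * maxCommutator H * ‖H‖ ^ 3 * η ^ 2) := by gcongr; norm_num
    _ = 15 * 10 ^ 6 * d ^ 4 * maxCommutator H * ‖H‖ ^ 3 * η ^ 2 := by ring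
    _ ≤ ρ * gap H ^ 6 := ha.mul_eta_sq_le hg
    _ = gap H ^ 2 * ρ * gap H ^ 4 := by ring

theorem mul_comparisonScale_le (hd : 0 < d) (hg : 0 < gap H) (hgn : gap H ≤ ‖H‖)
    (hsize : 11 * 10 ^ 6 * d ^ 4 * maxCommutator H * ‖H‖ ^ 5 ≤ ρ * gap H ^ 6) :
    40 * d * maxCommutator H * comparisonScale H ≤ gap H ^ 2 * ρ := by
  have hM := maxCommutator_nonneg H
  have hd1 : (1 : ℝ) ≤ d := by exact_mod_cast hd
  refine le_of_mul_le_mul_right ?_ (pow_pos hg 4)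
  calc 40 * d * maxCommutator H * comparisonScale H * gap H ^ 4
      = 4000 * d ^ 3 * maxCommutator H * ‖H‖ ^ 3 * gap H ^ 2 := by
        rw [comparisonScale]
        field_simp
        ring
    _ ≤ 4000 * d ^ 4 * maxCommutator H * ‖H‖ ^ 3 * ‖H‖ ^ 2 := by gcongr; norm_num
    _ = 4000 * (d ^ 4 * maxCommutator H * ‖H‖ ^ 5) := by ring
    _ ≤ 11 * 10 ^ 6 * (d ^ 4 * maxCommutator H * ‖H‖ ^ 5) := by gcongr; norm_num
    _ = 11 * 10 ^ 6 * d ^ 4 * maxCommutator H * ‖H‖ ^ 5 := by ring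
    _ ≤ ρ * gap H ^ 6 := hsize
    _ = gap H ^ 2 * ρ * gap H ^ 4 := by ring

theorem norm_le_comparisonScale (hd : 0 < d) (hg : 0 < gap H) (hgn : gap H ≤ ‖H‖) :
    ‖H‖ ≤ comparisonScale H := by
  have hd1 : (1 : ℝ) ≤ d := by exact_mod_cast hd
  rw [comparisonScale, le_div_iff₀ (by positivity)]
  calc ‖H‖ * gap H ^ 2 ≤ ‖H‖ * ‖H‖ ^ 2 := by gcongr
    _ = 1 * 1 ^ 2 * ‖H‖ ^ 3 := by ring
    _ ≤ 100 * d ^ 2 * ‖H‖ ^ 3 := by gcongr; norm_num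

theorem Admissible.weaklyAdmissible (ha : Admissible H R p η ρ) (hd : 0 < d) (hg : 0 < gap H)
    (hgn : gap H ≤ ‖H‖) : WeaklyAdmissible H p η ρ where
  rho_pos := ha.rho_pos
  period_dvd := ha.period_dvd
  eta_pos := ha.eta_pos
  mul_sub_le := ha.mul_sub_le hd (hg.trans_le hgn)
  size_le := ha.size_le hd hg hgn

theorem Admissible.weaklyAdmissible_comparisonScale (ha : Admissible H R p η ρ) (hd : 0 < d)
    (hg : 0 < gap H) (hgn : gap H ≤ ‖H‖) : WeaklyAdmissible H p (comparisonScale H) ρ where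
  rho_pos := ha.rho_pos
  period_dvd := ha.period_dvd
  eta_pos := comparisonScale_pos hd hg hgn
  mul_sub_le := by
    have hη := comparisonScale_pos hd hg hgn
    have hneg := mul_nonpos_of_nonneg_of_nonpos hη.le
      (sub_nonpos.mpr (norm_le_comparisonScale hd hg hgn))
    exact (mul_nonpos_of_nonneg_of_nonpos (by positivity) hneg).trans (sq_nonneg _)
  size_le := mul_comparisonScale_le hd hg hgn (ha.mul_norm_pow_le hd hg hgn)

theorem WeaklyAdmissible.of_le_of_le {t : ℝ} (h : WeaklyAdmissible H p η ρ)
    (h' : WeaklyAdmissible H p η' ρ) (hη : ‖H‖ ≤ 2 * η) (ht : η ≤ t) (ht' : t ≤ η') :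
    WeaklyAdmissible H p t ρ where
  rho_pos := h.rho_pos
  period_dvd := h.period_dvd
  eta_pos := h.eta_pos.trans_le ht
  mul_sub_le := by
    refine le_trans ?_ h.mul_sub_le
    gcongr 16 * d * ?_
    nlinarith
  size_le := by
    have hM := maxCommutator_nonneg H
    refine le_trans ?_ h'.size_le
    gcongr

theorem WeaklyAdmissible.of_mem_segment {t : ℝ} (h : WeaklyAdmissible H p η ρ)
    (h' : WeaklyAdmissible H p η' ρ) (hη : ‖H‖ ≤ 2 * η) (hη' : ‖H‖ ≤ 2 * η')
    (ht : t ∈ segment ℝ η η') : WeaklyAdmissible H p t ρ := by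
  rw [segment_eq_uIcc, Set.mem_uIcc] at ht
  rcases ht with ⟨hl, hu⟩ | ⟨hl, hu⟩
  · exact h.of_le_of_le h' hη hl hu
  · exact h'.of_le_of_le h hη' hl hu

theorem Admissible.posSemidef_perLocalizer_sq_sub (ha : Admissible H R p η ρ)
    (hS : IsGappedPeriodic H R p) (hΓ : IsOddCliffordRep (gammaHat γ)) (hd : 0 < d) :
    (perLocalizer H γ η ρ ^ 2 - ((gap H ^ 2 / (600 * d * η ^ 2) : ℝ) : ℂ) •
      (1 : Matrix (LocIndex d L k ρ) (LocIndex d L k ρ) ℂ)).PosSemidef := by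
  refine posSemidef_sq_sub_smul_one
    (perLocalizer_isHermitian hS.isSelfAdjoint hS.isPeriodic ha.period_dvd γ η) fun ψ => ?_
  have hη := ha.eta_pos
  have hd1 : (1 : ℝ) ≤ d := by exact_mod_cast hd
  refine le_trans ?_
    ((ha.weaklyAdmissible hd hS.gap_pos hS.gap_le_norm).norm_perLocalizer_apply_sq_ge hS hΓ ψ)
  gcongr
  linarith

theorem Admissible.signature_perLocalizer_eq_comparisonScale (ha : Admissible H R p η ρ)
    (hS : IsGappedPeriodic H R p) (hΓ : IsOddCliffordRep (gammaHat γ)) (hd : 0 < d) :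
    signature (perLocalizer H γ η ρ)
        (perLocalizer_isHermitian hS.isSelfAdjoint hS.isPeriodic ha.period_dvd γ η)
      = signature (perLocalizer H γ (comparisonScale H) ρ)
        (perLocalizer_isHermitian hS.isSelfAdjoint hS.isPeriodic ha.period_dvd γ _) := by
  have hg := hS.gap_pos
  have hgn := hS.gap_le_norm
  refine signature_perLocalizer_eq_of_segment hS hΓ ha.period_dvd fun t ht =>
    (ha.weaklyAdmissible hd hg hgn).of_mem_segment
      (ha.weaklyAdmissible_comparisonScale hd hg hgn) ?_ ?_ ht
  · linarith [ha.mul_norm_le_eta hd hg hgn]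
  · linarith [norm_le_comparisonScale hd hg hgn, comparisonScale_pos hd hg hgn]

theorem Admissible.signature_perLocalizer_eq (h : Admissible H R p η ρ)
    (h' : Admissible H R p η' ρ') (hS : IsGappedPeriodic H R p)
    (hΓ : IsOddCliffordRep (gammaHat γ)) (hd : 0 < d) :
    signature (perLocalizer H γ η ρ)
        (perLocalizer_isHermitian hS.isSelfAdjoint hS.isPeriodic h.period_dvd γ η)
      = signature (perLocalizer H γ η' ρ')
        (perLocalizer_isHermitian hS.isSelfAdjoint hS.isPeriodic h'.period_dvd γ η') := by
  have hg := hS.gap_pos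
  have hgn := hS.gap_le_norm
  rw [h.signature_perLocalizer_eq_comparisonScale hS hΓ hd,
    h'.signature_perLocalizer_eq_comparisonScale hS hΓ hd]
  rcases le_total ρ ρ' with hle | hle
  · exact signature_perLocalizer_eq_of_le hS hΓ hd h.rho_pos hle h.period_dvd h'.period_dvd
      h.two_range_le (h.mul_norm_pow_le hd hg hgn)
  · exact (signature_perLocalizer_eq_of_le hS hΓ hd h'.rho_pos hle h'.period_dvd h.period_dvd
      h'.two_range_le (h'.mul_norm_pow_le hd hg hgn)).symm

end Admissibility

end PeriodicLocalizer

theorem mainTheorem4_general {d L k : ℕ} (hd : 0 < d) (hL : 0 < L)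
    (H : Hilb d L →L[ℂ] Hilb d L) (hH : IsSelfAdjoint H) (hgap : (0 : ℂ) ∉ spectrum ℂ H)
    (R : ℝ) (hR : HasFiniteRange H R) (p : Fin d → ℕ) (hp : IsPeriodic H p)
    (γ : Fin (d - 1) → Matrix (Fin k) (Fin k) ℂ) (hγ : ∀ i, (γ i).IsHermitian)
    (hcl : ∀ i j, γ i * γ j + γ j * γ i = if i = j then 2 else 0) :
    (∀ (η : ℝ) (ρ : ℕ), Admissible H R p η ρ →
      (perLocalizer H γ η ρ ^ 2
        - ((gap H ^ 2 / (600 * d * η ^ 2) : ℝ) : ℂ) •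
          (1 : Matrix (LocIndex d L k ρ) (LocIndex d L k ρ) ℂ)).PosSemidef) ∧
    (∀ (η η' : ℝ) (ρ ρ' : ℕ) (h : Admissible H R p η ρ) (h' : Admissible H R p η' ρ'),
      signature (perLocalizer H γ η ρ)
          (perLocalizer_isHermitian hH hp h.period_dvd γ η)
        = signature (perLocalizer H γ η' ρ')
          (perLocalizer_isHermitian hH hp h'.period_dvd γ η')) := by
  have hS : IsGappedPeriodic H R p := ⟨hL, hH, hgap, hR, hp⟩
  have hΓ := isOddCliffordRep_gammaHat hγ hcl
  exact ⟨fun η ρ h => h.posSemidef_perLocalizer_sq_sub hS hΓ hd,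
    fun η η' ρ ρ' h h' => h.signature_perLocalizer_eq h' hS hΓ hd⟩

theorem mainTheorem4 {d L k : ℕ} (hd : Even d) (hd0 : 0 < d) (hL : 0 < L)
    (H : Hilb d L →L[ℂ] Hilb d L) (hH : IsSelfAdjoint H) (hgap : (0 : ℂ) ∉ spectrum ℂ H)
    (R : ℝ) (hR : HasFiniteRange H R)
    (p : Fin d → ℕ) (hp0 : ∀ j, 0 < p j) (hp : IsPeriodic H p)
    (γ : Fin (d - 1) → Matrix (Fin k) (Fin k) ℂ) (hγ : IsIrredCliffordRep γ) :
    (∀ (η : ℝ) (ρ : ℕ), Admissible H R p η ρ →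
      (perLocalizer H γ η ρ ^ 2
        - ((gap H ^ 2 / (600 * d * η ^ 2) : ℝ) : ℂ) •
          (1 : Matrix (LocIndex d L k ρ) (LocIndex d L k ρ) ℂ)).PosSemidef) ∧
    (∀ (η η' : ℝ) (ρ ρ' : ℕ) (h : Admissible H R p η ρ) (h' : Admissible H R p η' ρ'),
      signature (perLocalizer H γ η ρ)
          (perLocalizer_isHermitian hH hp h.period_dvd γ η)
        = signature (perLocalizer H γ η' ρ')
          (perLocalizer_isHermitian hH hp h'.period_dvd γ η')) :=
  mainTheorem4_general hd0 hL H hH hgap R hR p hp γ hγ.selfadjoint hγ.clifford
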